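/- **Lemma 4.1.** Let $U=[0,2\pi)$; all functions of $x$ are $2\pi$-periodic, and $H^m(U)$ is the periodic Sobolev space. Let $D=t\partial_t$, let $k:U\to(0,\infty)$ be $C^\infty$, and put $\lambda^{(1)}=0$, $\lambda^{(2)}=-2k$. *Spaces.* Let $\delta>0$, $l\ge 0$ an integer and $a=(a_1,a_2)$ with $a_i:U\to(0,\infty)$ continuous. For $w=(w^{(1)},w^{(2)})$ with $w^{(i)}\in\bigcap_{p=0}^{l}C^p((0,\delta],H^{l-p}(U))$ and $0\le p\le l$, $0<t\le\delta$, set $$S_{p}[w](t)=\sum_{i=1}^{2}\sum_{p'=0}^{p}\sum_{q=0}^{l-p}\int_U t^{2(\lambda^{(i)}(x)-a_i(x))}\,\bigl|\partial_x^qD^{p'}w^{(i)}(t,x)\bigr|^2\,dx,$$ $$E_{\delta,a,l}[w](t)=\Bigl(\sum_{p=0}^{l}S_p[w](t)\Bigr)^{1/2},\qquad \|w\|_{\delta,a,l}=\Bigl(\sum_{p=0}^{l}\,\sup_{0<t\le\delta}S_p[w](t)\Bigr)^{1/2},$$ and let $X_{\delta,a,l}$ be the space of all such $w$ with $\|w\|_{\delta,a,l}<\infty$.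 Define $\tilde E_{\delta,a,l}[w]$, $\|w\|^{\sim}_{\delta,a,l}$ and $\tilde X_{\delta,a,l}$ in the same way, except that each highest spatial derivative $\partial_x^l w^{(i)}$ is multiplied by the additional factor $t$ (that is, $|\partial_x^l w^{(i)}|^2$ is replaced by $t^2|\partial_x^l w^{(i)}|^2$). *Hypotheses.* Let $m\ge 2$ and let $P_*,P_{**},Q_*,Q_{**}\in H^m(U)$, where $P_*$ is identified with its continuous periodic representative. Suppose that $0<\epsilon<1$ and that $\alpha=(\alpha_1,\alpha_2):U\to(0,\infty)^2$ is continuous and periodic, and that at each $x\in U$ $$\alpha_1+\epsilon<\min\bigl(2(P_*+2k),\,2(P_*+1)\bigr),\qquad \alpha_2+\epsilon<2(1-k),\qquad \alpha_1-\alpha_2>\epsilon+\max(0,\,2k-1).$$ *Source operator.* For $w=(w^{(1)},w^{(2)})$ let $F[w]=(F_1[w],F_2[w])$ with $$R=2k\,t^{2k}Q_{**}+Dw^{(2)},\qquad S=t\,\partial_xQ_*+2\,\partial_xk\,t^{2k}\,t\log t\,Q_{**}+t^{2k}\,t\,\partial_xQ_{**}+t\,\partial_xw^{(2)},$$ $$F_1[w]=\bigl(t^{P_*}e^{P_{**}}e^{w^{(1)}}R\bigr)^2-\bigl(t^{P_*}e^{P_{**}}e^{w^{(1)}}S\bigr)^2,$$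 $$F_2[w]=-2\,Dw^{(1)}\,R+2\bigl(t\,\partial_xP_*\log t+t\,\partial_xP_{**}+t\,\partial_xw^{(1)}\bigr)S .$$ *Conclusion.* For every $\delta>0$, $F$ maps $\tilde X_{\delta,\alpha,m}$ into $X_{\delta,\alpha+\epsilon,m-1}$, where $\alpha+\epsilon=(\alpha_1+\epsilon,\alpha_2+\epsilon)$. Moreover, for every $\delta_0>0$ and every $r>0$ there is a constant $C>0$ such that, for all $\delta\in(0,\delta_0]$, $$E_{\delta,\alpha+\epsilon,m-1}\bigl[F[w]-F[\hat w]\bigr](t)\le C\,\tilde E_{\delta,\alpha,m}[w-\hat w](t)\qquad\text{for all } t\in(0,\delta]$$ and all $w,\hat w\in\tilde X_{\delta,\alpha,m}$ with $\|w\|^{\sim}_{\delta,\alpha,m}\le r$ and $\|\hat w\|^{\sim}_{\delta,\alpha,m}\le r$. In particular, on each bounded range of $\delta$ the constant does not depend on $\delta$. -/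

import Mathlib

open MeasureTheory Set
open scoped ENNReal ContDiff

noncomputable section

namespace GowdyFuchs

/-- Lebesgue measure on one period of the spatial variable; `U` is the periodicity domain of
length `2π` (the choice of the included endpoint is immaterial). -/
abbrev measU : Measure ℝ := volume.restrict (Ioc 0 (2 * Real.pi))

/-- The real Hilbert space `L²(U)`. -/
abbrev L2U : Type := Lp ℝ 2 measU

/-- `g` is the weak derivative of `f` on the circle: test functions are the smooth functions that
are periodic with period `2π`. -/
def HasWeakDeriv (f g : L2U) : Prop :=
  ∀ φ : ℝ → ℝ, ContDiff ℝ ∞ φ → Function.Periodic φ (2 * Real.pi) →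
    ∫ x, f x * deriv φ x ∂measU = - ∫ x, g x * φ x ∂measU

theorem integrable_mul_cont (f : L2U) {φ : ℝ → ℝ} (hφ : Continuous φ) :
    Integrable (fun x => f x * φ x) measU := by
  have h1 : MemLp φ ∞ measU := by
    obtain ⟨C, hC⟩ := (isCompact_Icc (a := (0 : ℝ)) (b := 2 * Real.pi)).exists_bound_of_continuousOn
      hφ.continuousOn
    refine memLp_top_of_bound hφ.aestronglyMeasurable C ?_
    filter_upwards [ae_restrict_mem measurableSet_Ioc] with x hx
    exact hC x (Ioc_subset_Icc_self hx)
  have h2 : Integrable (f : ℝ → ℝ) measU := (Lp.memLp f).integrable (by norm_num)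
  exact h2.mul_of_top_left h1

theorem HasWeakDeriv.add {f g f' g' : L2U} (h : HasWeakDeriv f g) (h' : HasWeakDeriv f' g') :
    HasWeakDeriv (f + f') (g + g') := by
  intro φ hφ hp
  have hd : Continuous (deriv φ) := hφ.continuous_deriv (by simp)
  have e1 : ∫ x, (f + f' : L2U) x * deriv φ x ∂measU
      = ∫ x, f x * deriv φ x + f' x * deriv φ x ∂measU := by
    refine integral_congr_ae ?_
    filter_upwards [Lp.coeFn_add f f'] with x hx
    rw [hx, Pi.add_apply, add_mul]
  have e2 : ∫ x, (g + g' : L2U) x * φ x ∂measU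
      = ∫ x, g x * φ x + g' x * φ x ∂measU := by
    refine integral_congr_ae ?_
    filter_upwards [Lp.coeFn_add g g'] with x hx
    rw [hx, Pi.add_apply, add_mul]
  rw [e1, e2, integral_add (integrable_mul_cont f hd) (integrable_mul_cont f' hd),
    integral_add (integrable_mul_cont g hφ.continuous) (integrable_mul_cont g' hφ.continuous),
    h φ hφ hp, h' φ hφ hp]
  ring

theorem HasWeakDeriv.smul {f g : L2U} (c : ℝ) (h : HasWeakDeriv f g) :
    HasWeakDeriv (c • f) (c • g) := by
  intro φ hφ hp
  have e1 : ∫ x, (c • f : L2U) x * deriv φ x ∂measU = ∫ x, c * (f x * deriv φ x) ∂measU := by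
    refine integral_congr_ae ?_
    filter_upwards [Lp.coeFn_smul c f] with x hx
    rw [hx, Pi.smul_apply, smul_eq_mul, mul_assoc]
  have e2 : ∫ x, (c • g : L2U) x * φ x ∂measU = ∫ x, c * (g x * φ x) ∂measU := by
    refine integral_congr_ae ?_
    filter_upwards [Lp.coeFn_smul c g] with x hx
    rw [hx, Pi.smul_apply, smul_eq_mul, mul_assoc]
  rw [e1, e2, integral_const_mul, integral_const_mul, h φ hφ hp]
  ring

theorem HasWeakDeriv.zero : HasWeakDeriv 0 0 := by
  intro φ hφ hp
  have h : ∀ ψ : ℝ → ℝ, ∫ x, (0 : L2U) x * ψ x ∂measU = 0 := by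
    intro ψ
    rw [← integral_zero ℝ ℝ (μ := measU)]
    refine integral_congr_ae ?_
    filter_upwards [Lp.coeFn_zero ℝ 2 measU] with x hx
    rw [hx, Pi.zero_apply, zero_mul]
  rw [h, h, neg_zero]

/-- The periodic Sobolev space `H^m(U)`. An element `f` is recorded as `(f, ∂ₓf, …, ∂ₓ^m f)`, each
entry being the weak derivative of the preceding one, so that the inherited norm is
`(∑_{q ≤ m} ‖∂ₓ^q f‖²_{L²})^{1/2}`. -/
def Sobolev (m : ℕ) : Submodule ℝ (PiLp 2 fun _ : Fin (m + 1) => L2U) where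
  carrier := {u | ∀ q : Fin m, HasWeakDeriv (u q.castSucc) (u q.succ)}
  add_mem' := fun ha hb q => (ha q).add (hb q)
  zero_mem' := fun _ => HasWeakDeriv.zero
  smul_mem' := fun c _ ha q => (ha q).smul c

/-- The function underlying an element of `H^m(U)`. -/
def sobFn {m : ℕ} (u : Sobolev m) : L2U := u.1 0

/-- `f ∈ H^m(U)`, for a function `f`. -/
def MemSobolev (m : ℕ) (f : ℝ → ℝ) : Prop := ∃ u : Sobolev m, f =ᵐ[measU] sobFn u

open Classical in
/-- The class in `L²(U)` of a square integrable function (and `0` for other functions). -/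
def toL2 (f : ℝ → ℝ) : L2U := if h : MemLp f 2 measU then h.toLp f else 0

open Classical in
/-- The weak derivative `∂ₓ f` of `f ∈ L²(U)` (and `0` if there is none in `L²(U)`). -/
def wderiv (f : L2U) : L2U := if h : ∃ g, HasWeakDeriv f g then h.choose else 0

/-- The weak derivative of a function of `x`. -/
def dx (f : ℝ → ℝ) : ℝ → ℝ := wderiv (toL2 f)

/-- `D = t ∂_t` on `L²(U)`-valued functions on `(0,δ]` (one-sided derivative at `t = δ`). -/
def DL2 (δ : ℝ) (c : ℝ → L2U) : ℝ → L2U := fun t => t • derivWithin c (Ioc 0 δ) t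

/-- `∂ₓ^q D^p w (t)` in `L²(U)`, for a function `w = w(t,x)` on `(0,δ] × U`. -/
def mixedDeriv (δ : ℝ) (p q : ℕ) (w : ℝ → ℝ → ℝ) (t : ℝ) : L2U :=
  wderiv^[q] ((DL2 δ)^[p] (fun s => toL2 (w s)) t)

/-- `w ∈ C^p((0,δ], H^j(U))`, for a function `w = w(t,x)`. -/
def MemC (δ : ℝ) (p j : ℕ) (w : ℝ → ℝ → ℝ) : Prop :=
  ∃ W : ℝ → Sobolev j, ContDiffOn ℝ p W (Ioc 0 δ) ∧ ∀ t ∈ Ioc 0 δ, w t =ᵐ[measU] sobFn (W t)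

/-- The quantity
`∑_i ∑_{p' ≤ p} ∑_{q ≤ j} ∫_U t^{2(λ^{(i)}(x) - α^{(i)}(x) + s(q))} |∂ₓ^q D^{p'} w^{(i)}(t,x)|² dx`
for vector-valued `w`, where `s q` is an additional exponent of the weight of `∂ₓ^q`.
For `s = 0` its supremum over `t ∈ (0,δ]` is the square of `‖w‖_{δ,α,p,j}`. -/
def slice {n : ℕ} (δ : ℝ) (lam al : Fin n → ℝ → ℝ) (s : ℕ → ℝ) (p j : ℕ)
    (w : Fin n → ℝ → ℝ → ℝ) (t : ℝ) : ℝ :=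
  ∑ i, ∑ p' ∈ Finset.range (p + 1), ∑ q ∈ Finset.range (j + 1),
    ∫ x, t ^ (2 * (lam i x - al i x + s q)) * (mixedDeriv δ p' q (w i) t x) ^ 2 ∂measU

/-- `(∑_{p ≤ l} slice_{p,l-p}(t))^{1/2}`: the norm before the supremum in `t` is taken. -/
def energy {n : ℕ} (δ : ℝ) (lam al : Fin n → ℝ → ℝ) (s : ℕ → ℝ) (l : ℕ)
    (w : Fin n → ℝ → ℝ → ℝ) (t : ℝ) : ℝ :=
  Real.sqrt (∑ p ∈ Finset.range (l + 1), slice δ lam al s p (l - p) w t)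

/-- `(∑_{p ≤ l} ‖w‖²_{δ,α,p,l-p})^{1/2}`, with values in `[0,∞]`. -/
def wnorm {n : ℕ} (δ : ℝ) (lam al : Fin n → ℝ → ℝ) (s : ℕ → ℝ) (l : ℕ)
    (w : Fin n → ℝ → ℝ → ℝ) : ℝ≥0∞ :=
  (∑ p ∈ Finset.range (l + 1),
    (⨆ t ∈ Ioc 0 δ, ENNReal.ofReal (Real.sqrt (slice δ lam al s p (l - p) w t))) ^ 2) ^ (1 / 2 : ℝ)

/-- The additional exponent in the spaces with a tilde: the highest spatial derivative `∂ₓ^l` gets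
the additional factor `t^{β+1}`, where `β = 0` because the characteristic speeds of both Gowdy
equations are identically `1`. -/
def topWeight (l : ℕ) (q : ℕ) : ℝ := if q = l then 1 else 0

/-- The function `E_{δ,α,l}[w]` on `(0,δ]`. -/
def E {n : ℕ} (δ : ℝ) (lam al : Fin n → ℝ → ℝ) (l : ℕ) (w : Fin n → ℝ → ℝ → ℝ) : ℝ → ℝ :=
  energy δ lam al 0 l w

/-- The function `Ẽ_{δ,α,l}[w]` on `(0,δ]`. -/
def Et {n : ℕ} (δ : ℝ) (lam al : Fin n → ℝ → ℝ) (l : ℕ) (w : Fin n → ℝ → ℝ → ℝ) : ℝ → ℝ :=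
  energy δ lam al (topWeight l) l w

/-- The norm of `X_{δ,α,l}`. -/
def normX {n : ℕ} (δ : ℝ) (lam al : Fin n → ℝ → ℝ) (l : ℕ) (w : Fin n → ℝ → ℝ → ℝ) : ℝ≥0∞ :=
  wnorm δ lam al 0 l w

/-- The norm of `X̃_{δ,α,l}`. -/
def normXt {n : ℕ} (δ : ℝ) (lam al : Fin n → ℝ → ℝ) (l : ℕ) (w : Fin n → ℝ → ℝ → ℝ) : ℝ≥0∞ :=
  wnorm δ lam al (topWeight l) l w

/-- The space `X_{δ,α,l}` (of functions, two of which are identified if for each `t ∈ (0,δ]` they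
agree almost everywhere in `U`). -/
def X {n : ℕ} (δ : ℝ) (lam al : Fin n → ℝ → ℝ) (l : ℕ) : Set (Fin n → ℝ → ℝ → ℝ) :=
  {w | (∀ i, ∀ p ≤ l, MemC δ p (l - p) (w i)) ∧ normX δ lam al l w < ⊤}

/-- The space `X̃_{δ,α,l}`. -/
def Xt {n : ℕ} (δ : ℝ) (lam al : Fin n → ℝ → ℝ) (l : ℕ) : Set (Fin n → ℝ → ℝ → ℝ) :=
  {w | (∀ i, ∀ p ≤ l, MemC δ p (l - p) (w i)) ∧ normXt δ lam al l w < ⊤}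

/-- The root functions `λ₂` of the two Gowdy equations. -/
def gowdyLam (k : ℝ → ℝ) : Fin 2 → ℝ → ℝ := ![fun _ => 0, fun x => -2 * k x]

/-- `D w` as a function of `(t,x)`. -/
def Dt (δ : ℝ) (w : ℝ → ℝ → ℝ) (t x : ℝ) : ℝ := DL2 δ (fun s => toL2 (w s)) t x

/-- The source-term operator `F = (F₁, F₂)` for the asymptotic data
`Ps = P_*`, `Pss = P_{**}`, `Qs = Q_*`, `Qss = Q_{**}`. -/
def gowdyF (δ : ℝ) (k Ps Pss Qs Qss : ℝ → ℝ) (w : Fin 2 → ℝ → ℝ → ℝ) : Fin 2 → ℝ → ℝ → ℝ :=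
  ![fun t x =>
      (t ^ Ps x * Real.exp (Pss x) * Real.exp (w 0 t x) *
        (2 * k x * t ^ (2 * k x) * Qss x + Dt δ (w 1) t x)) ^ 2
      - (t ^ Ps x * Real.exp (Pss x) * Real.exp (w 0 t x) *
        (t * dx Qs x + 2 * deriv k x * t ^ (2 * k x) * t * Real.log t * Qss x
          + t ^ (2 * k x) * t * dx Qss x + t * dx (w 1 t) x)) ^ 2,
    fun t x =>
      -2 * Dt δ (w 0) t x * (2 * k x * t ^ (2 * k x) * Qss x + Dt δ (w 1) t x)
      + 2 * (t * dx Ps x * Real.log t + t * dx Pss x + t * dx (w 0 t) x) *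
        (t * dx Qs x + 2 * deriv k x * t ^ (2 * k x) * t * Real.log t * Qss x
          + t ^ (2 * k x) * t * dx Qss x + t * dx (w 1 t) x)]

end GowdyFuchs

end

open GowdyFuchs

noncomputable section

namespace GowdyFuchs

open Filter Topology

/-! Every term of `F[w]` is a product of factors whose size is a power `t^κ(x)` with continuous
exponent `κ`. Such orders add under multiplication up to an arbitrarily small loss in the exponent,
and the loss is harmless because the hypotheses on `α` are strict inequalities between continuous
functions. What remains is to compute the exponents.

The analytic core is a weighted embedding `H¹ ⊂ L^∞` in one space dimension (`exists_sup_le`): if `ρ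
< μ`, then `|f(x)| ≤ C t^ρ(x) (‖t^{-μ} f‖ + ‖t^{-μ} ∂ₓf‖)`. The weight is never differentiated,
since `μ` is only continuous; instead one averages over an interval so short that `μ` oscillates by
less than the gap `μ - ρ`. With the Leibniz rule this makes the weighted norms of all derivatives
`∂ₓ^q D^p`, `p + q ≤ n`, multiplicative with loss (`exists_NN_mul_le`). Powers `t^f = exp(f log t)`
and exponentials are treated by the chain rule together with a pointwise bound (`DomL.pe`).

Put `m = n + 1`. For `w` in the tilde space, each of `w`, `D w` and `t ∂ₓ w` has `n` derivatives of
order `α - λ` (`Dom.of_tilde`): `F` contains `∂ₓ w` only through `t ∂ₓ w`, and this `t` is the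
factor attached to the top spatial derivative in the tilde norm. Numbering components from `0` as in
the code, `R` has order `2k`, `S` has order `min(1, α 1 + 2k)`, and the bracket multiplying `S` in
the second component has order `min(1, α 0)`. So the components of `F` have orders `2(P_* + min(1,
2k))` and `min(α 0 + 2k, min(1, α 0) + min(1, α 1 + 2k))`, which exceed the required `α + ε - λ` by
the hypotheses.

For the Lipschitz estimate the same calculus is run on pairs (`LipDom`): both members have order `κ`
with size `1`, and their difference has order `κ` with size `B`, where `B` is the tilde energy of `w
- ŵ` at time `t`. Uniformity in `δ`, `t`, `w`, `ŵ` comes from working with arbitrary indexed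
families of such data (`Fam`): each constant is chosen before the index. -/

/-! ### Classes in L²(U) and integration over one period -/

theorem toL2_coe {f : ℝ → ℝ} (h : MemLp f 2 measU) : toL2 f =ᵐ[measU] f := by
  rw [toL2, dif_pos h]
  exact h.coeFn_toLp

theorem toL2_self (f : L2U) : toL2 f = f := by
  rw [toL2, dif_pos (Lp.memLp f)]
  exact Lp.toLp_coeFn f _

theorem toL2_congr {f g : ℝ → ℝ} (h : f =ᵐ[measU] g) : toL2 f = toL2 g := by
  by_cases hf : MemLp f 2 measU
  · have hg : MemLp g 2 measU := hf.ae_eq h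
    rw [toL2, toL2, dif_pos hf, dif_pos hg]
    exact (MemLp.toLp_eq_toLp_iff hf hg).2 h
  · have hg : ¬ MemLp g 2 measU := fun hg => hf (hg.ae_eq h.symm)
    rw [toL2, toL2, dif_neg hf, dif_neg hg]

theorem toL2_eq {f : ℝ → ℝ} {g : L2U} (h : f =ᵐ[measU] g) : toL2 f = g := by
  rw [toL2_congr h, toL2_self]

theorem toL2_add {f g : ℝ → ℝ} (hf : MemLp f 2 measU) (hg : MemLp g 2 measU) :
    toL2 (f + g) = toL2 f + toL2 g := by
  refine toL2_eq ?_
  filter_upwards [Lp.coeFn_add (toL2 f) (toL2 g), toL2_coe hf, toL2_coe hg] with x h1 h2 h3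
  rw [h1, Pi.add_apply, Pi.add_apply, h2, h3]

theorem toL2_sub {f g : ℝ → ℝ} (hf : MemLp f 2 measU) (hg : MemLp g 2 measU) :
    toL2 (f - g) = toL2 f - toL2 g := by
  refine toL2_eq ?_
  filter_upwards [Lp.coeFn_sub (toL2 f) (toL2 g), toL2_coe hf, toL2_coe hg] with x h1 h2 h3
  rw [h1, Pi.sub_apply, Pi.sub_apply, h2, h3]

theorem toL2_zero : toL2 (fun _ => 0) = 0 :=
  toL2_eq (Lp.coeFn_zero ℝ 2 measU).symm

theorem two_pi_pos' : (0 : ℝ) < 2 * Real.pi := by positivity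

theorem ae_measU_of_mem {p : ℝ → Prop} (h : ∀ x ∈ Icc 0 (2 * Real.pi), p x) :
    ∀ᵐ x ∂measU, p x := by
  filter_upwards [ae_restrict_mem measurableSet_Ioc] with x hx
  exact h x (Ioc_subset_Icc_self hx)

theorem ae_measU_of_ae {p : ℝ → Prop} (h : ∀ᵐ x, x ∈ uIcc 0 (2 * Real.pi) → p x) :
    ∀ᵐ x ∂measU, p x := by
  filter_upwards [ae_restrict_mem measurableSet_Ioc, ae_restrict_of_ae h] with x hx h'
  exact h' (by rw [uIcc_of_le two_pi_pos'.le]; exact Ioc_subset_Icc_self hx)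

theorem integral_measU (f : ℝ → ℝ) : ∫ x, f x ∂measU = ∫ x in (0 : ℝ)..(2 * Real.pi), f x := by
  rw [intervalIntegral.integral_of_le two_pi_pos'.le]

theorem L2U.integrable (f : L2U) : Integrable (f : ℝ → ℝ) measU :=
  (Lp.memLp f).integrable (by norm_num)

theorem L2U.intervalIntegrable (f : L2U) :
    IntervalIntegrable (f : ℝ → ℝ) volume 0 (2 * Real.pi) := by
  rw [intervalIntegrable_iff_integrableOn_Ioc_of_le two_pi_pos'.le]
  exact L2U.integrable f

theorem memLp_of_continuousOn {p : ℝ≥0∞} {F : ℝ → ℝ} (hF : ContinuousOn F (Icc 0 (2 * Real.pi))) :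
    MemLp F p measU := by
  obtain ⟨C, hC⟩ := (isCompact_Icc (a := (0 : ℝ)) (b := 2 * Real.pi)).exists_bound_of_continuousOn
    hF
  exact MemLp.of_bound ((hF.mono Ioc_subset_Icc_self).aestronglyMeasurable measurableSet_Ioc) C
    (ae_measU_of_mem hC)

/-! ### Periodic test functions; uniqueness and closedness of the weak derivative -/

/-- A smooth function supported inside one period extends periodically. -/
theorem exists_periodic_extension {χ : ℝ → ℝ} (hχ : ContDiff ℝ ∞ χ)
    (hs : tsupport χ ⊆ Ioo 0 (2 * Real.pi)) :
    ∃ ψ : ℝ → ℝ, ContDiff ℝ ∞ ψ ∧ Function.Periodic ψ (2 * Real.pi) ∧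
      ∀ x ∈ Ioc 0 (2 * Real.pi), ψ x = χ x := by
  set L := 2 * Real.pi with hL
  have hLp : 0 < L := two_pi_pos'
  let ψ : ℝ → ℝ := fun x => χ (toIocMod hLp 0 x)
  have hper : Function.Periodic ψ L := fun x => by simp [ψ]
  have heq : ∀ x ∈ Ioc 0 L, ψ x = χ x := fun x hx => by
    simp only [ψ]
    rw [(toIocMod_eq_self hLp).2 (by simpa using hx)]
  refine ⟨ψ, ?_, hper, heq⟩
  have key : ∀ y ∈ Ioc 0 L, ContDiffAt ℝ ∞ ψ y := by
    intro y hy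
    rcases hy.2.lt_or_eq with h | h
    · refine hχ.contDiffAt.congr_of_eventuallyEq ?_
      filter_upwards [Ioo_mem_nhds hy.1 h] with x hx
      exact heq x ⟨hx.1, hx.2.le⟩
    -- At the gluing point `y = L` the extension vanishes nearby on both sides, since the support of
    -- `χ` stays away from `L` and from `0`.
    · refine (contDiffAt_const (c := (0 : ℝ))).congr_of_eventuallyEq ?_
      have n1 : ∀ᶠ x in 𝓝 y, x ∉ tsupport χ :=
        (isClosed_tsupport χ).isOpen_compl.mem_nhds (fun h' => (hs h').2.ne h)
      have n2 : ∀ᶠ x in 𝓝 y, x - L ∉ tsupport χ := by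
        have : Tendsto (fun x => x - L) (𝓝 y) (𝓝 0) := by
          have hc : Continuous fun x : ℝ => x - L := by fun_prop
          simpa [h] using hc.tendsto y
        exact this.eventually ((isClosed_tsupport χ).isOpen_compl.mem_nhds
          (fun h' => (hs h').1.ne rfl))
      filter_upwards [n1, n2, Ioo_mem_nhds hy.1 (show y < y + L by linarith)] with x h1 h2 h3
      rcases le_or_gt x L with h4 | h4
      · rw [heq x ⟨h3.1, h4⟩]
        exact image_eq_zero_of_notMem_tsupport h1
      · rw [← hper.sub_eq x, heq (x - L) ⟨by linarith, by linarith [h3.2]⟩]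
        exact image_eq_zero_of_notMem_tsupport h2
  rw [contDiff_iff_contDiffAt]
  intro x
  have h1 := key (toIocMod hLp 0 x) (by simpa using toIocMod_mem_Ioc hLp 0 x)
  have h2 : ψ = ψ ∘ fun z => z - toIocDiv hLp 0 x • L := by
    funext z
    exact (hper.sub_zsmul_eq (toIocDiv hLp 0 x)).symm
  rw [h2]
  refine ContDiffAt.comp x ?_ (contDiffAt_id.sub contDiffAt_const)
  have : x - toIocDiv hLp 0 x • L = toIocMod hLp 0 x := by
    rw [toIocMod]
  simpa [this] using h1

/-- Every test function supported inside the open period extends periodically, so periodic test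
functions suffice for the fundamental lemma of the calculus of variations on `Ioo`; the endpoint is
a null set. -/
theorem ae_eq_zero_of_forall_test {h : ℝ → ℝ} (hi : Integrable h measU)
    (H : ∀ ψ : ℝ → ℝ, ContDiff ℝ ∞ ψ → Function.Periodic ψ (2 * Real.pi) →
      ∫ x, h x * ψ x ∂measU = 0) : h =ᵐ[measU] 0 := by
  have hloc : LocallyIntegrableOn h (Ioo 0 (2 * Real.pi)) volume :=
    IntegrableOn.locallyIntegrableOn (IntegrableOn.mono_set hi Ioo_subset_Ioc_self)
  have := isOpen_Ioo.ae_eq_zero_of_integral_contDiff_smul_eq_zero hloc (by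
    intro χ hχ _ hs
    obtain ⟨ψ, h1, h2, h3⟩ := exists_periodic_extension hχ hs
    rw [← H ψ h1 h2, ← setIntegral_eq_integral_of_forall_compl_eq_zero (s := Ioc 0 (2 * Real.pi))]
    · refine setIntegral_congr_fun measurableSet_Ioc fun x hx => ?_
      simp only [smul_eq_mul]
      rw [h3 x hx, mul_comm]
    · intro x hx
      rw [image_eq_zero_of_notMem_tsupport (fun h' => hx (Ioo_subset_Ioc_self (hs h'))), zero_smul])
  have h2 : ∀ᵐ x ∂(volume.restrict (Ioo 0 (2 * Real.pi))), h x = 0 := by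
    rw [ae_restrict_iff' measurableSet_Ioo]
    exact this
  rwa [restrict_Ioo_eq_restrict_Ioc] at h2

theorem integral_mul_eq_inner (f : L2U) {φ : ℝ → ℝ} (hφ : Continuous φ) :
    ∫ x, f x * φ x ∂measU = inner ℝ (toL2 φ) f := by
  rw [L2.inner_def]
  refine integral_congr_ae ?_
  filter_upwards [toL2_coe (memLp_of_continuousOn hφ.continuousOn)] with x hx
  rw [hx]; simp

theorem HasWeakDeriv.unique {f g g' : L2U} (h : HasWeakDeriv f g) (h' : HasWeakDeriv f g') :
    g = g' := by
  have : (fun x => g x - g' x) =ᵐ[measU] 0 := by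
    refine ae_eq_zero_of_forall_test ((L2U.integrable g).sub (L2U.integrable g')) ?_
    intro ψ h1 h2
    simp only [sub_mul]
    rw [integral_sub (integrable_mul_cont g h1.continuous) (integrable_mul_cont g' h1.continuous)]
    linarith [h ψ h1 h2, h' ψ h1 h2]
  refine Lp.ext ?_
  filter_upwards [this] with x hx
  exact sub_eq_zero.1 hx

theorem HasWeakDeriv.wderiv_eq {f g : L2U} (h : HasWeakDeriv f g) : wderiv f = g := by
  have h' : ∃ g, HasWeakDeriv f g := ⟨g, h⟩
  rw [wderiv, dif_pos h']
  exact h'.choose_spec.unique h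

theorem HasWeakDeriv.self {f g : L2U} (h : HasWeakDeriv f g) : HasWeakDeriv f (wderiv f) := by
  rw [h.wderiv_eq]; exact h

theorem HasWeakDeriv.neg {f g : L2U} (h : HasWeakDeriv f g) : HasWeakDeriv (-f) (-g) := by
  simpa using h.smul (-1)

theorem HasWeakDeriv.sub {f g f' g' : L2U} (h : HasWeakDeriv f g) (h' : HasWeakDeriv f' g') :
    HasWeakDeriv (f - f') (g - g') := by
  simpa [sub_eq_add_neg] using h.add h'.neg

/-- Both sides of the defining identity are inner products with fixed elements of `L²(U)`, so the
graph of `∂ₓ` is closed. This lets `∂ₓ` pass to limits of difference quotients in `t`. -/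
theorem HasWeakDeriv.of_tendsto {ι : Type*} {l : Filter ι} [l.NeBot] {f g : ι → L2U} {f' g' : L2U}
    (h : ∀ᶠ i in l, HasWeakDeriv (f i) (g i)) (hf : Tendsto f l (𝓝 f')) (hg : Tendsto g l (𝓝 g')) :
    HasWeakDeriv f' g' := by
  intro φ h1 h2
  have hd : Continuous (deriv φ) := h1.continuous_deriv (by simp)
  rw [integral_mul_eq_inner f' hd, integral_mul_eq_inner g' h1.continuous]
  have e1 : Tendsto (fun i => inner ℝ (toL2 (deriv φ)) (f i)) l
      (𝓝 (inner ℝ (toL2 (deriv φ)) f')) := tendsto_const_nhds.inner hf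
  have e2 : Tendsto (fun i => -inner ℝ (toL2 φ) (g i)) l
      (𝓝 (-inner ℝ (toL2 φ) g')) := (tendsto_const_nhds.inner hg).neg
  refine tendsto_nhds_unique (e1.congr' ?_) e2
  filter_upwards [h] with i hi
  rw [← integral_mul_eq_inner _ hd, ← integral_mul_eq_inner _ h1.continuous, hi φ h1 h2]

/-! ### Absolutely continuous periodic representatives -/

/-- `F` is an absolutely continuous periodic representative of `f` with derivative `g`. -/
structure IsRep (F : ℝ → ℝ) (f g : L2U) : Prop where
  ac : AbsolutelyContinuousOnInterval F 0 (2 * Real.pi)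
  per : F (2 * Real.pi) = F 0
  eq : f =ᵐ[measU] F
  der : ∀ᵐ x ∂measU, HasDerivAt F (g x) x

/-- Integration by parts over one period, the boundary terms cancelling by periodicity. Together
with `HasWeakDeriv.exists_rep` it reduces product and chain rules for weak derivatives to classical
ones almost everywhere. -/
theorem IsRep.hasWeakDeriv {F : ℝ → ℝ} {f g : L2U} (h : IsRep F f g) : HasWeakDeriv f g := by
  intro φ h1 h2
  have hac : AbsolutelyContinuousOnInterval φ 0 (2 * Real.pi) :=
    ((h1.of_le (by simp)).contDiffOn).absolutelyContinuousOnInterval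
  have e1 : ∫ x, f x * deriv φ x ∂measU = ∫ x, F x * deriv φ x ∂measU := by
    refine integral_congr_ae ?_
    filter_upwards [h.eq] with x hx
    rw [hx]
  have e2 : ∫ x, g x * φ x ∂measU = ∫ x, deriv F x * φ x ∂measU := by
    refine integral_congr_ae ?_
    filter_upwards [h.der] with x hx
    rw [hx.deriv]
  rw [e1, e2, integral_measU, integral_measU, h.ac.integral_mul_deriv_eq_deriv_mul hac, h.per]
  have : φ (2 * Real.pi) = φ 0 := by simpa using h2 0
  rw [this]
  ring

/-- Du Bois-Reymond on the circle: `f` minus the primitive of `g` has weak derivative zero, hence is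
constant. -/
theorem HasWeakDeriv.exists_rep {f g : L2U} (h : HasWeakDeriv f g) : ∃ F, IsRep F f g := by
  let G : ℝ → ℝ := fun x => ∫ y in (0 : ℝ)..x, g y
  have hgi := L2U.intervalIntegrable g
  -- Testing with the constant `1` shows that `g` has mean zero, so its primitive `G` is periodic.
  have g0 : ∫ x in (0 : ℝ)..(2 * Real.pi), g x = 0 := by
    have := h (fun _ => 1) contDiff_const (fun _ => rfl)
    simp only [deriv_const, mul_zero, mul_one, integral_zero] at this
    rw [← integral_measU]; linarith
  have Gac : AbsolutelyContinuousOnInterval G 0 (2 * Real.pi) :=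
    hgi.absolutelyContinuousOnInterval_intervalIntegral (by simp)
  have Gcont : ContinuousOn G (Icc 0 (2 * Real.pi)) := by
    have := Gac.continuousOn
    rwa [uIcc_of_le two_pi_pos'.le] at this
  have Gmem : MemLp G 2 measU := memLp_of_continuousOn Gcont
  have Gder : ∀ᵐ x ∂measU, HasDerivAt G (g x) x := by
    refine ae_measU_of_ae ?_
    filter_upwards [hgi.ae_hasDerivAt_integral] with x hx hx'
    exact hx hx' 0 (by simp)
  have Grep : IsRep G (toL2 G) g := ⟨Gac, by simp [G, g0], toL2_coe Gmem, Gder⟩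
  set d : L2U := f - toL2 G with hd
  have hdw : HasWeakDeriv d 0 := by simpa [hd] using h.sub Grep.hasWeakDeriv
  set c : ℝ := (2 * Real.pi)⁻¹ * ∫ x, d x ∂measU with hc
  have hdi : Integrable (d : ℝ → ℝ) measU := L2U.integrable d
  have hconst : (fun x => d x - c) =ᵐ[measU] 0 := by
    refine ae_eq_zero_of_forall_test (hdi.sub (integrable_const c)) ?_
    intro ψ h1 h2
    -- Only functions of mean zero have periodic primitives, so the mean `e` of `ψ` is removed
    -- before `φ` is formed.
    set e : ℝ := (2 * Real.pi)⁻¹ * ∫ x, ψ x ∂measU with he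
    let φ : ℝ → ℝ := fun x => ∫ y in (0 : ℝ)..x, (ψ y - e)
    have hcont : Continuous fun y => ψ y - e := h1.continuous.sub continuous_const
    have hder : ∀ x, HasDerivAt φ (ψ x - e) x := fun x =>
      intervalIntegral.integral_hasDerivAt_right (hcont.intervalIntegrable _ _)
        (hcont.stronglyMeasurableAtFilter _ _) hcont.continuousAt
    have hderiv : deriv φ = fun x => ψ x - e := funext fun x => (hder x).deriv
    have hφ : ContDiff ℝ ∞ φ := by
      rw [contDiff_infty_iff_deriv, hderiv]
      exact ⟨fun x => (hder x).differentiableAt, h1.sub contDiff_const⟩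
    have hψi : IntervalIntegrable ψ volume 0 (2 * Real.pi) := h1.continuous.intervalIntegrable _ _
    have hφ0 : ∫ y in (0 : ℝ)..(2 * Real.pi), (ψ y - e) = 0 := by
      rw [intervalIntegral.integral_sub hψi intervalIntegrable_const, he, integral_measU]
      simp; field_simp; simp
    have hφp : Function.Periodic φ (2 * Real.pi) := by
      intro x
      have hp : Function.Periodic (fun y => ψ y - e) (2 * Real.pi) := fun y => by
        simp only [h2 y]
      have := hp.intervalIntegral_add_eq x 0
      rw [zero_add, hφ0] at this
      simp only [φ]
      rw [← intervalIntegral.integral_add_adjacent_intervals (hcont.intervalIntegrable 0 x)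
        (hcont.intervalIntegrable x _), this, add_zero]
    have := hdw φ hφ hφp
    rw [hderiv] at this
    have z : ∫ x, (0 : L2U) x * φ x ∂measU = 0 := by
      rw [← integral_zero ℝ ℝ (μ := measU)]
      refine integral_congr_ae ?_
      filter_upwards [Lp.coeFn_zero ℝ 2 measU] with x hx
      rw [hx, Pi.zero_apply, zero_mul]
    rw [z, neg_zero] at this
    have i1 := integrable_mul_cont d h1.continuous
    simp only [mul_sub] at this
    rw [integral_sub i1 (hdi.mul_const e), integral_mul_const] at this
    have hψi' : Integrable ψ measU :=
      (memLp_of_continuousOn (p := 1) h1.continuous.continuousOn).integrable le_rfl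
    simp only [sub_mul]
    rw [integral_sub i1 (hψi'.const_mul c), integral_const_mul]
    have h4 : ∫ x, d x ∂measU = 2 * Real.pi * c := by rw [hc]; field_simp
    have h5 : ∫ x, ψ x ∂measU = 2 * Real.pi * e := by rw [he]; field_simp
    rw [h4] at this
    rw [h5]; linarith
  refine ⟨fun x => c + G x, ?_, ?_, ?_, ?_⟩
  · have : AbsolutelyContinuousOnInterval (fun _ : ℝ => c) 0 (2 * Real.pi) :=
      (contDiffOn_const (c := c)).absolutelyContinuousOnInterval
    exact this.add Gac
  · simp [G, g0]
  · filter_upwards [hconst, Lp.coeFn_sub f (toL2 G), toL2_coe Gmem] with x h1 h2 h3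
    rw [← hd] at h2
    simp only [Pi.zero_apply] at h1
    rw [h2, Pi.sub_apply, h3] at h1
    linarith
  · filter_upwards [Gder] with x hx
    exact hx.const_add c

theorem IsRep.continuousOn {F : ℝ → ℝ} {f g : L2U} (h : IsRep F f g) :
    ContinuousOn F (Icc 0 (2 * Real.pi)) := by
  have := h.ac.continuousOn
  rwa [uIcc_of_le two_pi_pos'.le] at this

theorem IsRep.sub_eq_integral {F : ℝ → ℝ} {f g : L2U} (h : IsRep F f g) {x y : ℝ}
    (hx : x ∈ Icc 0 (2 * Real.pi)) (hy : y ∈ Icc 0 (2 * Real.pi)) :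
    F y - F x = ∫ z in x..y, g z := by
  have hs : uIcc x y ⊆ uIcc 0 (2 * Real.pi) := by
    rw [uIcc_of_le two_pi_pos'.le]
    exact uIcc_subset_Icc hx hy
  rw [← (h.ac.mono hs).integral_deriv_eq_sub]
  refine intervalIntegral.integral_congr_ae ?_
  have := (ae_restrict_iff' measurableSet_Ioc).1 h.der
  filter_upwards [this] with z hz hz'
  refine (hz ?_).deriv
  exact ⟨lt_of_le_of_lt (le_min hx.1 hy.1) hz'.1, hz'.2.trans (max_le hx.2 hy.2)⟩

/-! ### Bounded multipliers; product and chain rules for weak derivatives -/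

/-- The function of `x` is measurable and essentially bounded on one period. -/
def EssBdd (φ : ℝ → ℝ) (B : ℝ) : Prop :=
  AEStronglyMeasurable φ measU ∧ ∀ᵐ x ∂measU, |φ x| ≤ B

theorem HasWeakDeriv.exists_essBdd {f g : L2U} (h : HasWeakDeriv f g) : ∃ B, EssBdd f B := by
  obtain ⟨F, hF⟩ := h.exists_rep
  obtain ⟨C, hC⟩ := (isCompact_Icc (a := (0 : ℝ)) (b := 2 * Real.pi)).exists_bound_of_continuousOn
    hF.continuousOn
  refine ⟨C, (Lp.memLp f).1, ?_⟩
  filter_upwards [hF.eq, ae_measU_of_mem hC] with x h1 h2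
  rw [h1]; exact h2

theorem EssBdd.memLp_mul {φ : ℝ → ℝ} {B : ℝ} (h : EssBdd φ B) {f : ℝ → ℝ} (hf : MemLp f 2 measU) :
    MemLp (fun x => φ x * f x) 2 measU := by
  refine MemLp.of_le_mul (c := B) hf (h.1.mul hf.1) ?_
  filter_upwards [h.2] with x hx
  rw [norm_mul]
  exact mul_le_mul_of_nonneg_right hx (norm_nonneg _)

theorem EssBdd.memLp {φ : ℝ → ℝ} {B : ℝ} (h : EssBdd φ B) : MemLp φ 2 measU :=
  MemLp.of_bound h.1 B h.2

theorem EssBdd.norm_toL2_mul_le {φ : ℝ → ℝ} {B : ℝ} (h : EssBdd φ B) (f : L2U) :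
    ‖toL2 (fun x => φ x * f x)‖ ≤ B * ‖f‖ := by
  refine Lp.norm_le_mul_norm_of_ae_le_mul ?_
  filter_upwards [h.2, toL2_coe (h.memLp_mul (Lp.memLp f))] with x hx h2
  rw [h2, norm_mul]
  exact mul_le_mul_of_nonneg_right hx (norm_nonneg _)

theorem EssBdd.exp {φ : ℝ → ℝ} {B : ℝ} (h : EssBdd φ B) :
    EssBdd (fun x => Real.exp (φ x)) (Real.exp B) := by
  refine ⟨Real.continuous_exp.comp_aestronglyMeasurable h.1, ?_⟩
  filter_upwards [h.2] with x hx
  rw [abs_of_pos (Real.exp_pos _)]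
  exact Real.exp_le_exp.2 ((le_abs_self _).trans hx)

/-- The function `F` is bounded on the interval, and `exp` is Lipschitz on the range of `F`. -/
theorem absolutelyContinuousOnInterval_exp {F : ℝ → ℝ} {a b : ℝ}
    (h : AbsolutelyContinuousOnInterval F a b) :
    AbsolutelyContinuousOnInterval (fun x => Real.exp (F x)) a b := by
  obtain ⟨C, hC⟩ := h.exists_bound
  have hlip : ∀ x ∈ uIcc a b, ∀ y ∈ uIcc a b,
      dist (Real.exp (F x)) (Real.exp (F y)) ≤ Real.exp C * dist (F x) (F y) := by
    intro x hx y hy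
    have := Convex.norm_image_sub_le_of_norm_deriv_le (f := Real.exp) (s := Iic C)
      (C := Real.exp C) (x := F y) (y := F x) (fun z _ => Real.differentiableAt_exp)
      (fun z hz => by
        rw [Real.deriv_exp, Real.norm_eq_abs, abs_of_pos (Real.exp_pos _)]
        exact Real.exp_le_exp.2 hz) (convex_Iic C)
      ((le_abs_self _).trans (hC y hy)) ((le_abs_self _).trans (hC x hx))
    simpa [dist_eq_norm] using this
  unfold AbsolutelyContinuousOnInterval at h ⊢
  refine squeeze_zero' (Eventually.of_forall fun _ => Finset.sum_nonneg fun _ _ => dist_nonneg) ?_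
    (by simpa using h.const_mul (Real.exp C))
  rw [eventually_inf_principal]
  filter_upwards with (n, I) hnI
  rw [Finset.mul_sum]
  refine Finset.sum_le_sum fun i hi => ?_
  exact hlip _ (hnI.1 i hi).1 _ (hnI.1 i hi).2

theorem HasWeakDeriv.mul {u u' v v' : L2U} (h : HasWeakDeriv u u') (h' : HasWeakDeriv v v') :
    HasWeakDeriv (toL2 (fun x => u x * v x)) (toL2 (fun x => v x * u' x) + toL2 (fun x => u x * v' x)) := by
  obtain ⟨F, hF⟩ := h.exists_rep
  obtain ⟨G, hG⟩ := h'.exists_rep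
  obtain ⟨B, hB⟩ := h.exists_essBdd
  obtain ⟨B', hB'⟩ := h'.exists_essBdd
  refine IsRep.hasWeakDeriv (F := fun x => F x * G x) ⟨hF.ac.mul hG.ac, ?_, ?_, ?_⟩
  · simp only [hF.per, hG.per]
  · filter_upwards [toL2_coe (hB.memLp_mul (Lp.memLp v)), hF.eq, hG.eq] with x h1 h2 h3
    rw [h1, h2, h3]
  · filter_upwards [Lp.coeFn_add (toL2 (fun x => v x * u' x)) (toL2 (fun x => u x * v' x)),
      toL2_coe (hB'.memLp_mul (Lp.memLp u')), toL2_coe (hB.memLp_mul (Lp.memLp v')), hF.eq, hG.eq,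
      hF.der, hG.der] with x h1 h2 h3 h4 h5 h6 h7
    rw [h1, Pi.add_apply, h2, h3, h4, h5]
    rw [mul_comm (G x)]
    exact h6.mul h7


theorem HasWeakDeriv.exp {u u' : L2U} (h : HasWeakDeriv u u') :
    HasWeakDeriv (toL2 (fun x => Real.exp (u x))) (toL2 (fun x => Real.exp (u x) * u' x)) := by
  obtain ⟨F, hF⟩ := h.exists_rep
  obtain ⟨B, hB⟩ := h.exists_essBdd
  refine IsRep.hasWeakDeriv (F := fun x => Real.exp (F x))
    ⟨absolutelyContinuousOnInterval_exp hF.ac, ?_, ?_, ?_⟩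
  · simp only [hF.per]
  · filter_upwards [toL2_coe hB.exp.memLp, hF.eq] with x h1 h2
    rw [h1, h2]
  · filter_upwards [toL2_coe (hB.exp.memLp_mul (Lp.memLp u')), hF.eq, hF.der] with x h1 h2 h3
    rw [h1, h2]
    exact h3.exp

theorem hasWeakDeriv_of_smooth {f : ℝ → ℝ} (hf : ContDiff ℝ 1 f)
    (hp : Function.Periodic f (2 * Real.pi)) : HasWeakDeriv (toL2 f) (toL2 (deriv f)) := by
  refine IsRep.hasWeakDeriv (F := f) ⟨hf.contDiffOn.absolutelyContinuousOnInterval,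
    by simpa using hp 0, toL2_coe (memLp_of_continuousOn hf.continuous.continuousOn), ?_⟩
  filter_upwards [toL2_coe (memLp_of_continuousOn (hf.continuous_deriv le_rfl).continuousOn)]
    with x hx
  rw [hx]
  exact (hf.differentiable (by simp) x).hasDerivAt

/-! ### Variable-exponent weights and the weighted Sobolev inequality -/

theorem integral_abs_le (f : L2U) : ∫ x, |f x| ∂measU ≤ ‖toL2 (fun _ => 1)‖ * ‖f‖ := by
  have h := integral_mul_eq_inner |f| (φ := fun _ => (1 : ℝ)) continuous_const
  have h2 : ∫ x, (|f| : L2U) x * 1 ∂measU = ∫ x, |f x| ∂measU := by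
    refine integral_congr_ae ?_
    filter_upwards [Lp.coeFn_abs f] with x hx
    rw [hx, mul_one]
  rw [← h2, h]
  calc inner ℝ (toL2 fun _ => 1) |f| ≤ ‖toL2 (fun _ => 1)‖ * ‖|f|‖ := real_inner_le_norm _ _
    _ = _ := by rw [norm_abs_eq_norm]

/-- Averaging `|F x| ≤ |F y| + ∫ |g|` over `y ∈ [a, b]` controls the point value by two `L¹` norms
on that interval; there `1 ≤ K |φ|`, so the multiplier `φ` can be inserted at the cost of `K`. No
derivative of `φ` occurs, so `φ` may be a weight that is merely continuous. -/
theorem IsRep.local_bound {F : ℝ → ℝ} {f g : L2U} (hF : IsRep F f g) {φ : ℝ → ℝ} {B : ℝ}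
    (hφ : EssBdd φ B) {a b x K : ℝ} (ha : 0 ≤ a) (hb : b ≤ 2 * Real.pi) (hab : a < b)
    (hx : x ∈ Icc a b) (hK : 0 ≤ K) (hKφ : ∀ y ∈ Icc a b, 1 ≤ K * |φ y|) :
    |F x| ≤ K * ((b - a)⁻¹ + 1) * ‖toL2 (fun _ => 1)‖ *
      (‖toL2 (fun x => φ x * f x)‖ + ‖toL2 (fun x => φ x * g x)‖) := by
  have hsub : Ioc a b ⊆ Ioc 0 (2 * Real.pi) := Ioc_subset_Ioc ha hb
  have hm : volume.restrict (Ioc a b) ≤ measU := Measure.restrict_mono_set _ hsub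
  have hcc : Icc a b ⊆ Icc 0 (2 * Real.pi) := Icc_subset_Icc ha hb
  set u := toL2 (fun x => φ x * f x) with hu
  set v := toL2 (fun x => φ x * g x) with hv
  set N := ‖toL2 (fun _ => (1 : ℝ))‖ with hN
  have hue : ∀ᵐ y ∂measU, u y = φ y * F y := by
    filter_upwards [toL2_coe (hφ.memLp_mul (Lp.memLp f)), hF.eq] with y h1 h2
    rw [h1, h2]
  have hve : ∀ᵐ y ∂measU, v y = φ y * g y := toL2_coe (hφ.memLp_mul (Lp.memLp g))
  have hui : ∀ w : L2U, ∫ y in Ioc a b, |w y| ≤ N * ‖w‖ := fun w =>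
    (integral_mono_measure hm (ae_of_all _ fun _ => abs_nonneg _) (L2U.integrable w).abs).trans
      (integral_abs_le w)
  have hint : ∀ w : L2U, IntegrableOn (fun y => |w y|) (Ioc a b) := fun w =>
    (L2U.integrable w).abs.mono_measure hm
  have hgint : ∫ y in Ioc a b, |g y| ≤ K * (N * ‖v‖) := by
    calc ∫ y in Ioc a b, |g y| ≤ ∫ y in Ioc a b, K * |v y| := by
          refine integral_mono_ae (hint g) ((hint v).const_mul K) ?_
          filter_upwards [ae_mono hm hve, ae_restrict_mem measurableSet_Ioc] with y h1 h2
          rw [h1, abs_mul]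
          nlinarith [hKφ y (Ioc_subset_Icc_self h2), abs_nonneg (g y)]
      _ = K * ∫ y in Ioc a b, |v y| := integral_const_mul _ _
      _ ≤ _ := mul_le_mul_of_nonneg_left (hui v) hK
  have hpt : ∀ y ∈ Icc a b, |F x| ≤ |F y| + K * (N * ‖v‖) := by
    intro y hy
    have h1 := hF.sub_eq_integral (hcc hy) (hcc hx)
    have h2 : |F x - F y| ≤ ∫ z in Ioc a b, |g z| := by
      rw [h1]
      refine (intervalIntegral.norm_integral_le_integral_norm_uIoc (f := fun z => g z)
        (μ := volume) (a := y) (b := x)).trans ?_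
      refine setIntegral_mono_set (hint g) (ae_of_all _ fun _ => abs_nonneg _) ?_
      refine LE.le.eventuallyLE ?_
      intro z hz
      exact ⟨lt_of_le_of_lt (le_min hy.1 hx.1) hz.1, hz.2.trans (max_le hy.2 hx.2)⟩
    have h3 : |F x| ≤ |F y| + |F x - F y| := by
      have := abs_add_le (F y) (F x - F y); simpa using this
    linarith
  have hfin : (b - a) * |F x| ≤ K * (N * ‖u‖) + (b - a) * (K * (N * ‖v‖)) := by
    have e1 : ∫ _ in Ioc a b, |F x| = (b - a) * |F x| := by
      rw [setIntegral_const]; simp [hab.le]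
    have e2 : ∫ y in Ioc a b, (K * |u y| + K * (N * ‖v‖)) =
        K * (∫ y in Ioc a b, |u y|) + (b - a) * (K * (N * ‖v‖)) := by
      rw [integral_add ((hint u).const_mul K) (integrable_const _), integral_const_mul,
        setIntegral_const]
      simp [hab.le]
    have e3 : ∫ _ in Ioc a b, |F x| ≤ ∫ y in Ioc a b, (K * |u y| + K * (N * ‖v‖)) := by
      refine integral_mono_ae (integrable_const _)
        (((hint u).const_mul K).add (integrable_const _)) ?_
      filter_upwards [ae_mono hm hue, ae_restrict_mem measurableSet_Ioc] with y h1 h2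
      refine (hpt y (Ioc_subset_Icc_self h2)).trans ?_
      rw [h1, abs_mul]
      nlinarith [hKφ y (Ioc_subset_Icc_self h2), abs_nonneg (F y)]
    rw [e1, e2] at e3
    have := mul_le_mul_of_nonneg_left (hui u) hK
    linarith
  have hba : 0 < b - a := by linarith
  have h4 : |F x| ≤ (b - a)⁻¹ * (K * (N * ‖u‖)) + K * (N * ‖v‖) := by
    have := mul_le_mul_of_nonneg_left hfin (inv_nonneg.2 hba.le)
    rwa [mul_add, inv_mul_cancel_left₀ hba.ne', inv_mul_cancel_left₀ hba.ne'] at this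
  refine h4.trans ?_
  have p1 : 0 ≤ K * (N * ‖u‖) := by positivity
  have p2 : 0 ≤ (b - a)⁻¹ * (K * (N * ‖v‖)) := by positivity
  linarith [show K * ((b - a)⁻¹ + 1) * N * (‖u‖ + ‖v‖) = (b - a)⁻¹ * (K * (N * ‖u‖)) +
    K * (N * ‖v‖) + K * (N * ‖u‖) + (b - a)⁻¹ * (K * (N * ‖v‖)) by ring]

theorem rpow_le_max_rpow {t δ₀ s M : ℝ} (ht : 0 < t) (hδ : t ≤ δ₀) (hs : 0 ≤ s) (hM : s ≤ M) :
    t ^ s ≤ (max 1 δ₀) ^ M :=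
  (Real.rpow_le_rpow ht.le (hδ.trans (le_max_right _ _)) hs).trans
    (Real.rpow_le_rpow_of_exponent_le (le_max_left _ _) hM)

theorem essBdd_of_continuous {φ : ℝ → ℝ} (hφ : Continuous φ) : ∃ B, EssBdd φ B := by
  obtain ⟨C, hC⟩ := (isCompact_Icc (a := (0 : ℝ)) (b := 2 * Real.pi)).exists_bound_of_continuousOn
    hφ.continuousOn
  exact ⟨C, hφ.aestronglyMeasurable, ae_measU_of_mem hC⟩

theorem continuous_rpow_weight {μ : ℝ → ℝ} (hμ : Continuous μ) {t : ℝ} (ht : 0 < t) :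
    Continuous fun x => t ^ (-μ x) :=
  Continuous.rpow continuous_const hμ.neg fun _ => Or.inl ht.ne'

/-- The weighted norm `‖t^{-μ} f‖_{L²}`. -/
def wn (μ : ℝ → ℝ) (t : ℝ) (f : L2U) : ℝ := ‖toL2 (fun x => t ^ (-μ x) * f x)‖

theorem wn_nonneg (μ : ℝ → ℝ) (t : ℝ) (f : L2U) : 0 ≤ wn μ t f := norm_nonneg _

theorem memLp_weight {μ : ℝ → ℝ} (hμ : Continuous μ) {t : ℝ} (ht : 0 < t) (f : L2U) :
    MemLp (fun x => t ^ (-μ x) * f x) 2 measU := by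
  obtain ⟨B, hB⟩ := essBdd_of_continuous (continuous_rpow_weight hμ ht)
  exact hB.memLp_mul (Lp.memLp f)

theorem wn_le_of_ae {μ ρ : ℝ → ℝ} (hμ : Continuous μ) (hρ : Continuous ρ) {t : ℝ} (ht : 0 < t)
    {f g : L2U} {B : ℝ}
    (h : ∀ᵐ x ∂measU, t ^ (-ρ x) * |f x| ≤ B * (t ^ (-μ x) * |g x|)) :
    wn ρ t f ≤ B * wn μ t g := by
  refine Lp.norm_le_mul_norm_of_ae_le_mul ?_
  filter_upwards [h, toL2_coe (memLp_weight hμ ht g), toL2_coe (memLp_weight hρ ht f)]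
    with x h1 h2 h3
  rw [h2, h3, Real.norm_eq_abs, Real.norm_eq_abs, abs_mul, abs_mul,
    abs_of_pos (Real.rpow_pos_of_pos ht _), abs_of_pos (Real.rpow_pos_of_pos ht _)]
  exact h1

theorem wn_add_le {μ : ℝ → ℝ} (hμ : Continuous μ) {t : ℝ} (ht : 0 < t) (f g : L2U) :
    wn μ t (f + g) ≤ wn μ t f + wn μ t g := by
  have : toL2 (fun x => t ^ (-μ x) * (f + g : L2U) x) =
      toL2 (fun x => t ^ (-μ x) * f x) + toL2 (fun x => t ^ (-μ x) * g x) := by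
    rw [← toL2_add (memLp_weight hμ ht f) (memLp_weight hμ ht g)]
    refine toL2_congr ?_
    filter_upwards [Lp.coeFn_add f g] with x hx
    rw [hx, Pi.add_apply, Pi.add_apply, mul_add]
  rw [wn, this]
  exact norm_add_le _ _

theorem wn_smul {μ : ℝ → ℝ} (hμ : Continuous μ) {t : ℝ} (ht : 0 < t) (c : ℝ) (f : L2U) :
    wn μ t (c • f) = |c| * wn μ t f := by
  have : toL2 (fun x => t ^ (-μ x) * (c • f : L2U) x) = c • toL2 (fun x => t ^ (-μ x) * f x) := by
    refine toL2_eq ?_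
    filter_upwards [Lp.coeFn_smul c f, Lp.coeFn_smul c (toL2 (fun x => t ^ (-μ x) * f x)),
      toL2_coe (memLp_weight hμ ht f)] with x h1 h2 h3
    rw [h1, h2, Pi.smul_apply, Pi.smul_apply, h3, smul_eq_mul, smul_eq_mul]
    ring
  rw [wn, this, norm_smul, Real.norm_eq_abs, wn]

theorem wn_zero (μ : ℝ → ℝ) (t : ℝ) : wn μ t 0 = 0 := by
  have : toL2 (fun x => t ^ (-μ x) * (0 : L2U) x) = 0 := by
    refine toL2_eq ?_
    filter_upwards [Lp.coeFn_zero ℝ 2 measU] with x hx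
    rw [hx, Pi.zero_apply, mul_zero]
  rw [wn, this, norm_zero]

theorem wn_sq {μ : ℝ → ℝ} (hμ : Continuous μ) {t : ℝ} (ht : 0 < t) (f : L2U) :
    wn μ t f ^ 2 = ∫ x, t ^ (2 * (-μ x)) * (f x) ^ 2 ∂measU := by
  rw [wn, ← real_inner_self_eq_norm_sq, L2.inner_def]
  refine integral_congr_ae ?_
  filter_upwards [toL2_coe (memLp_weight hμ ht f)] with x hx
  rw [hx, real_inner_self_eq_norm_sq, Real.norm_eq_abs, sq_abs, mul_pow, mul_comm 2 (-μ x),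
    Real.rpow_mul ht.le]
  norm_num

theorem exists_gap {μ ρ : ℝ → ℝ} (hμ : Continuous μ) (hρ : Continuous ρ) (h : ∀ x, ρ x < μ x) :
    ∃ η > 0, ∀ x ∈ Icc 0 (2 * Real.pi), ρ x + η ≤ μ x := by
  obtain ⟨x₀, -, hx₀⟩ := (isCompact_Icc (a := (0 : ℝ)) (b := 2 * Real.pi)).exists_isMinOn
    ⟨0, by simp [two_pi_pos'.le]⟩ (hμ.sub hρ).continuousOn
  refine ⟨μ x₀ - ρ x₀, sub_pos.2 (h x₀), fun x hx => ?_⟩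
  have := hx₀ hx
  simp only [mem_ofPred_eq, Pi.sub_apply] at this
  linarith

theorem exists_upper {μ : ℝ → ℝ} (hμ : Continuous μ) :
    ∃ M, 0 ≤ M ∧ ∀ x ∈ Icc 0 (2 * Real.pi), |μ x| ≤ M := by
  obtain ⟨C, hC⟩ := (isCompact_Icc (a := (0 : ℝ)) (b := 2 * Real.pi)).exists_bound_of_continuousOn
    hμ.continuousOn
  exact ⟨max C 0, le_max_right _ _, fun x hx => (hC x hx).trans (le_max_left _ _)⟩

/-- Lowering the exponent of the weight costs a constant on bounded time intervals. -/
theorem exists_rpow_le {μ ρ : ℝ → ℝ} (hμ : Continuous μ) (hρ : Continuous ρ)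
    (h : ∀ x, ρ x ≤ μ x) (δ₀ : ℝ) : ∃ C, 0 ≤ C ∧ ∀ t, 0 < t → t ≤ δ₀ →
      ∀ x ∈ Icc 0 (2 * Real.pi), t ^ (μ x) ≤ C * t ^ (ρ x) := by
  obtain ⟨M, hM, hb⟩ := exists_upper (hμ.sub hρ)
  refine ⟨(max 1 δ₀) ^ M, by positivity, fun t ht htδ x hx => ?_⟩
  have h1 : t ^ (μ x) = t ^ (μ x - ρ x) * t ^ (ρ x) := by
    rw [← Real.rpow_add ht]; ring_nf
  rw [h1]
  exact mul_le_mul_of_nonneg_right (rpow_le_max_rpow ht htδ (sub_nonneg.2 (h x))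
    ((le_abs_self _).trans (hb x hx))) (Real.rpow_nonneg ht.le _)

theorem exists_wn_le {μ ρ : ℝ → ℝ} (hμ : Continuous μ) (hρ : Continuous ρ)
    (h : ∀ x, ρ x ≤ μ x) (δ₀ : ℝ) : ∃ C, 0 ≤ C ∧ ∀ t, 0 < t → t ≤ δ₀ →
      ∀ f : L2U, wn ρ t f ≤ C * wn μ t f := by
  obtain ⟨C, hC, H⟩ := exists_rpow_le hρ.neg hμ.neg (fun x => neg_le_neg (h x)) δ₀
  refine ⟨C, hC, fun t ht htδ f => wn_le_of_ae hμ hρ ht ?_⟩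
  refine ae_measU_of_mem fun x hx => ?_
  rw [← mul_assoc]
  exact mul_le_mul_of_nonneg_right (H t ht htδ x hx) (abs_nonneg _)

/-- A Sobolev inequality with variable weights, with an arbitrarily small loss in the exponent. -/
theorem exists_sup_le {μ ρ : ℝ → ℝ} (hμ : Continuous μ) (hρ : Continuous ρ)
    (h : ∀ x, ρ x < μ x) (δ₀ : ℝ) : ∃ C, 0 ≤ C ∧ ∀ t, 0 < t → t ≤ δ₀ →
      ∀ f g : L2U, HasWeakDeriv f g →
        ∀ᵐ x ∂measU, |f x| ≤ C * t ^ (ρ x) * (wn μ t f + wn μ t g) := by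
  obtain ⟨η, hη, hgap⟩ := exists_gap hμ hρ h
  obtain ⟨M₁, hM₁, hb₁⟩ := exists_upper hμ
  obtain ⟨M₂, hM₂, hb₂⟩ := exists_upper hρ
  have huc := (isCompact_Icc (a := (0 : ℝ)) (b := 2 * Real.pi)).uniformContinuousOn_of_continuous
    hμ.continuousOn
  obtain ⟨d, hd, hdμ⟩ := Metric.uniformContinuousOn_iff.1 huc η hη
  -- The bound `l < d` keeps the oscillation of `μ` below the gap `η` on an interval of length `l`;
  -- `l ≤ π` ensures that for every `x` one of `[x, x + l]`, `[x - l, x]` lies in the period.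
  set l := min (d / 2) Real.pi with hl
  have hlpos : 0 < l := lt_min (by positivity) Real.pi_pos
  have hld : l < d := (min_le_left _ _).trans_lt (by linarith)
  have hlpi : l ≤ Real.pi := min_le_right _ _
  set A := (max 1 δ₀) ^ (M₁ + M₂) with hA
  refine ⟨A * (l⁻¹ + 1) * ‖toL2 (fun _ => 1)‖, by positivity, ?_⟩
  intro t ht htδ f g hfg
  obtain ⟨F, hF⟩ := hfg.exists_rep
  obtain ⟨B, hB⟩ := essBdd_of_continuous (continuous_rpow_weight hμ ht)
  have key : ∀ x ∈ Icc 0 (2 * Real.pi), ∀ a b, 0 ≤ a → b ≤ 2 * Real.pi → b - a = l → x ∈ Icc a b →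
      |F x| ≤ A * (l⁻¹ + 1) * ‖toL2 (fun _ => 1)‖ * t ^ (ρ x) * (wn μ t f + wn μ t g) := by
    intro x hx a b ha hb hab hxab
    -- This `K` is admissible because `0 ≤ μ y - ρ x ≤ M₁ + M₂` for `y` near `x`, so that `t^(μ y -
    -- ρ x) ≤ A` for all `t ≤ δ₀`, including `t > 1`.
    have := hF.local_bound hB (K := A * t ^ (ρ x)) ha hb (by linarith) hxab (by positivity) (by
      intro y hy
      have hy' : y ∈ Icc 0 (2 * Real.pi) := ⟨ha.trans hy.1, hy.2.trans hb⟩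
      have hdist : dist x y < d := by
        rw [Real.dist_eq, abs_lt]
        constructor <;> linarith [hxab.1, hxab.2, hy.1, hy.2]
      have h1 := hdμ x hx y hy' hdist
      rw [Real.dist_eq, abs_lt] at h1
      rw [abs_of_pos (Real.rpow_pos_of_pos ht _), mul_assoc, ← Real.rpow_add ht]
      have h2 : t ^ (μ y - ρ x) ≤ A := by
        refine rpow_le_max_rpow ht htδ ?_ ?_
        · linarith [hgap x hx]
        · linarith [le_abs_self (μ y), hb₁ y hy', neg_abs_le (ρ x), hb₂ x hx]
      have h3 : t ^ (ρ x + -μ y) = (t ^ (μ y - ρ x))⁻¹ := by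
        rw [← Real.rpow_neg ht.le]; ring_nf
      rw [h3, ← div_eq_mul_inv, one_le_div (Real.rpow_pos_of_pos ht _)]
      exact h2)
    refine this.trans (le_of_eq ?_)
    rw [hab, wn, wn]
    ring
  have key2 : ∀ x ∈ Icc 0 (2 * Real.pi),
      |F x| ≤ A * (l⁻¹ + 1) * ‖toL2 (fun _ => 1)‖ * t ^ (ρ x) * (wn μ t f + wn μ t g) := by
    intro x hx
    rcases le_total x Real.pi with hxp | hxp
    · exact key x hx x (x + l) hx.1 (by linarith) (by ring) ⟨le_rfl, by linarith⟩
    · exact key x hx (x - l) x (by linarith) hx.2 (by ring) ⟨by linarith, le_rfl⟩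
  filter_upwards [hF.eq, ae_measU_of_mem key2] with x h1 h2
  rw [h1]; exact h2

/-- At `t = 1` all weights are trivial, so this is the unweighted embedding. -/
theorem exists_sup_le_norm : ∃ C, 0 ≤ C ∧ ∀ f g : L2U, HasWeakDeriv f g →
    EssBdd f (C * (‖f‖ + ‖g‖)) := by
  obtain ⟨C, hC, H⟩ := exists_sup_le (μ := fun _ => 1) (ρ := fun _ => 0) continuous_const
    continuous_const (fun _ => one_pos) 1
  refine ⟨C, hC, fun f g h => ⟨(Lp.memLp f).1, ?_⟩⟩
  filter_upwards [H 1 one_pos le_rfl f g h] with x hx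
  have e : ∀ u : L2U, wn (fun _ => 1) 1 u = ‖u‖ := fun u => by
    simp [wn, toL2_self]
  simpa [e] using hx

/-! ### Continuity and differentiability of products and exponentials of L²-valued curves -/

/-- The pointwise product of two classes in `L²(U)`. -/
def pm (f g : L2U) : L2U := toL2 (fun x => f x * g x)

/-- The pointwise exponential of a class in `L²(U)`. -/
def pe (f : L2U) : L2U := toL2 (fun x => Real.exp (f x))

theorem pm_comm (f g : L2U) : pm f g = pm g f := by
  simp only [pm, mul_comm]

theorem pm_coe {f g : L2U} {B : ℝ} (h : EssBdd f B) : pm f g =ᵐ[measU] fun x => f x * g x :=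
  toL2_coe (h.memLp_mul (Lp.memLp g))

theorem pe_coe {f : L2U} {B : ℝ} (h : EssBdd f B) : pe f =ᵐ[measU] fun x => Real.exp (f x) :=
  toL2_coe h.exp.memLp

theorem EssBdd.congr {φ ψ : ℝ → ℝ} {B : ℝ} (h : EssBdd φ B) (e : ψ =ᵐ[measU] φ) : EssBdd ψ B :=
  ⟨h.1.congr e.symm, by filter_upwards [h.2, e] with x h1 h2; rwa [h2]⟩

theorem pm_add {f g h : L2U} {B : ℝ} (hf : EssBdd f B) : pm f (g + h) = pm f g + pm f h := by
  refine toL2_eq ?_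
  filter_upwards [Lp.coeFn_add g h, Lp.coeFn_add (pm f g) (pm f h), pm_coe hf, pm_coe hf]
    with x h1 h2 h3 h4
  rw [h1, h2, Pi.add_apply, Pi.add_apply, h3, h4, mul_add]

theorem pm_smul {f g : L2U} {B : ℝ} (hf : EssBdd f B) (c : ℝ) : pm f (c • g) = c • pm f g := by
  refine toL2_eq ?_
  filter_upwards [Lp.coeFn_smul c g, Lp.coeFn_smul c (pm f g), pm_coe hf] with x h1 h2 h3
  rw [h1, h2, Pi.smul_apply, Pi.smul_apply, h3, smul_eq_mul, smul_eq_mul]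
  ring

theorem pm_sub {f g h : L2U} {B : ℝ} (hf : EssBdd f B) : pm f (g - h) = pm f g - pm f h := by
  have : g - h = g + (-1 : ℝ) • h := by simp [sub_eq_add_neg]
  rw [this, pm_add hf, pm_smul hf]
  simp [sub_eq_add_neg]

theorem pm_sub_left {f f' g : L2U} {B B' : ℝ} (hf : EssBdd f B) (hf' : EssBdd f' B') :
    pm (f - f') g = pm f g - pm f' g := by
  refine toL2_eq ?_
  filter_upwards [Lp.coeFn_sub f f', Lp.coeFn_sub (pm f g) (pm f' g), pm_coe hf, pm_coe hf']
    with x h1 h2 h3 h4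
  rw [h1, h2, Pi.sub_apply, Pi.sub_apply, h3, h4, sub_mul]

theorem norm_pm_le {f g : L2U} {B : ℝ} (hf : EssBdd f B) : ‖pm f g‖ ≤ B * ‖g‖ :=
  hf.norm_toL2_mul_le g

/-- Multiplication is not continuous on `L²`, but it is continuous from `H¹ × L²` to `L²`: in `f h -
g k = f (h - k) + (f - g) k` the factors `f` and `f - g` are controlled in the sup norm. -/
theorem tendsto_pm {ι : Type*} {l : Filter ι} {f f' h : ι → L2U} {g g' k : L2U}
    (hf : ∀ᶠ i in l, HasWeakDeriv (f i) (f' i)) (hg : HasWeakDeriv g g')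
    (h1 : Tendsto f l (𝓝 g)) (h2 : Tendsto f' l (𝓝 g')) (h3 : Tendsto h l (𝓝 k)) :
    Tendsto (fun i => pm (f i) (h i)) l (𝓝 (pm g k)) := by
  obtain ⟨C, hC, H⟩ := exists_sup_le_norm
  rw [tendsto_iff_norm_sub_tendsto_zero]
  have z1 : Tendsto (fun i => C * (‖f i‖ + ‖f' i‖) * ‖h i - k‖ +
      C * (‖f i - g‖ + ‖f' i - g'‖) * ‖k‖) l (𝓝 0) := by
    have e1 := tendsto_iff_norm_sub_tendsto_zero.1 h1
    have e2 := tendsto_iff_norm_sub_tendsto_zero.1 h2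
    have e3 := tendsto_iff_norm_sub_tendsto_zero.1 h3
    have := (((h1.norm.add h2.norm).const_mul C).mul e3).add
      (((e1.add e2).const_mul C).mul_const ‖k‖)
    simpa using this
  refine squeeze_zero' (Eventually.of_forall fun _ => norm_nonneg _) ?_ z1
  filter_upwards [hf] with i hi
  have b1 := H _ _ hi
  have b2 := H _ _ hg
  have b3 := H _ _ (hi.sub hg)
  have : pm (f i) (h i) - pm g k = pm (f i) (h i - k) + pm (f i - g) k := by
    rw [pm_sub b1, pm_sub_left b1 b2]; abel
  rw [this]
  exact (norm_add_le _ _).trans (add_le_add (norm_pm_le b1) (norm_pm_le b3))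

/-- The difference quotient of the product is `v(t)` times the slope of `u` plus `u(τ)` times the
slope of `v`. The slopes converge only in `L²`, so `v(t)` must lie in `H¹` and `u(τ)` must converge
in `H¹`. -/
theorem hasDerivWithinAt_pm {s : Set ℝ} {t : ℝ} {u v ux : ℝ → L2U} {u' v' vx : L2U}
    (ht : t ∈ s) (hu : HasDerivWithinAt u u' s t) (hv : HasDerivWithinAt v v' s t)
    (hux : ∀ τ ∈ s, HasWeakDeriv (u τ) (ux τ)) (hc : ContinuousWithinAt ux s t)
    (hvx : HasWeakDeriv (v t) vx) :
    HasDerivWithinAt (fun τ => pm (u τ) (v τ)) (pm (v t) u' + pm (u t) v') s t := by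
  rw [hasDerivWithinAt_iff_tendsto_slope] at hu hv ⊢
  obtain ⟨C, hC, H⟩ := exists_sup_le_norm
  have hss : 𝓝[s \ {t}] t ≤ 𝓝[s] t := nhdsWithin_mono _ sdiff_subset
  have hucont : ContinuousWithinAt u s t := by
    rw [← hasDerivWithinAt_iff_tendsto_slope] at hu
    exact hu.continuousWithinAt
  have hmem : ∀ᶠ τ in 𝓝[s \ {t}] t, τ ∈ s := by
    filter_upwards [self_mem_nhdsWithin] with τ hτ using hτ.1
  have l1 : Tendsto (fun τ => pm (v t) (slope u t τ)) (𝓝[s \ {t}] t) (𝓝 (pm (v t) u')) :=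
    tendsto_pm (f' := fun _ => vx) (Eventually.of_forall fun _ => hvx) hvx tendsto_const_nhds
      tendsto_const_nhds hu
  have l2 : Tendsto (fun τ => pm (u τ) (slope v t τ)) (𝓝[s \ {t}] t) (𝓝 (pm (u t) v')) :=
    tendsto_pm (hmem.mono fun τ hτ => hux τ hτ) (hux t ht) (hucont.tendsto.mono_left hss)
      (hc.tendsto.mono_left hss) hv
  refine (l1.add l2).congr' ?_
  filter_upwards [hmem] with τ hτ
  have b1 := H _ _ hvx
  have b2 := H _ _ (hux τ hτ)
  have b3 := H _ _ (hux t ht)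
  rw [slope_def_module, slope_def_module, slope_def_module, pm_smul b1, pm_smul b2, pm_sub b1,
    pm_sub b2, ← smul_add, pm_comm (v t) (u τ), pm_comm (v t) (u t)]
  congr 1
  abel

theorem HasWeakDeriv.pe_pm {u u' : L2U} (h : HasWeakDeriv u u') :
    HasWeakDeriv (pe u) (pm (pe u) u') := by
  obtain ⟨B, hB⟩ := h.exists_essBdd
  have e : toL2 (fun x => Real.exp (u x) * u' x) = pm (pe u) u' := by
    refine toL2_congr ?_
    filter_upwards [pe_coe hB] with x hx
    rw [hx]
  rw [← e]
  exact h.exp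

/-- Since `|e^d - 1 - d| ≤ d²` for `|d| ≤ 1`, one factor `|d|` goes to the sup norm, which tends to
zero because `u` is continuous into `H¹`, and the other to the `L²` difference quotient. -/
theorem hasDerivWithinAt_pe {s : Set ℝ} {t : ℝ} {u ux : ℝ → L2U} {u' : L2U}
    (ht : t ∈ s) (hu : HasDerivWithinAt u u' s t)
    (hux : ∀ τ ∈ s, HasWeakDeriv (u τ) (ux τ)) (hc : ContinuousWithinAt ux s t) :
    HasDerivWithinAt (fun τ => pe (u τ)) (pm (pe (u t)) u') s t := by
  have hucont : ContinuousWithinAt u s t := hu.continuousWithinAt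
  rw [hasDerivWithinAt_iff_tendsto_slope] at hu ⊢
  obtain ⟨C, hC, H⟩ := exists_sup_le_norm
  have hss : 𝓝[s \ {t}] t ≤ 𝓝[s] t := nhdsWithin_mono _ sdiff_subset
  have hmem : ∀ᶠ τ in 𝓝[s \ {t}] t, τ ∈ s := by
    filter_upwards [self_mem_nhdsWithin] with τ hτ using hτ.1
  have b := H _ _ (hux t ht)
  set A := Real.exp (C * (‖u t‖ + ‖ux t‖)) with hA
  have bE : EssBdd (pe (u t)) A := b.exp.congr (pe_coe b)
  have l1 : Tendsto (fun τ => pm (pe (u t)) (slope u t τ)) (𝓝[s \ {t}] t)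
      (𝓝 (pm (pe (u t)) u')) :=
    tendsto_pm (f' := fun _ => pm (pe (u t)) (ux t)) (Eventually.of_forall fun _ => (hux t ht).pe_pm)
      (hux t ht).pe_pm tendsto_const_nhds tendsto_const_nhds hu
  have e0 : Tendsto (fun τ => C * (‖u τ - u t‖ + ‖ux τ - ux t‖)) (𝓝[s \ {t}] t) (𝓝 0) := by
    have e1 := tendsto_iff_norm_sub_tendsto_zero.1 (hucont.tendsto.mono_left hss)
    have e2 := tendsto_iff_norm_sub_tendsto_zero.1 (hc.tendsto.mono_left hss)
    simpa using (e1.add e2).const_mul C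
  have l2 : Tendsto (fun τ => slope (fun τ => pe (u τ)) t τ - pm (pe (u t)) (slope u t τ))
      (𝓝[s \ {t}] t) (𝓝 0) := by
    have z : Tendsto (fun τ => A * (C * (‖u τ - u t‖ + ‖ux τ - ux t‖)) * ‖slope u t τ‖)
        (𝓝[s \ {t}] t) (𝓝 0) := by
      simpa using (e0.const_mul A).mul hu.norm
    refine squeeze_zero_norm' ?_ z
    filter_upwards [hmem, e0.eventually (ge_mem_nhds one_pos)] with τ hτ h1
    have bd := H _ _ ((hux τ hτ).sub (hux t ht))
    have bτ := H _ _ (hux τ hτ)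
    have key : ‖pe (u τ) - pe (u t) - pm (pe (u t)) (u τ - u t)‖ ≤
        (A * (C * (‖u τ - u t‖ + ‖ux τ - ux t‖))) * ‖u τ - u t‖ := by
      refine Lp.norm_le_mul_norm_of_ae_le_mul ?_
      filter_upwards [Lp.coeFn_sub (pe (u τ) - pe (u t)) (pm (pe (u t)) (u τ - u t)),
        Lp.coeFn_sub (pe (u τ)) (pe (u t)), pm_coe (g := u τ - u t) bE, pe_coe b, pe_coe bτ,
        Lp.coeFn_sub (u τ) (u t), bd.2, b.exp.2] with x a1 a2 a3 a4 a5 a6 a7 a8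
      rw [a1, Pi.sub_apply, a2, Pi.sub_apply, a3, a4, a5]
      rw [a6, Pi.sub_apply] at a7 ⊢
      set d := u τ x - u t x with hd
      have : Real.exp (u τ x) - Real.exp (u t x) - Real.exp (u t x) * d =
          Real.exp (u t x) * (Real.exp d - 1 - d) := by
        rw [show u τ x = u t x + d by rw [hd]; ring, Real.exp_add]; ring
      rw [this, norm_mul, Real.norm_eq_abs, Real.norm_eq_abs, Real.norm_eq_abs]
      have q := Real.abs_exp_sub_one_sub_id_le (a7.trans h1)
      calc |Real.exp (u t x)| * |Real.exp d - 1 - d| ≤ A * d ^ 2 :=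
            mul_le_mul a8 q (abs_nonneg _) (Real.exp_pos _).le
        _ = A * (|d| * |d|) := by rw [← sq_abs, sq]
        _ ≤ A * ((C * (‖u τ - u t‖ + ‖ux τ - ux t‖)) * |d|) := by gcongr
        _ = _ := by ring
    rw [slope_def_module, slope_def_module, pm_smul bE, ← smul_sub, norm_smul, norm_smul]
    calc _ ≤ ‖(τ - t)⁻¹‖ * (A * (C * (‖u τ - u t‖ + ‖ux τ - ux t‖)) * ‖u τ - u t‖) := by gcongr
      _ = _ := by ring
  have := l1.add l2
  simpa using this

/-! ### Jets: curves with all mixed derivatives up to a given order -/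

/-- `v = D u` on `(0,δ]`. -/
def HasD (δ : ℝ) (u v : ℝ → L2U) : Prop :=
  ∀ t ∈ Ioc 0 δ, HasDerivWithinAt u (t⁻¹ • v t) (Ioc 0 δ) t

/-- `v = ∂ₓ u` on `(0,δ]`. -/
def HasX (δ : ℝ) (u v : ℝ → L2U) : Prop :=
  ∀ t ∈ Ioc 0 δ, HasWeakDeriv (u t) (v t)

theorem HasD.eq {δ : ℝ} {u v : ℝ → L2U} (h : HasD δ u v) : EqOn (DL2 δ u) v (Ioc 0 δ) := by
  intro t ht
  rw [DL2, (h t ht).derivWithin (uniqueDiffOn_Ioc 0 δ t ht), smul_smul, mul_inv_cancel₀ ht.1.ne',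
    one_smul]

theorem HasX.eq {δ : ℝ} {u v : ℝ → L2U} (h : HasX δ u v) :
    EqOn (fun t => wderiv (u t)) v (Ioc 0 δ) := fun t ht => (h t ht).wderiv_eq

theorem HasD.congr {δ : ℝ} {u v u' v' : ℝ → L2U} (h : HasD δ u v) (e : EqOn u' u (Ioc 0 δ))
    (e' : EqOn v' v (Ioc 0 δ)) : HasD δ u' v' := fun t ht => by
  rw [e' ht]
  exact (h t ht).congr e (e ht)

theorem HasX.congr {δ : ℝ} {u v u' v' : ℝ → L2U} (h : HasX δ u v) (e : EqOn u' u (Ioc 0 δ))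
    (e' : EqOn v' v (Ioc 0 δ)) : HasX δ u' v' := fun t ht => by
  rw [e' ht, e ht]
  exact h t ht

theorem DL2_congr {δ : ℝ} {u v : ℝ → L2U} (h : EqOn u v (Ioc 0 δ)) :
    EqOn (DL2 δ u) (DL2 δ v) (Ioc 0 δ) := fun t ht => by
  rw [DL2, DL2, derivWithin_congr h (h ht)]

/-- All derivatives `∂ₓ^q D^p u` with `p + q ≤ n` exist and are continuous curves in `L²(U)`. -/
def Jet (δ : ℝ) : ℕ → (ℝ → L2U) → Prop
  | 0, u => ContinuousOn u (Ioc 0 δ)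
  | n + 1, u => HasD δ u (DL2 δ u) ∧ HasX δ u (fun t => wderiv (u t)) ∧
      Jet δ n (DL2 δ u) ∧ Jet δ n (fun t => wderiv (u t))

theorem Jet.congr {δ : ℝ} {n : ℕ} {u v : ℝ → L2U} (h : Jet δ n u) (e : EqOn v u (Ioc 0 δ)) :
    Jet δ n v := by
  induction n generalizing u v with
  | zero => exact ContinuousOn.congr h e
  | succ n ih =>
    obtain ⟨h1, h2, h3, h4⟩ := h
    have ex : EqOn (fun t => wderiv (v t)) (fun t => wderiv (u t)) (Ioc 0 δ) := fun t ht => by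
      simp only [e ht]
    exact ⟨h1.congr e (DL2_congr e), h2.congr e ex, ih h3 (DL2_congr e), ih h4 ex⟩

/-- The derivatives may be supplied by formulas, in place of the canonical choices `DL2` and
`wderiv` in the definition. -/
theorem Jet.mk {δ : ℝ} {n : ℕ} {u v w : ℝ → L2U} (h1 : HasD δ u v) (h2 : HasX δ u w)
    (h3 : Jet δ n v) (h4 : Jet δ n w) : Jet δ (n + 1) u :=
  ⟨h1.congr (fun _ _ => rfl) h1.eq, h2.congr (fun _ _ => rfl) h2.eq, h3.congr h1.eq, h4.congr h2.eq⟩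

theorem Jet.continuousOn {δ : ℝ} {n : ℕ} {u : ℝ → L2U} (h : Jet δ n u) :
    ContinuousOn u (Ioc 0 δ) := by
  cases n with
  | zero => exact h
  | succ n => exact fun t ht => (h.1 t ht).continuousWithinAt

theorem Jet.of_succ {δ : ℝ} {n : ℕ} {u : ℝ → L2U} (h : Jet δ (n + 1) u) : Jet δ n u := by
  induction n generalizing u with
  | zero => exact h.continuousOn
  | succ n ih => exact ⟨h.1, h.2.1, ih h.2.2.1, ih h.2.2.2⟩

theorem Jet.mono {δ : ℝ} {n k : ℕ} {u : ℝ → L2U} (h : Jet δ n u) (hk : k ≤ n) : Jet δ k u := by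
  induction hk with
  | refl => exact h
  | step _ ih => exact ih h.of_succ

theorem HasD.add {δ : ℝ} {u v u' v' : ℝ → L2U} (h : HasD δ u v) (h' : HasD δ u' v') :
    HasD δ (u + u') (v + v') := fun t ht => by
  rw [Pi.add_apply, smul_add]
  exact (h t ht).add (h' t ht)

theorem HasX.add {δ : ℝ} {u v u' v' : ℝ → L2U} (h : HasX δ u v) (h' : HasX δ u' v') :
    HasX δ (u + u') (v + v') := fun t ht => (h t ht).add (h' t ht)

theorem HasD.smul {δ : ℝ} {u v : ℝ → L2U} (c : ℝ) (h : HasD δ u v) :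
    HasD δ (c • u) (c • v) := fun t ht => by
  rw [Pi.smul_apply, smul_comm]
  exact (h t ht).const_smul c

theorem HasX.smul {δ : ℝ} {u v : ℝ → L2U} (c : ℝ) (h : HasX δ u v) :
    HasX δ (c • u) (c • v) := fun t ht => (h t ht).smul c

theorem Jet.add {δ : ℝ} {n : ℕ} {u v : ℝ → L2U} (h : Jet δ n u) (h' : Jet δ n v) :
    Jet δ n (u + v) := by
  induction n generalizing u v with
  | zero => exact ContinuousOn.add h h'
  | succ n ih =>
    exact Jet.mk (h.1.add h'.1) (h.2.1.add h'.2.1) (ih h.2.2.1 h'.2.2.1) (ih h.2.2.2 h'.2.2.2)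

theorem Jet.smul {δ : ℝ} {n : ℕ} {u : ℝ → L2U} (c : ℝ) (h : Jet δ n u) : Jet δ n (c • u) := by
  induction n generalizing u with
  | zero => exact ContinuousOn.const_smul h c
  | succ n ih => exact Jet.mk (h.1.smul c) (h.2.1.smul c) (ih h.2.2.1) (ih h.2.2.2)

theorem HasD.mul {δ : ℝ} {u v u' v' ux vx : ℝ → L2U} (h : HasD δ u u') (h' : HasD δ v v')
    (hx : HasX δ u ux) (hx' : HasX δ v vx) (hc : ContinuousOn ux (Ioc 0 δ)) :
    HasD δ (fun t => pm (u t) (v t)) ((fun t => pm (v t) (u' t)) + fun t => pm (u t) (v' t)) := by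
  intro t ht
  obtain ⟨B, hB⟩ := (hx t ht).exists_essBdd
  obtain ⟨B', hB'⟩ := (hx' t ht).exists_essBdd
  have := hasDerivWithinAt_pm ht (h t ht) (h' t ht) hx (hc t ht) (hx' t ht)
  rw [pm_smul hB, pm_smul hB', ← smul_add] at this
  exact this

theorem HasX.mul {δ : ℝ} {u v ux vx : ℝ → L2U} (hx : HasX δ u ux) (hx' : HasX δ v vx) :
    HasX δ (fun t => pm (u t) (v t)) ((fun t => pm (v t) (ux t)) + fun t => pm (u t) (vx t)) :=
  fun t ht => (hx t ht).mul (hx' t ht)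

theorem HasD.exp {δ : ℝ} {u u' ux : ℝ → L2U} (h : HasD δ u u')
    (hx : HasX δ u ux) (hc : ContinuousOn ux (Ioc 0 δ)) :
    HasD δ (fun t => pe (u t)) (fun t => pm (pe (u t)) (u' t)) := by
  intro t ht
  obtain ⟨B, hB⟩ := (hx t ht).exists_essBdd
  have := hasDerivWithinAt_pe ht (h t ht) hx (hc t ht)
  rwa [pm_smul (hB.exp.congr (pe_coe hB))] at this

theorem HasX.exp {δ : ℝ} {u ux : ℝ → L2U} (hx : HasX δ u ux) :
    HasX δ (fun t => pe (u t)) (fun t => pm (pe (u t)) (ux t)) := fun t ht => (hx t ht).pe_pm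

/-- Induction by the Leibniz rule, always placing the differentiated factor in the first slot by
commutativity. The second factor needs at least one derivative, even for `n = 0`, since otherwise
neither factor would be bounded. -/
theorem Jet.mul {δ : ℝ} {n : ℕ} {u v : ℝ → L2U} (h : Jet δ n u) (h' : Jet δ (max n 1) v) :
    Jet δ n (fun t => pm (u t) (v t)) := by
  induction n generalizing u v with
  | zero =>
    intro t ht
    have e : ∀ τ, pm (u τ) (v τ) = pm (v τ) (u τ) := fun τ => pm_comm _ _
    simp only [e]
    refine tendsto_pm ?_ (h'.2.1 t ht) (h'.continuousOn t ht) (h'.2.2.2.continuousOn t ht)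
      (h.continuousOn t ht)
    filter_upwards [self_mem_nhdsWithin] with τ hτ using h'.2.1 τ hτ
  | succ n ih =>
    have h'' : Jet δ (n + 1) v := h'.mono (le_max_left _ _)
    have m1 : max n 1 ≤ n + 1 := by omega
    have e : ∀ f g : ℝ → L2U, (fun t => pm (f t) (g t)) =
      fun t => pm (g t) (f t) := fun f g => funext fun t => pm_comm _ _
    refine Jet.mk (HasD.mul h.1 h''.1 h.2.1 h''.2.1 h.2.2.2.continuousOn) (h.2.1.mul h''.2.1) ?_ ?_
    · refine Jet.add ?_ ?_
      · rw [e]; exact ih h.2.2.1 (h''.mono m1)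
      · rw [e]; exact ih h''.2.2.1 (h.mono m1)
    · refine Jet.add ?_ ?_
      · rw [e]; exact ih h.2.2.2 (h''.mono m1)
      · rw [e]; exact ih h''.2.2.2 (h.mono m1)

theorem tendsto_pe_mul {ι : Type*} {l : Filter ι} {f f' h : ι → L2U} {g g' k : L2U}
    (hf : ∀ᶠ i in l, HasWeakDeriv (f i) (f' i)) (hg : HasWeakDeriv g g')
    (h1 : Tendsto f l (𝓝 g)) (h2 : Tendsto f' l (𝓝 g')) (h3 : Tendsto h l (𝓝 k)) :
    Tendsto (fun i => pm (pe (f i)) (h i)) l (𝓝 (pm (pe g) k)) := by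
  obtain ⟨C, hC, H⟩ := exists_sup_le_norm
  have b := H _ _ hg
  set A := Real.exp (C * (‖g‖ + ‖g'‖)) with hA
  have bE : EssBdd (pe g) A := b.exp.congr (pe_coe b)
  have e1 := tendsto_iff_norm_sub_tendsto_zero.1 h1
  have e2 := tendsto_iff_norm_sub_tendsto_zero.1 h2
  have e3 := tendsto_iff_norm_sub_tendsto_zero.1 h3
  have e0 : Tendsto (fun i => C * (‖f i - g‖ + ‖f' i - g'‖)) l (𝓝 0) := by
    simpa using (e1.add e2).const_mul C
  rw [tendsto_iff_norm_sub_tendsto_zero]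
  have z : Tendsto (fun i => A * (2 * (C * (‖f i - g‖ + ‖f' i - g'‖))) * ‖h i‖ + A * ‖h i - k‖)
      l (𝓝 0) := by
    simpa using (((e0.const_mul 2).const_mul A).mul h3.norm).add (e3.const_mul A)
  refine squeeze_zero' (Eventually.of_forall fun _ => norm_nonneg _) ?_ z
  filter_upwards [hf, e0.eventually (ge_mem_nhds one_pos)] with i hi hi1
  have bi := H _ _ hi
  have bd := H _ _ (hi.sub hg)
  have bEi := bi.exp.congr (pe_coe bi)
  have bdiff : EssBdd (pe (f i) - pe g : L2U) (A * (2 * (C * (‖f i - g‖ + ‖f' i - g'‖)))) := by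
    refine ⟨(Lp.memLp _).1, ?_⟩
    filter_upwards [Lp.coeFn_sub (pe (f i)) (pe g), pe_coe b, pe_coe bi, Lp.coeFn_sub (f i) g,
      bd.2, b.exp.2] with x a1 a2 a3 a4 a5 a6
    rw [a1, Pi.sub_apply, a2, a3]
    rw [a4, Pi.sub_apply] at a5
    have : Real.exp (f i x) - Real.exp (g x) =
        Real.exp (g x) * (Real.exp (f i x - g x) - 1) := by
      rw [mul_sub, ← Real.exp_add]; ring_nf
    rw [this, abs_mul]
    refine mul_le_mul a6 ((Real.abs_exp_sub_one_le (a5.trans hi1)).trans ?_) (abs_nonneg _)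
      (Real.exp_pos _).le
    gcongr
  have : pm (pe (f i)) (h i) - pm (pe g) k =
      pm (pe (f i) - pe g) (h i) + pm (pe g) (h i - k) := by
    rw [pm_sub bE, pm_sub_left bEi bE]; abel
  rw [this]
  exact (norm_add_le _ _).trans (add_le_add (norm_pm_le bdiff) (norm_pm_le bE))

/-- The derivatives of `e^u` are `e^u` times derivatives of `u`, and the induction provides `e^u`
with one derivative less. The start is order `1`, since order `0` does not make `u` bounded. -/
theorem Jet.exp_succ {δ : ℝ} {n : ℕ} {u : ℝ → L2U} (h : Jet δ (n + 1) u) :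
    Jet δ (n + 1) (fun t => pe (u t)) := by
  induction n with
  | zero =>
    have key : ∀ v : ℝ → L2U, ContinuousOn v (Ioc 0 δ) →
        ContinuousOn (fun t => pm (pe (u t)) (v t)) (Ioc 0 δ) := fun v hv t ht =>
      tendsto_pe_mul (eventually_mem_nhdsWithin.mono fun τ hτ => h.2.1 τ hτ) (h.2.1 t ht)
        (h.continuousOn t ht) (h.2.2.2.continuousOn t ht) (hv t ht)
    exact Jet.mk (h.1.exp h.2.1 h.2.2.2.continuousOn) h.2.1.exp (key _ h.2.2.1.continuousOn)
      (key _ h.2.2.2.continuousOn)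
  | succ n ih =>
    have h1 := ih h.of_succ
    have e : ∀ f g : ℝ → L2U, (fun t => pm (f t) (g t)) =
      fun t => pm (g t) (f t) := fun f g => funext fun t => pm_comm _ _
    refine Jet.mk (h.1.exp h.2.1 h.2.2.2.continuousOn) h.2.1.exp ?_ ?_
    · rw [e]; exact h.2.2.1.mul (h1.mono (by omega))
    · rw [e]; exact h.2.2.2.mul (h1.mono (by omega))

/-- Apply `∂ₓ` to the difference quotients of `u` in `t` and use that `∂ₓ` is closed. -/
theorem Jet.comm {δ : ℝ} {u : ℝ → L2U} (h : Jet δ 2 u) :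
    HasX δ (DL2 δ u) (DL2 δ (fun t => wderiv (u t))) := by
  intro t ht
  have h1 := h.1 t ht
  have h2 := h.2.2.2.1 t ht
  rw [hasDerivWithinAt_iff_tendsto_slope] at h1 h2
  have : (𝓝[Ioc 0 δ \ {t}] t).NeBot :=
    accPt_principal_iff_nhdsWithin.1 (uniqueDiffWithinAt_iff_accPt.1 (uniqueDiffOn_Ioc 0 δ t ht))
  have h3 : HasWeakDeriv (t⁻¹ • DL2 δ u t) (t⁻¹ • DL2 δ (fun t => wderiv (u t)) t) := by
    refine HasWeakDeriv.of_tendsto ?_ h1 h2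
    filter_upwards [self_mem_nhdsWithin] with τ hτ
    rw [slope_def_module, slope_def_module]
    exact ((h.2.1 τ hτ.1).sub (h.2.1 t ht)).smul _
  have := h3.smul t
  rwa [smul_smul, smul_smul, mul_inv_cancel₀ ht.1.ne', one_smul, one_smul] at this

/-! ### Weighted norms of jets and their multiplicativity -/

/-- The sum of the weighted norms of all derivatives of order at most `n` (one summand for each
word in `D` and `∂ₓ`). -/
def NN (μ : ℝ → ℝ) (δ : ℝ) : ℕ → (ℝ → L2U) → ℝ → ℝ
  | 0, u, t => wn μ t (u t)
  | n + 1, u, t => wn μ t (u t) + NN μ δ n (DL2 δ u) t + NN μ δ n (fun s => wderiv (u s)) t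

section
variable {μ ν ρ : ℝ → ℝ} {δ δ₀ t : ℝ} {n k : ℕ} {u v w : ℝ → L2U}

theorem NN_nonneg : 0 ≤ NN μ δ n u t := by
  induction n generalizing u with
  | zero => exact wn_nonneg _ _ _
  | succ n ih => exact add_nonneg (add_nonneg (wn_nonneg _ _ _) ih) ih

theorem wn_le_NN : wn μ t (u t) ≤ NN μ δ n u t := by
  cases n with
  | zero => exact le_rfl
  | succ n =>
    have h1 : 0 ≤ NN μ δ n (DL2 δ u) t := NN_nonneg
    have h2 : 0 ≤ NN μ δ n (fun s => wderiv (u s)) t := NN_nonneg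
    simp only [NN]; linarith

theorem NN_le_succ : NN μ δ n u t ≤ NN μ δ (n + 1) u t := by
  induction n generalizing u with
  | zero => exact wn_le_NN
  | succ n ih => exact add_le_add (add_le_add le_rfl ih) ih

theorem NN_mono (h : k ≤ n) : NN μ δ k u t ≤ NN μ δ n u t := by
  induction h with
  | refl => exact le_rfl
  | step _ ih => exact ih.trans NN_le_succ

theorem NN_congr (e : EqOn u v (Ioc 0 δ)) (ht : t ∈ Ioc 0 δ) : NN μ δ n u t = NN μ δ n v t := by
  induction n generalizing u v with
  | zero => simp only [NN, e ht]
  | succ n ih =>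
    have ex : EqOn (fun t => wderiv (u t)) (fun t => wderiv (v t)) (Ioc 0 δ) := fun t ht => by
      simp only [e ht]
    simp only [NN]
    rw [e ht, ih (DL2_congr e), ih ex]

theorem NN_succ_eq (h1 : HasD δ u v) (h2 : HasX δ u w) (ht : t ∈ Ioc 0 δ) :
    NN μ δ (n + 1) u t = wn μ t (u t) + NN μ δ n v t + NN μ δ n w t := by
  simp only [NN]
  rw [NN_congr h1.eq ht, NN_congr h2.eq ht]

theorem NN_add_le (hμ : Continuous μ) (hu : Jet δ n u) (hv : Jet δ n v) (ht : t ∈ Ioc 0 δ) :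
    NN μ δ n (u + v) t ≤ NN μ δ n u t + NN μ δ n v t := by
  induction n generalizing u v with
  | zero => exact wn_add_le hμ ht.1 _ _
  | succ n ih =>
    rw [NN_succ_eq (hu.1.add hv.1) (hu.2.1.add hv.2.1) ht]
    have h1 := wn_add_le hμ ht.1 (u t) (v t)
    have h2 := ih hu.2.2.1 hv.2.2.1
    have h3 := ih hu.2.2.2 hv.2.2.2
    simp only [NN, Pi.add_apply]
    linarith

theorem NN_smul (hμ : Continuous μ) (c : ℝ) (hu : Jet δ n u) (ht : t ∈ Ioc 0 δ) :
    NN μ δ n (c • u) t = |c| * NN μ δ n u t := by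
  induction n generalizing u with
  | zero => exact wn_smul hμ ht.1 _ _
  | succ n ih =>
    rw [NN_succ_eq (hu.1.smul c) (hu.2.1.smul c) ht, ih hu.2.2.1, ih hu.2.2.2, Pi.smul_apply,
      wn_smul hμ ht.1]
    simp only [NN]
    ring

theorem exists_NN_le (hμ : Continuous μ) (hρ : Continuous ρ) (h : ∀ x, ρ x ≤ μ x) (δ₀ : ℝ)
    (n : ℕ) : ∃ C, 0 ≤ C ∧ ∀ δ ≤ δ₀, ∀ t ∈ Ioc 0 δ, ∀ u, NN ρ δ n u t ≤ C * NN μ δ n u t := by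
  obtain ⟨C, hC, H⟩ := exists_wn_le hμ hρ h δ₀
  refine ⟨C, hC, fun δ hδ t ht u => ?_⟩
  induction n generalizing u with
  | zero => exact H t ht.1 (ht.2.trans hδ) _
  | succ n ih =>
    have h1 := H t ht.1 (ht.2.trans hδ) (u t)
    have h2 := ih (DL2 δ u)
    have h3 := ih (fun s => wderiv (u s))
    simp only [NN]
    linarith

/-- Estimate `v` in the sup norm by `t^(ρ - μ)`, allowed because `ρ - μ < ν`; the remaining `t^{-ρ}
t^(ρ - μ) = t^{-μ}` is the weight of `u`. -/
theorem exists_wn_mul_le (hμ : Continuous μ) (hν : Continuous ν) (hρ : Continuous ρ)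
    (h : ∀ x, ρ x < μ x + ν x) (δ₀ : ℝ) : ∃ C, 0 ≤ C ∧ ∀ δ ≤ δ₀, ∀ t ∈ Ioc 0 δ, ∀ u v : ℝ → L2U,
      Jet δ 1 v → wn ρ t (pm (u t) (v t)) ≤ C * wn μ t (u t) * NN ν δ 1 v t := by
  obtain ⟨C, hC, H⟩ := exists_sup_le hν (hρ.sub hμ)
    (fun x => by simp only [Pi.sub_apply]; linarith [h x]) δ₀
  refine ⟨C, hC, fun δ hδ t ht u v hv => ?_⟩
  obtain ⟨B, hB⟩ := (hv.2.1 t ht).exists_essBdd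
  have : wn ρ t (pm (u t) (v t)) ≤ C * (wn ν t (v t) + wn ν t (wderiv (v t))) * wn μ t (u t) := by
    refine wn_le_of_ae hμ hρ ht.1 ?_
    rw [pm_comm]
    filter_upwards [H t ht.1 (ht.2.trans hδ) _ _ (hv.2.1 t ht), pm_coe hB] with x h1 h2
    rw [h2, abs_mul]
    calc t ^ (-ρ x) * (|v t x| * |u t x|)
        ≤ t ^ (-ρ x) * ((C * t ^ (ρ x - μ x) * (wn ν t (v t) + wn ν t (wderiv (v t)))) *
          |u t x|) := by
          have := Real.rpow_nonneg ht.1.le (-ρ x)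
          gcongr
          exact h1
      _ = _ := by
          rw [show t ^ (-μ x) = t ^ (-ρ x) * t ^ (ρ x - μ x) by
            rw [← Real.rpow_add ht.1]; ring_nf]
          ring
  refine this.trans ?_
  have h3 : wn ν t (v t) + wn ν t (wderiv (v t)) ≤ NN ν δ 1 v t := by
    simp only [NN]
    linarith [wn_nonneg ν t (DL2 δ v t)]
  have h4 := wn_nonneg μ t (u t)
  calc _ ≤ C * NN ν δ 1 v t * wn μ t (u t) := by gcongr
    _ = _ := by ring

/-- The weighted norms are multiplicative up to an arbitrarily small loss in the exponent. -/
theorem exists_NN_mul_le (hμ : Continuous μ) (hν : Continuous ν) (hρ : Continuous ρ)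
    (h : ∀ x, ρ x < μ x + ν x) (δ₀ : ℝ) (n : ℕ) : ∃ C, 0 ≤ C ∧ ∀ δ ≤ δ₀, ∀ t ∈ Ioc 0 δ, ∀ u v,
      Jet δ n u → Jet δ (max n 1) v →
      NN ρ δ n (fun s => pm (u s) (v s)) t ≤ C * NN μ δ n u t * NN ν δ (max n 1) v t := by
  induction n generalizing μ ν with
  | zero =>
    obtain ⟨C, hC, H⟩ := exists_wn_mul_le hμ hν hρ h δ₀
    exact ⟨C, hC, fun δ hδ t ht u v _ hv => H δ hδ t ht u v hv⟩
  | succ n ih =>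
    obtain ⟨C₀, hC₀, H₀⟩ := exists_wn_mul_le hμ hν hρ h δ₀
    obtain ⟨C₁, hC₁, H₁⟩ := ih hμ hν h
    -- The weights are exchanged for the terms in which the derivative falls on `v`.
    obtain ⟨C₂, hC₂, H₂⟩ := ih hν hμ (fun x => by linarith [h x])
    refine ⟨C₀ + 2 * C₁ + 2 * C₂, by positivity, fun δ hδ t ht u v hu hv => ?_⟩
    have m1 : max n 1 ≤ n + 1 := by omega
    have m2 : max (n + 1) 1 = n + 1 := by omega
    rw [m2] at hv ⊢
    have c : ∀ a b : ℝ → L2U, (fun s => pm (a s) (b s)) = fun s => pm (b s) (a s) :=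
      fun a b => funext fun s => pm_comm _ _
    rw [NN_succ_eq (hu.1.mul hv.1 hu.2.1 hv.2.1 hu.2.2.2.continuousOn) (hu.2.1.mul hv.2.1) ht]
    have j1 := hu.2.2.1.mul (hv.mono m1)
    have j2 := hv.2.2.1.mul (hu.mono m1)
    have j3 := hu.2.2.2.mul (hv.mono m1)
    have j4 := hv.2.2.2.mul (hu.mono m1)
    have b1 := H₁ δ hδ t ht _ _ hu.2.2.1 (hv.mono m1)
    have b2 := H₂ δ hδ t ht _ _ hv.2.2.1 (hu.mono m1)
    have b3 := H₁ δ hδ t ht _ _ hu.2.2.2 (hv.mono m1)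
    have b4 := H₂ δ hδ t ht _ _ hv.2.2.2 (hu.mono m1)
    rw [c] at j1 j2 j3 j4 b1 b2 b3 b4
    have a1 := NN_add_le hρ j1 j2 ht
    have a2 := NN_add_le hρ j3 j4 ht
    have b0 := H₀ δ hδ t ht u v (hv.mono (by omega))
    set U := NN μ δ (n + 1) u t
    set V := NN ν δ (n + 1) v t
    have u0 : wn μ t (u t) ≤ U := wn_le_NN
    have uD : NN μ δ n (DL2 δ u) t ≤ U := by
      have h1 := wn_nonneg μ t (u t)
      have h2 : 0 ≤ NN μ δ n (fun s => wderiv (u s)) t := NN_nonneg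
      simp only [U, NN]; linarith
    have uX : NN μ δ n (fun s => wderiv (u s)) t ≤ U := by
      have h1 := wn_nonneg μ t (u t)
      have h2 : 0 ≤ NN μ δ n (DL2 δ u) t := NN_nonneg
      simp only [U, NN]; linarith
    have vD : NN ν δ n (DL2 δ v) t ≤ V := by
      have h1 := wn_nonneg ν t (v t)
      have h2 : 0 ≤ NN ν δ n (fun s => wderiv (v s)) t := NN_nonneg
      simp only [V, NN]; linarith
    have vX : NN ν δ n (fun s => wderiv (v s)) t ≤ V := by
      have h1 := wn_nonneg ν t (v t)
      have h2 : 0 ≤ NN ν δ n (DL2 δ v) t := NN_nonneg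
      simp only [V, NN]; linarith
    have uM : NN μ δ (max n 1) u t ≤ U := NN_mono m1
    have vM : NN ν δ (max n 1) v t ≤ V := NN_mono m1
    have v1 : NN ν δ 1 v t ≤ V := NN_mono (by omega)
    have hU : 0 ≤ U := NN_nonneg
    have hV : 0 ≤ V := NN_nonneg
    have p1 : 0 ≤ NN ν δ (max n 1) v t := NN_nonneg
    have p2 : 0 ≤ NN μ δ (max n 1) u t := NN_nonneg
    have p3 : 0 ≤ NN ν δ 1 v t := NN_nonneg
    have d0 : C₀ * wn μ t (u t) * NN ν δ 1 v t ≤ C₀ * U * V := by gcongr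
    have d1 : C₁ * NN μ δ n (DL2 δ u) t * NN ν δ (max n 1) v t ≤ C₁ * U * V := by gcongr
    have d2 : C₂ * NN ν δ n (DL2 δ v) t * NN μ δ (max n 1) u t ≤ C₂ * V * U := by gcongr
    have d3 : C₁ * NN μ δ n (fun s => wderiv (u s)) t * NN ν δ (max n 1) v t ≤ C₁ * U * V := by
      gcongr
    have d4 : C₂ * NN ν δ n (fun s => wderiv (v s)) t * NN μ δ (max n 1) u t ≤ C₂ * V * U := by
      gcongr
    linarith [show (C₀ + 2 * C₁ + 2 * C₂) * U * V = C₀ * U * V + C₁ * U * V + C₂ * V * U +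
      C₁ * U * V + C₂ * V * U by ring]

theorem DL2_iterate_congr (p : ℕ) (e : EqOn u v (Ioc 0 δ)) :
    EqOn ((DL2 δ)^[p] u) ((DL2 δ)^[p] v) (Ioc 0 δ) := by
  induction p generalizing u v with
  | zero => exact e
  | succ p ih => exact ih (DL2_congr e)

theorem Jet.iterate_comm {p : ℕ} (h : Jet δ (p + 1) u) :
    EqOn ((DL2 δ)^[p] (fun s => wderiv (u s))) (fun s => wderiv ((DL2 δ)^[p] u s)) (Ioc 0 δ) := by
  induction p generalizing u with
  | zero => exact fun _ _ => rfl
  | succ p ih =>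
    intro t ht
    have h1 := DL2_iterate_congr p ((h.mono (by omega : 2 ≤ p + 1 + 1)).comm.eq)
    simp only [Function.iterate_succ, Function.comp]
    rw [← h1 ht, ih h.2.2.1 ht]

theorem Jet.mixed_wderiv {p q : ℕ} (h : Jet δ (n + 1) u) (hpq : p + q ≤ n) (ht : t ∈ Ioc 0 δ) :
    wderiv^[q] ((DL2 δ)^[p] (fun s => wderiv (u s)) t) = wderiv^[q + 1] ((DL2 δ)^[p] u t) := by
  rw [(h.mono (by omega : p + 1 ≤ n + 1)).iterate_comm ht]
  rfl

/-- Each word in `D` and `∂ₓ` can be reordered to `∂ₓ^q D^p` because the two commute on jets. The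
factor `3` per level counts the three summands of `NN`. -/
theorem NN_le_of_mixed {B : ℝ} (h : Jet δ n u) (ht : t ∈ Ioc 0 δ)
    (H : ∀ p q, p + q ≤ n → wn μ t (wderiv^[q] ((DL2 δ)^[p] u t)) ≤ B) :
    NN μ δ n u t ≤ 3 ^ n * B := by
  induction n generalizing u with
  | zero => simpa [NN] using H 0 0 le_rfl
  | succ n ih =>
    have h0 := H 0 0 (by omega)
    have h1 := ih h.2.2.1 (fun p q hpq => H (p + 1) q (by omega))
    have h2 := ih h.2.2.2 (fun p q hpq => by
      rw [h.mixed_wderiv hpq ht]; exact H p (q + 1) (by omega))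
    have hB : 0 ≤ B := (wn_nonneg _ _ _).trans h0
    have h3 : (1 : ℝ) ≤ 3 ^ n := one_le_pow₀ (by norm_num)
    simp only [Function.iterate_zero, id] at h0
    simp only [NN]
    rw [pow_succ]
    nlinarith

theorem mixed_le_NN {p q : ℕ} (hpq : p + q ≤ n) :
    wn μ t (wderiv^[q] ((DL2 δ)^[p] u t)) ≤ NN μ δ n u t := by
  induction n generalizing u p q with
  | zero =>
    obtain ⟨rfl, rfl⟩ : p = 0 ∧ q = 0 := by omega
    exact le_rfl
  | succ n ih =>
    have h0 := wn_nonneg μ t (u t)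
    have h1 : 0 ≤ NN μ δ n (DL2 δ u) t := NN_nonneg
    have h2 : 0 ≤ NN μ δ n (fun s => wderiv (u s)) t := NN_nonneg
    rcases p with _ | p
    · rcases q with _ | q
      · exact wn_le_NN
      · have := ih (u := fun s => wderiv (u s)) (p := 0) (q := q) (by omega)
        simp only [NN]
        simp only [Function.iterate_zero, id, Function.iterate_succ, Function.comp] at this ⊢
        linarith
    · have := ih (u := DL2 δ u) (p := p) (q := q) (by omega)
      simp only [NN]
      simp only [Function.iterate_succ, Function.comp] at this ⊢
      linarith

theorem HasD.id_smul (h : HasD δ u v) :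
    HasD δ (fun s => s • u s) ((fun s => s • u s) + fun s => s • v s) := by
  intro t ht
  have := (hasDerivWithinAt_id t (Ioc 0 δ)).smul (h t ht)
  refine this.congr_deriv ?_
  simp only [id, Pi.add_apply, one_smul, smul_add, smul_smul]
  rw [inv_mul_cancel₀ ht.1.ne', mul_inv_cancel₀ ht.1.ne', one_smul, one_smul, add_comm]

theorem HasX.id_smul (h : HasX δ u v) : HasX δ (fun s => s • u s) (fun s => s • v s) :=
  fun t ht => (h t ht).smul t

theorem Jet.id_smul (h : Jet δ n u) : Jet δ n (fun s => s • u s) := by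
  induction n generalizing u with
  | zero => exact continuousOn_id.smul h
  | succ n ih =>
    exact Jet.mk h.1.id_smul h.2.1.id_smul ((ih h.of_succ).add (ih h.2.2.1)) (ih h.2.2.2)

/-- Because `D (t u) = t u + t D u`, one level now produces four terms, whence `4^n`. -/
theorem NN_id_smul_le {B : ℝ} (hμ : Continuous μ) (h : Jet δ n u) (ht : t ∈ Ioc 0 δ)
    (H : ∀ p q, p + q ≤ n → t * wn μ t (wderiv^[q] ((DL2 δ)^[p] u t)) ≤ B) :
    NN μ δ n (fun s => s • u s) t ≤ 4 ^ n * B := by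
  induction n generalizing u with
  | zero =>
    have := H 0 0 le_rfl
    simp only [NN, wn_smul hμ ht.1, abs_of_pos ht.1]
    simpa using this
  | succ n ih =>
    have h0 := H 0 0 (by omega)
    have h1 := ih h.2.2.1 (fun p q hpq => H (p + 1) q (by omega))
    have h2 := ih h.2.2.2 (fun p q hpq => by
      rw [h.mixed_wderiv hpq ht]; exact H p (q + 1) (by omega))
    have h3 := ih h.of_succ (fun p q hpq => H p q (by omega))
    have hB : 0 ≤ B := (mul_nonneg ht.1.le (wn_nonneg _ _ _)).trans h0
    have h4 : (1 : ℝ) ≤ 4 ^ n := one_le_pow₀ (by norm_num)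
    simp only [Function.iterate_zero, id] at h0
    rw [NN_succ_eq h.1.id_smul h.2.1.id_smul ht]
    have h5 := NN_add_le hμ h.of_succ.id_smul h.2.2.1.id_smul ht
    have h6 : wn μ t (t • u t) = t * wn μ t (u t) := by
      rw [wn_smul hμ ht.1, abs_of_pos ht.1]
    rw [pow_succ, h6]
    nlinarith

/-- Control of `u`, `D u` and `t ∂ₓ u` by derivatives of order at most `n + 1`, when a factor `t`
accompanies the highest spatial derivative. -/
theorem exists_NN_le_of_tilde (hμ : Continuous μ) (δ₀ : ℝ) (n : ℕ) : ∃ C, 0 ≤ C ∧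
    ∀ δ ≤ δ₀, ∀ t ∈ Ioc 0 δ, ∀ u B, Jet δ (n + 1) u →
      (∀ p q, p + q ≤ n + 1 →
        (if q = n + 1 then t else 1) * wn μ t (wderiv^[q] ((DL2 δ)^[p] u t)) ≤ B) →
      NN μ δ n u t ≤ C * B ∧ NN μ δ n (DL2 δ u) t ≤ C * B ∧
        NN μ δ n (fun s => s • wderiv (u s)) t ≤ C * B := by
  refine ⟨4 ^ n * max 1 δ₀, by positivity, fun δ hδ t ht u B hu H => ?_⟩
  have hB : 0 ≤ B := by
    refine le_trans ?_ (H 0 0 (by omega))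
    rw [if_neg (by omega)]
    exact mul_nonneg zero_le_one (wn_nonneg _ _ _)
  have h1 : ∀ p q, p + q ≤ n + 1 → q ≤ n → wn μ t (wderiv^[q] ((DL2 δ)^[p] u t)) ≤ B := by
    intro p q hpq hq
    have := H p q hpq
    rwa [if_neg (by omega), one_mul] at this
  have h34 : (3 : ℝ) ^ n * B ≤ 4 ^ n * max 1 δ₀ * B := by
    have : (3 : ℝ) ^ n ≤ 4 ^ n := pow_le_pow_left₀ (by norm_num) (by norm_num) n
    have h' : (1 : ℝ) ≤ max 1 δ₀ := le_max_left _ _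
    have : (3 : ℝ) ^ n ≤ 4 ^ n * max 1 δ₀ := by
      nlinarith [pow_pos (show (0 : ℝ) < 4 by norm_num) n]
    exact mul_le_mul_of_nonneg_right this hB
  refine ⟨?_, ?_, ?_⟩
  · exact (NN_le_of_mixed hu.of_succ ht fun p q hpq => h1 p q (by omega) (by omega)).trans h34
  · exact (NN_le_of_mixed hu.2.2.1 ht fun p q hpq => h1 (p + 1) q (by omega) (by omega)).trans h34
  · have := NN_id_smul_le (B := max 1 δ₀ * B) hμ hu.2.2.2 ht (fun p q hpq => by
      -- Only `∂ₓ^(n+1)` needs the factor `t` from the tilde norm; for fewer spatial derivatives `t`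
      -- is simply bounded by `max 1 δ₀`.
      rw [hu.mixed_wderiv hpq ht]
      rcases eq_or_ne (q + 1) (n + 1) with hq | hq
      · have := H p (q + 1) (by omega)
        rw [if_pos hq] at this
        exact this.trans (le_mul_of_one_le_left hB (le_max_left _ _))
      · exact mul_le_mul (ht.2.trans (hδ.trans (le_max_right _ _)))
          (h1 p (q + 1) (by omega) (by omega)) (wn_nonneg _ _ _) (by positivity))
    rwa [← mul_assoc] at this

end

/-! ### Jets versus C^p curves in H^j(U) -/

/-- The underlying function as a continuous linear map on `H^j(U)`. -/
def sobFnL (j : ℕ) : Sobolev j →L[ℝ] L2U :=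
  (PiLp.proj 2 (fun _ : Fin (j + 1) => L2U) 0).comp (Sobolev j).subtypeL

theorem sobFnL_apply {j : ℕ} (u : Sobolev j) : sobFnL j u = sobFn u := rfl

/-- The weak derivative as a linear map `H^{j+1}(U) → H^j(U)`. -/
def sobShiftₗ (j : ℕ) : Sobolev (j + 1) →ₗ[ℝ] Sobolev j where
  toFun u := ⟨WithLp.toLp 2 fun q : Fin (j + 1) => u.1 q.succ, fun q => u.2 q.succ⟩
  map_add' _ _ := rfl
  map_smul' _ _ := rfl

theorem norm_sobShift_le {j : ℕ} (u : Sobolev (j + 1)) : ‖sobShiftₗ j u‖ ≤ 1 * ‖u‖ := by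
  rw [one_mul]
  change ‖(sobShiftₗ j u).1‖ ≤ ‖u.1‖
  rw [PiLp.norm_eq_of_L2, PiLp.norm_eq_of_L2]
  refine Real.sqrt_le_sqrt ?_
  rw [Fin.sum_univ_succ (n := j + 1)]
  exact le_add_of_nonneg_left (sq_nonneg _)

/-- The weak derivative as a continuous linear map `H^{j+1}(U) → H^j(U)`. -/
def sobShift (j : ℕ) : Sobolev (j + 1) →L[ℝ] Sobolev j :=
  (sobShiftₗ j).mkContinuous 1 norm_sobShift_le

theorem hasWeakDeriv_sobShift {j : ℕ} (u : Sobolev (j + 1)) :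
    HasWeakDeriv (sobFn u) (sobFn (sobShift j u)) := u.2 0

/-- `u ∈ C^p((0,δ], H^j(U))`, for a curve `u` in `L²(U)`. -/
def CurveC (δ : ℝ) (p j : ℕ) (u : ℝ → L2U) : Prop :=
  ∃ W : ℝ → Sobolev j, ContDiffOn ℝ p W (Ioc 0 δ) ∧ ∀ t ∈ Ioc 0 δ, u t = sobFn (W t)

/-- Applying `D` lowers `p` by one and keeps `j`, applying `∂ₓ` lowers `j` and keeps `p`; both map
the scale `C^p(H^(m+1-p))` to the same scale for `m`. -/
theorem Jet.of_curveC {δ : ℝ} {m : ℕ} {u : ℝ → L2U} (h : ∀ p ≤ m, CurveC δ p (m - p) u) :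
    Jet δ m u := by
  induction m generalizing u with
  | zero =>
    obtain ⟨W, hW, e⟩ := h 0 le_rfl
    exact ((sobFnL _).continuous.comp_continuousOn hW.continuousOn).congr e
  | succ m ih =>
    have hU : UniqueDiffOn ℝ (Ioc 0 δ) := uniqueDiffOn_Ioc 0 δ
    have key : ∀ p j (W : ℝ → Sobolev j), ContDiffOn ℝ ((p + 1 : ℕ) : WithTop ℕ∞) W (Ioc 0 δ) →
        (∀ t ∈ Ioc 0 δ, u t = sobFn (W t)) →
        HasD δ u (fun t => sobFn (t • derivWithin W (Ioc 0 δ) t)) ∧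
        ContDiffOn ℝ p (fun t => t • derivWithin W (Ioc 0 δ) t) (Ioc 0 δ) := by
      intro p j W hW e
      constructor
      · intro t ht
        have h1 : HasDerivWithinAt W (derivWithin W (Ioc 0 δ) t) (Ioc 0 δ) t :=
          (hW.differentiableOn (by simp) t ht).hasDerivWithinAt
        have h2 := (sobFnL j).hasFDerivAt.comp_hasDerivWithinAt t h1
        have h3 : t⁻¹ • sobFn (t • derivWithin W (Ioc 0 δ) t) =
            sobFnL j (derivWithin W (Ioc 0 δ) t) := by
          rw [← sobFnL_apply, map_smul, smul_smul, inv_mul_cancel₀ ht.1.ne', one_smul]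
        rw [h3]
        exact h2.congr e (e t ht)
      · exact contDiffOn_id.smul (hW.derivWithin hU (by simp))
    obtain ⟨W₁, hW₁, e₁⟩ := h 1 (by omega)
    have hD := (key 0 _ W₁ (by simpa using hW₁) e₁).1
    obtain ⟨W₀, -, e₀⟩ := h 0 (by omega)
    have hX : HasX δ u (fun t => wderiv (u t)) := by
      intro t ht
      have := hasWeakDeriv_sobShift (j := m) (W₀ t)
      rw [← e₀ t ht] at this
      exact this.self
    refine ⟨hD.congr (fun _ _ => rfl) hD.eq, hX, ih ?_, ih ?_⟩
    · intro p hp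
      have hj : m + 1 - (p + 1) = m - p := by omega
      have := h (p + 1) (by omega)
      rw [hj] at this
      obtain ⟨W, hW, e⟩ := this
      obtain ⟨k1, k2⟩ := key p _ W hW e
      exact ⟨_, k2, fun t ht => k1.eq ht⟩
    · intro p hp
      have hj : m + 1 - p = m - p + 1 := by omega
      have := h p (by omega)
      rw [hj] at this
      obtain ⟨W, hW, e⟩ := this
      refine ⟨fun t => sobShift _ (W t), (sobShift _).contDiff.comp_contDiffOn hW, fun t ht => ?_⟩
      have := hasWeakDeriv_sobShift (W t)
      rw [← e t ht] at this
      exact this.wderiv_eq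

theorem Jet.hasWeakDeriv_iterate {δ : ℝ} {n : ℕ} {u : ℝ → L2U} (h : Jet δ n u) {t : ℝ}
    (ht : t ∈ Ioc 0 δ) {q : ℕ} (hq : q < n) :
    HasWeakDeriv (wderiv^[q] (u t)) (wderiv^[q + 1] (u t)) := by
  induction q generalizing n u with
  | zero =>
    obtain ⟨n, rfl⟩ : ∃ k, n = k + 1 := ⟨n - 1, by omega⟩
    exact h.2.1 t ht
  | succ q ih =>
    obtain ⟨n, rfl⟩ : ∃ k, n = k + 1 := ⟨n - 1, by omega⟩
    exact ih h.2.2.2 (by omega)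

theorem Jet.iterate_wderiv {δ : ℝ} {n q : ℕ} {u : ℝ → L2U} (h : Jet δ (n + q) u) :
    Jet δ n (fun t => wderiv^[q] (u t)) := by
  induction q generalizing u with
  | zero => exact h
  | succ q ih => exact ih (u := fun t => wderiv (u t)) h.2.2.2

theorem Jet.hasD_iterate {δ : ℝ} {q : ℕ} {u : ℝ → L2U} (h : Jet δ (q + 1) u) :
    HasD δ (fun t => wderiv^[q] (u t)) (fun t => wderiv^[q] (DL2 δ u t)) := by
  induction q generalizing u with
  | zero => exact h.1
  | succ q ih =>
    have := ih h.2.2.2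
    refine this.congr (fun _ _ => rfl) fun t ht => ?_
    simp only [Function.iterate_succ, Function.comp]
    exact congrArg _ ((h.mono (by omega : 2 ≤ q + 1 + 1)).comm.eq ht)

open Classical in
/-- The curve in `H^j(U)` underlying a curve in `L²(U)`. -/
def liftCurve (j : ℕ) (u : ℝ → L2U) (t : ℝ) : Sobolev j :=
  if h : ∀ q < j, HasWeakDeriv (wderiv^[q] (u t)) (wderiv^[q + 1] (u t)) then
    ⟨WithLp.toLp 2 fun q : Fin (j + 1) => wderiv^[q] (u t), fun q => h q q.2⟩
  else 0

theorem liftCurve_val {δ : ℝ} {n j : ℕ} {u : ℝ → L2U} (h : Jet δ n u) (hj : j ≤ n) {t : ℝ}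
    (ht : t ∈ Ioc 0 δ) : (liftCurve j u t).1 =
      WithLp.toLp 2 fun q : Fin (j + 1) => wderiv^[q] (u t) := by
  rw [liftCurve, dif_pos fun q hq => h.hasWeakDeriv_iterate ht (by omega)]

/-- The lifted curve has derivative `t⁻¹` times the lift of `D u`, which gives induction on `p`.
Limits of difference quotients are taken componentwise in the ambient product, of which `H^j(U)`
carries the subspace topology. -/
theorem Jet.contDiffOn_liftCurve {δ : ℝ} {n p j : ℕ} {u : ℝ → L2U} (h : Jet δ n u)
    (hpj : p + j ≤ n) : ContDiffOn ℝ p (liftCurve j u) (Ioc 0 δ) := by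
  induction p generalizing n u with
  | zero =>
    rw [Nat.cast_zero, contDiffOn_zero]
    rw [Topology.IsInducing.subtypeVal.continuousOn_iff]
    have e : EqOn (Subtype.val ∘ liftCurve j u)
        (fun t => WithLp.toLp 2 fun q : Fin (j + 1) => wderiv^[q] (u t)) (Ioc 0 δ) :=
      fun t ht => liftCurve_val h (by omega) ht
    refine ContinuousOn.congr ?_ e
    refine (PiLp.continuous_toLp 2 _).comp_continuousOn (continuousOn_pi.2 fun q => ?_)
    exact ((h.mono (by omega : 0 + (q : ℕ) ≤ n)).iterate_wderiv).continuousOn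
  | succ p ih =>
    obtain ⟨n, rfl⟩ : ∃ k, n = k + 1 := ⟨n - 1, by omega⟩
    have hder : ∀ t ∈ Ioc 0 δ, HasDerivWithinAt (liftCurve j u)
        (t⁻¹ • liftCurve j (DL2 δ u) t) (Ioc 0 δ) t := by
      intro t ht
      have h1 : HasDerivWithinAt
          (fun t => (WithLp.toLp 2 fun q : Fin (j + 1) => wderiv^[q] (u t) :
            PiLp 2 fun _ : Fin (j + 1) => L2U))
          (WithLp.toLp 2 fun q : Fin (j + 1) => t⁻¹ • wderiv^[q] (DL2 δ u t)) (Ioc 0 δ) t := by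
        have h0 : HasDerivWithinAt (fun t => fun q : Fin (j + 1) => wderiv^[q] (u t))
            (fun q : Fin (j + 1) => t⁻¹ • wderiv^[q] (DL2 δ u t)) (Ioc 0 δ) t :=
          hasDerivWithinAt_pi.2 fun q =>
            (h.mono (by omega : (q : ℕ) + 1 ≤ n + 1)).hasD_iterate t ht
        exact (PiLp.continuousLinearEquiv 2 ℝ
          (fun _ : Fin (j + 1) => L2U)).symm.hasFDerivAt.comp_hasDerivWithinAt t h0
      have h2 : HasDerivWithinAt (fun t => (liftCurve j u t).1)
          (t⁻¹ • liftCurve j (DL2 δ u) t).1 (Ioc 0 δ) t := by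
        refine HasDerivWithinAt.congr ?_ (fun s hs => liftCurve_val h (by omega) hs)
          (liftCurve_val h (by omega) ht)
        refine h1.congr_deriv ?_
        rw [Submodule.coe_smul, liftCurve_val h.2.2.1 (by omega) ht]
        rfl
      rw [hasDerivWithinAt_iff_tendsto_slope] at h2 ⊢
      rw [tendsto_subtype_rng]
      refine h2.congr fun s => ?_
      rw [slope_def_module, slope_def_module]
      rfl
    have hU : UniqueDiffOn ℝ (Ioc 0 δ) := uniqueDiffOn_Ioc 0 δ
    rw [Nat.cast_succ, contDiffOn_succ_iff_derivWithin hU]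
    refine ⟨fun t ht => (hder t ht).differentiableWithinAt, by simp, ?_⟩
    have h3 : ContDiffOn ℝ p (fun t => t⁻¹ • liftCurve j (DL2 δ u) t) (Ioc 0 δ) :=
      (contDiffOn_id.inv fun t ht => ht.1.ne').smul (ih h.2.2.1 (by omega))
    exact h3.congr fun t ht => (hder t ht).derivWithin (hU t ht)

theorem Jet.curveC {δ : ℝ} {n p j : ℕ} {u : ℝ → L2U} (h : Jet δ n u)
    (hpj : p + j ≤ n) : CurveC δ p j u := by
  refine ⟨liftCurve j u, h.contDiffOn_liftCurve hpj, fun t ht => ?_⟩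
  rw [sobFn, liftCurve_val h (by omega) ht]
  rfl

theorem MemC.curveC {δ : ℝ} {p j : ℕ} {w : ℝ → ℝ → ℝ} (h : MemC δ p j w) :
    CurveC δ p j (fun t => toL2 (w t)) := by
  obtain ⟨W, hW, e⟩ := h
  exact ⟨W, hW, fun t ht => toL2_eq (e t ht)⟩

theorem CurveC.memC {δ : ℝ} {p j : ℕ} {w : ℝ → ℝ → ℝ}
    (hw : ∀ t ∈ Ioc 0 δ, MemLp (w t) 2 measU) (h : CurveC δ p j (fun t => toL2 (w t))) :
    MemC δ p j w := by
  obtain ⟨W, hW, e⟩ := h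
  refine ⟨W, hW, fun t ht => ?_⟩
  rw [← e t ht]
  exact (toL2_coe (hw t ht)).symm

/-! ### Time-independent functions and the logarithm -/

/-- The class `f` has `n` weak derivatives in `L²(U)`. -/
def HasJets : ℕ → L2U → Prop
  | 0, _ => True
  | n + 1, f => HasWeakDeriv f (wderiv f) ∧ HasJets n (wderiv f)

theorem Sobolev.hasJets {n : ℕ} (u : Sobolev n) : HasJets n (sobFn u) := by
  induction n with
  | zero => trivial
  | succ n ih =>
    have := hasWeakDeriv_sobShift u
    refine ⟨this.self, ?_⟩
    rw [this.wderiv_eq]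
    exact ih _

theorem HasJets.of_succ {n : ℕ} {f : L2U} (h : HasJets (n + 1) f) : HasJets n f := by
  induction n generalizing f with
  | zero => trivial
  | succ n ih => exact ⟨h.1, ih h.2⟩

theorem MemSobolev.hasJets {n : ℕ} {f : ℝ → ℝ} (h : MemSobolev n f) : HasJets n (toL2 f) := by
  obtain ⟨u, hu⟩ := h
  rw [toL2_eq hu]
  exact Sobolev.hasJets u

theorem MemSobolev.memLp {n : ℕ} {f : ℝ → ℝ} (h : MemSobolev n f) : MemLp f 2 measU := by
  obtain ⟨u, hu⟩ := h
  exact (Lp.memLp (sobFn u)).ae_eq hu.symm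

theorem hasJets_of_smooth {n : ℕ} {f : ℝ → ℝ} (hf : ContDiff ℝ ∞ f)
    (hp : Function.Periodic f (2 * Real.pi)) : HasJets n (toL2 f) := by
  induction n generalizing f with
  | zero => trivial
  | succ n ih =>
    have h := hasWeakDeriv_of_smooth (hf.of_le (by simp)) hp
    refine ⟨h.self, ?_⟩
    rw [h.wderiv_eq]
    exact ih (contDiff_infty_iff_deriv.1 hf).2 fun x => by
      rw [← deriv_comp_add_const, show (fun y => f (y + 2 * Real.pi)) = f from funext hp]

section
variable {δ : ℝ} {n : ℕ}

theorem hasD_const (f : L2U) : HasD δ (fun _ => f) (fun _ => 0) := fun t _ => by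
  rw [smul_zero]
  exact hasDerivWithinAt_const _ _ _

theorem hasX_const {f g : L2U} (h : HasWeakDeriv f g) : HasX δ (fun _ => f) (fun _ => g) :=
  fun _ _ => h

theorem Jet.zero : Jet δ n (fun _ => 0) := by
  induction n with
  | zero => exact continuousOn_const
  | succ n ih => exact Jet.mk (hasD_const 0) (hasX_const HasWeakDeriv.zero) ih ih

theorem NN_zero {μ : ℝ → ℝ} {t : ℝ} (ht : t ∈ Ioc 0 δ) : NN μ δ n (fun _ => 0) t = 0 := by
  induction n with
  | zero => exact wn_zero _ _
  | succ n ih =>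
    rw [NN_succ_eq (hasD_const 0) (hasX_const HasWeakDeriv.zero) ht, ih, wn_zero]
    simp

theorem Jet.const {f : L2U} (h : HasJets n f) : Jet δ n (fun _ => f) := by
  induction n generalizing f with
  | zero => exact continuousOn_const
  | succ n ih => exact Jet.mk (hasD_const f) (hasX_const h.1) Jet.zero (ih h.2)

theorem exists_NN_const_le {μ : ℝ → ℝ} (hμ : Continuous μ) (hμ0 : ∀ x, μ x ≤ 0) (δ₀ : ℝ) {f : L2U}
    (h : HasJets n f) : ∃ C, 0 ≤ C ∧ ∀ δ ≤ δ₀, ∀ t ∈ Ioc 0 δ, NN μ δ n (fun _ => f) t ≤ C := by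
  obtain ⟨C, hC, H⟩ := exists_wn_le (μ := fun _ => 0) continuous_const hμ hμ0 δ₀
  have h0 : ∀ (g : L2U) (t : ℝ), wn (fun _ => 0) t g = ‖g‖ := fun g _ => by
    simp [wn, toL2_self]
  induction n generalizing f with
  | zero =>
    refine ⟨C * ‖f‖, by positivity, fun δ hδ t ht => ?_⟩
    have := H t ht.1 (ht.2.trans hδ) f
    rwa [h0] at this
  | succ n ih =>
    obtain ⟨C', hC', H'⟩ := ih h.2
    refine ⟨C * ‖f‖ + C', by positivity, fun δ hδ t ht => ?_⟩
    have := H t ht.1 (ht.2.trans hδ) f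
    rw [h0] at this
    rw [NN_succ_eq (hasD_const f) (hasX_const h.1) ht, NN_zero ht]
    linarith [H' δ hδ t ht]

/-- The constant function `1`. -/
def oneL2 : L2U := toL2 fun _ => 1

theorem oneL2_coe : oneL2 =ᵐ[measU] fun _ => (1 : ℝ) :=
  toL2_coe (memLp_of_continuousOn continuousOn_const)

theorem hasJets_oneL2 : HasJets n oneL2 :=
  hasJets_of_smooth contDiff_const fun _ => rfl

theorem hasWeakDeriv_oneL2 : HasWeakDeriv oneL2 0 := by
  have := hasWeakDeriv_of_smooth (f := fun _ => 1) contDiff_const (fun _ => rfl)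
  rwa [show deriv (fun _ : ℝ => (1 : ℝ)) = fun _ => 0 from funext fun x => deriv_const x 1,
    toL2_zero] at this

theorem hasD_log : HasD δ (fun t => Real.log t • oneL2) (fun _ => oneL2) := fun _ ht =>
  ((Real.hasDerivAt_log ht.1.ne').hasDerivWithinAt).smul_const oneL2

theorem hasX_log : HasX δ (fun t => Real.log t • oneL2) (fun _ => 0) := fun t _ => by
  simpa using hasWeakDeriv_oneL2.smul (Real.log t)

theorem Jet.log : Jet δ n (fun t => Real.log t • oneL2) := by
  cases n with
  | zero => exact (Real.continuousOn_log.mono fun t ht => ht.1.ne').smul continuousOn_const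
  | succ n => exact Jet.mk hasD_log hasX_log (Jet.const hasJets_oneL2) Jet.zero

theorem exists_log_le {μ : ℝ → ℝ} (hμ : Continuous μ) (hμ0 : ∀ x, μ x < 0) (δ₀ : ℝ) :
    ∃ C, 0 ≤ C ∧ ∀ t, 0 < t → t ≤ δ₀ → ∀ x ∈ Icc 0 (2 * Real.pi), t ^ (-μ x) * |Real.log t| ≤ C := by
  obtain ⟨η, hη, hg⟩ := exists_gap (μ := fun _ => 0) continuous_const hμ hμ0
  -- The gap `η` is known on one period only, while `exists_rpow_le` asks for an inequality at every
  -- `x`; the maximum with `η` changes nothing on the period.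
  obtain ⟨C, hC, H⟩ := exists_rpow_le (μ := fun x => max (-μ x) η) (ρ := fun _ => η)
    (hμ.neg.max continuous_const) continuous_const (fun x => le_max_right _ _) δ₀
  refine ⟨C * (η⁻¹ + max 1 δ₀ ^ η * max 1 δ₀), by positivity, fun t ht htδ x hx => ?_⟩
  have h1 := H t ht htδ x hx
  rw [max_eq_left (by linarith [hg x hx])] at h1
  have h2 : t ^ η * |Real.log t| ≤ η⁻¹ + max 1 δ₀ ^ η * max 1 δ₀ := by
    rcases le_or_gt t 1 with h | h
    · have := (Real.abs_log_mul_self_rpow_lt t η ht h hη).le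
      rw [abs_mul, abs_of_pos (Real.rpow_pos_of_pos ht η), one_div, mul_comm] at this
      have : 0 ≤ max 1 δ₀ ^ η * max 1 δ₀ := by positivity
      linarith
    · have h3 : |Real.log t| ≤ max 1 δ₀ := by
        rw [abs_of_nonneg (Real.log_nonneg h.le)]
        exact ((Real.log_le_sub_one_of_pos ht).trans (by linarith)).trans
          (htδ.trans (le_max_right _ _))
      have h4 := rpow_le_max_rpow (M := η) ht htδ hη.le le_rfl
      have : t ^ η * |Real.log t| ≤ max 1 δ₀ ^ η * max 1 δ₀ := by gcongr
      have : 0 ≤ η⁻¹ := by positivity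
      linarith
  calc t ^ (-μ x) * |Real.log t| ≤ C * t ^ η * |Real.log t| := by gcongr
    _ = C * (t ^ η * |Real.log t|) := by ring
    _ ≤ _ := by gcongr

theorem exists_NN_log_le {μ : ℝ → ℝ} (hμ : Continuous μ) (hμ0 : ∀ x, μ x < 0) (δ₀ : ℝ) (n : ℕ) :
    ∃ C, 0 ≤ C ∧ ∀ δ ≤ δ₀, ∀ t ∈ Ioc 0 δ, NN μ δ n (fun t => Real.log t • oneL2) t ≤ C := by
  obtain ⟨C, hC, H⟩ := exists_log_le hμ hμ0 δ₀
  have key : ∀ δ ≤ δ₀, ∀ t ∈ Ioc 0 δ, wn μ t (Real.log t • oneL2) ≤ C * ‖oneL2‖ := by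
    intro δ hδ t ht
    have h0 : wn (fun _ => 0) t oneL2 = ‖oneL2‖ := by simp [wn, toL2_self]
    rw [← h0]
    refine wn_le_of_ae continuous_const hμ ht.1 ?_
    filter_upwards [ae_measU_of_mem (H t ht.1 (ht.2.trans hδ)), Lp.coeFn_smul (Real.log t) oneL2]
      with x h1 h2
    rw [h2, Pi.smul_apply, smul_eq_mul, abs_mul, ← mul_assoc]
    simp only [neg_zero, Real.rpow_zero, one_mul]
    gcongr
  cases n with
  | zero => exact ⟨C * ‖oneL2‖, by positivity, fun δ hδ t ht => key δ hδ t ht⟩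
  | succ n =>
    obtain ⟨C', hC', H'⟩ := exists_NN_const_le hμ (fun x => (hμ0 x).le) δ₀ (hasJets_oneL2 (n := n))
    refine ⟨C * ‖oneL2‖ + C', by positivity, fun δ hδ t ht => ?_⟩
    rw [NN_succ_eq hasD_log hasX_log ht, NN_zero ht]
    linarith [H' δ hδ t ht, key δ hδ t ht]

end

/-! ### The calculus of orders t^κ, uniform over families -/

/-- A family of time intervals `(0,δ]`, of bounded length, with a time in each of them. -/
structure Fam (ι : Type*) where
  δ : ι → ℝ
  t : ι → ℝ
  δ₀ : ℝ
  mem : ∀ i, t i ∈ Ioc 0 (δ i)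
  le : ∀ i, δ i ≤ δ₀

section
variable {ι : Type*} {T : Fam ι} {n : ℕ} {κ κ' : ℝ → ℝ} {B B' : ι → ℝ}

/-- The curves `u i` have `n` derivatives, and at the times `T.t i` these are of order
`B i * t^κ`, up to an arbitrarily small loss in the exponent. -/
def DomL (T : Fam ι) (n : ℕ) (κ : ℝ → ℝ) (B : ι → ℝ) (u : ι → ℝ → L2U) : Prop :=
  Continuous κ ∧ (∀ i, Jet (T.δ i) n (u i)) ∧ ∀ μ : ℝ → ℝ, Continuous μ → (∀ x, μ x < κ x) →
    ∃ C, 0 ≤ C ∧ ∀ i, NN μ (T.δ i) n (u i) (T.t i) ≤ C * B i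

theorem DomL.congr {u v : ι → ℝ → L2U} (h : DomL T n κ B u)
    (e : ∀ i, EqOn (v i) (u i) (Ioc 0 (T.δ i))) : DomL T n κ B v := by
  refine ⟨h.1, fun i => (h.2.1 i).congr (e i), fun μ hμ hlt => ?_⟩
  obtain ⟨C, hC, H⟩ := h.2.2 μ hμ hlt
  refine ⟨C, hC, fun i => ?_⟩
  rw [NN_congr (e i) (T.mem i)]
  exact H i

theorem DomL.mono {u : ι → ℝ → L2U} (h : DomL T n κ B u) (hc : Continuous κ')
    (hκ : ∀ x, κ' x ≤ κ x) : DomL T n κ' B u :=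
  ⟨hc, h.2.1, fun μ hμ hlt => h.2.2 μ hμ fun x => (hlt x).trans_le (hκ x)⟩

theorem DomL.add {u v : ι → ℝ → L2U} (h : DomL T n κ B u) (h' : DomL T n κ B v) :
    DomL T n κ B (fun i => u i + v i) := by
  refine ⟨h.1, fun i => (h.2.1 i).add (h'.2.1 i), fun μ hμ hlt => ?_⟩
  obtain ⟨C, hC, H⟩ := h.2.2 μ hμ hlt
  obtain ⟨C', hC', H'⟩ := h'.2.2 μ hμ hlt
  refine ⟨C + C', by positivity, fun i => ?_⟩
  have := NN_add_le hμ (h.2.1 i) (h'.2.1 i) (T.mem i)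
  linarith [H i, H' i]

theorem DomL.smul {u : ι → ℝ → L2U} (c : ℝ) (h : DomL T n κ B u) :
    DomL T n κ B (fun i => c • u i) := by
  refine ⟨h.1, fun i => (h.2.1 i).smul c, fun μ hμ hlt => ?_⟩
  obtain ⟨C, hC, H⟩ := h.2.2 μ hμ hlt
  refine ⟨|c| * C, by positivity, fun i => ?_⟩
  rw [NN_smul hμ c (h.2.1 i) (T.mem i), mul_assoc]
  exact mul_le_mul_of_nonneg_left (H i) (abs_nonneg c)

theorem DomL.pm_max {k : ℕ} {u v : ι → ℝ → L2U} (h : DomL T k κ B u)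
    (h' : DomL T (max k 1) κ' B' v) (hB : ∀ i, 0 ≤ B i) :
    DomL T k (fun x => κ x + κ' x) (fun i => B i * B' i) (fun i s => pm (u i s) (v i s)) := by
  refine ⟨h.1.add h'.1, fun i => (h.2.1 i).mul (h'.2.1 i), fun ρ hρ hlt => ?_⟩
  have hκ := h.1
  have hκ' := h'.1
  -- The available gap `κ + κ' - ρ` is split into thirds: one for each factor and one for the
  -- product estimate.
  obtain ⟨C, hC, H⟩ := h.2.2 (fun x => κ x - (κ x + κ' x - ρ x) / 3) (by fun_prop)
    (fun x => by linarith [hlt x])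
  obtain ⟨C', hC', H'⟩ := h'.2.2 (fun x => κ' x - (κ x + κ' x - ρ x) / 3) (by fun_prop)
    (fun x => by linarith [hlt x])
  obtain ⟨A, hA, HA⟩ := exists_NN_mul_le (μ := fun x => κ x - (κ x + κ' x - ρ x) / 3)
    (ν := fun x => κ' x - (κ x + κ' x - ρ x) / 3) (by fun_prop) (by fun_prop) hρ
    (fun x => by linarith [hlt x]) T.δ₀ k
  refine ⟨A * C * C', by positivity, fun i => ?_⟩
  refine (HA _ (T.le i) _ (T.mem i) _ _ (h.2.1 i) (h'.2.1 i)).trans ?_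
  have h0 := hB i
  calc _ ≤ A * (C * B i) * (C' * B' i) := by
        gcongr
        · exact NN_nonneg
        · exact H i
        · exact H' i
    _ = _ := by ring

theorem DomL.pm {u v : ι → ℝ → L2U} (hn : 1 ≤ n) (h : DomL T n κ B u)
    (h' : DomL T n κ' B' v) (hB : ∀ i, 0 ≤ B i) :
    DomL T n (fun x => κ x + κ' x) (fun i => B i * B' i)
      (fun i s => GowdyFuchs.pm (u i s) (v i s)) := by
  rw [← max_eq_left hn] at h'
  exact h.pm_max h' hB

theorem DomL.of_le {k : ℕ} {u : ι → ℝ → L2U} (hk : k ≤ n) (h : DomL T n κ B u) : DomL T k κ B u := by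
  refine ⟨h.1, fun i => (h.2.1 i).mono hk, fun μ hμ hlt => ?_⟩
  obtain ⟨C, hC, H⟩ := h.2.2 μ hμ hlt
  exact ⟨C, hC, fun i => (NN_mono hk).trans (H i)⟩

theorem DomL.deriv {u : ι → ℝ → L2U} (h : DomL T (n + 1) κ B u) :
    DomL T n κ B (fun i => DL2 (T.δ i) (u i)) ∧ DomL T n κ B (fun i s => wderiv (u i s)) := by
  refine ⟨⟨h.1, fun i => (h.2.1 i).2.2.1, fun μ hμ hlt => ?_⟩,
    ⟨h.1, fun i => (h.2.1 i).2.2.2, fun μ hμ hlt => ?_⟩⟩ <;>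
  · obtain ⟨C, hC, H⟩ := h.2.2 μ hμ hlt
    refine ⟨C, hC, fun i => le_trans ?_ (H i)⟩
    have h1 := wn_nonneg μ (T.t i) (u i (T.t i))
    have h2 : 0 ≤ NN μ (T.δ i) n (DL2 (T.δ i) (u i)) (T.t i) := NN_nonneg
    have h3 : 0 ≤ NN μ (T.δ i) n (fun s => wderiv (u i s)) (T.t i) := NN_nonneg
    simp only [NN]
    linarith

theorem DomL.mk_succ {u v w : ι → ℝ → L2U} (hD : ∀ i, HasD (T.δ i) (u i) (v i))
    (hX : ∀ i, HasX (T.δ i) (u i) (w i)) (hv : DomL T n κ B v) (hw : DomL T n κ B w)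
    (h0 : ∀ μ : ℝ → ℝ, Continuous μ → (∀ x, μ x < κ x) →
      ∃ C, 0 ≤ C ∧ ∀ i, wn μ (T.t i) (u i (T.t i)) ≤ C * B i) : DomL T (n + 1) κ B u := by
  refine ⟨hv.1, fun i => Jet.mk (hD i) (hX i) (hv.2.1 i) (hw.2.1 i), fun μ hμ hlt => ?_⟩
  obtain ⟨C₀, hC₀, H₀⟩ := h0 μ hμ hlt
  obtain ⟨C₁, hC₁, H₁⟩ := hv.2.2 μ hμ hlt
  obtain ⟨C₂, hC₂, H₂⟩ := hw.2.2 μ hμ hlt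
  refine ⟨C₀ + C₁ + C₂, by positivity, fun i => ?_⟩
  rw [NN_succ_eq (hD i) (hX i) (T.mem i)]
  linarith [H₀ i, H₁ i, H₂ i]

theorem wn_oneL2_bound {μ : ℝ → ℝ} (hμ : Continuous μ) (h0 : ∀ x, μ x ≤ 0) (δ₀ : ℝ) :
    ∃ C, 0 ≤ C ∧ ∀ t, 0 < t → t ≤ δ₀ → wn μ t oneL2 ≤ C := by
  obtain ⟨C, hC, H⟩ := exists_NN_const_le (n := 0) hμ h0 δ₀ hasJets_oneL2
  exact ⟨C, hC, fun t ht htδ => H δ₀ le_rfl t ⟨ht, htδ⟩⟩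

/-- `e^u` is of order `t^κ` if it is so pointwise and `u` is of order `1`. -/
theorem DomL.pe {u : ι → ℝ → L2U} (hn : 1 ≤ n) (h : DomL T n (fun _ => 0) (fun _ => 1) u)
    (hκ : Continuous κ)
    (hb : ∃ C, ∀ i, ∀ᵐ x ∂measU, Real.exp (u i (T.t i) x) ≤ C * T.t i ^ κ x) :
    DomL T n κ (fun _ => 1) (fun i s => pe (u i s)) := by
  obtain ⟨A₀, hA₀⟩ := hb
  set A := max A₀ 0
  have hA : ∀ i, ∀ᵐ x ∂measU, Real.exp (u i (T.t i) x) ≤ A * T.t i ^ κ x := fun i => by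
    filter_upwards [hA₀ i] with x hx
    exact hx.trans (mul_le_mul_of_nonneg_right (le_max_left _ _)
      (Real.rpow_nonneg (T.mem i).1.le _))
  have hA0 : 0 ≤ A := le_max_right _ _
  have hbdd : ∀ i, ∃ C, EssBdd (u i (T.t i)) C := fun i =>
    (((h.2.1 i).mono hn).2.1 _ (T.mem i)).exists_essBdd
  have hexp : ∀ i (f : L2U) (μ : ℝ → ℝ), Continuous μ →
      wn μ (T.t i) (GowdyFuchs.pm (GowdyFuchs.pe (u i (T.t i))) f) ≤
        A * wn (fun x => μ x - κ x) (T.t i) f := by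
    intro i f μ hμ
    obtain ⟨C, hC⟩ := hbdd i
    refine wn_le_of_ae (hμ.sub hκ) hμ (T.mem i).1 ?_
    filter_upwards [hA i, pe_coe hC, pm_coe (g := f) (hC.exp.congr (pe_coe hC))] with x h1 h2 h3
    rw [h3, h2, abs_mul, abs_of_pos (Real.exp_pos _)]
    calc T.t i ^ (-μ x) * (Real.exp (u i (T.t i) x) * |f x|)
        ≤ T.t i ^ (-μ x) * ((A * T.t i ^ κ x) * |f x|) := by
          have := Real.rpow_nonneg (T.mem i).1.le (-μ x)
          gcongr
      _ = _ := by
          rw [show -(μ - κ) x = -μ x + κ x by rw [Pi.sub_apply]; ring,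
            Real.rpow_add (T.mem i).1]
          ring
  have hwn : ∀ μ : ℝ → ℝ, Continuous μ → (∀ x, μ x < κ x) →
      ∃ C, 0 ≤ C ∧ ∀ i, wn μ (T.t i) (GowdyFuchs.pe (u i (T.t i))) ≤ C * 1 := by
    intro μ hμ hlt
    obtain ⟨C, hC, H⟩ := wn_oneL2_bound (μ := fun x => μ x - κ x) (by fun_prop)
      (fun x => by linarith [hlt x]) T.δ₀
    refine ⟨A * C, by positivity, fun i => ?_⟩
    have e : GowdyFuchs.pm (GowdyFuchs.pe (u i (T.t i))) oneL2 = GowdyFuchs.pe (u i (T.t i)) := by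
      refine toL2_eq ?_
      filter_upwards [oneL2_coe] with x hx
      rw [hx, mul_one]
    have h1 := hexp i oneL2 μ hμ
    rw [e] at h1
    rw [mul_one]
    exact h1.trans (mul_le_mul_of_nonneg_left (H _ (T.mem i).1 ((T.mem i).2.trans (T.le i))) hA0)
  have hDe : ∀ i, HasD (T.δ i) (fun s => GowdyFuchs.pe (u i s))
      (fun s => GowdyFuchs.pm (GowdyFuchs.pe (u i s)) (DL2 (T.δ i) (u i) s)) := fun i =>
    have h1 := (h.2.1 i).mono hn
    h1.1.exp h1.2.1 h1.2.2.2.continuousOn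
  have hXe : ∀ i, HasX (T.δ i) (fun s => GowdyFuchs.pe (u i s))
      (fun s => GowdyFuchs.pm (GowdyFuchs.pe (u i s)) (wderiv (u i s))) := fun i =>
    ((h.2.1 i).mono hn).2.1.exp
  have hjet : ∀ i, Jet (T.δ i) n (fun s => GowdyFuchs.pe (u i s)) := fun i => by
    obtain ⟨k, rfl⟩ : ∃ k, n = k + 1 := ⟨n - 1, by omega⟩
    exact (h.2.1 i).exp_succ
  -- With no derivatives left, `v` is only in `L²`, so the pointwise bound on `e^u` is used
  -- directly. This treats `n = 1`; afterwards `e^u` has a derivative of its own and the product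
  -- rule for orders applies.
  have base : ∀ v : ι → ℝ → L2U, DomL T 0 (fun _ => 0) (fun _ => 1) v →
      (∀ i, Jet (T.δ i) 0 (fun s => GowdyFuchs.pm (GowdyFuchs.pe (u i s)) (v i s))) →
      DomL T 0 κ (fun _ => 1) (fun i s => GowdyFuchs.pm (GowdyFuchs.pe (u i s)) (v i s)) := by
    intro v hv hj
    refine ⟨hκ, hj, fun μ hμ hlt => ?_⟩
    obtain ⟨C, hC, H⟩ := hv.2.2 (fun x => μ x - κ x) (by fun_prop) (fun x => by linarith [hlt x])
    refine ⟨A * C, by positivity, fun i => ?_⟩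
    refine (hexp i _ μ hμ).trans ?_
    rw [mul_assoc]
    exact mul_le_mul_of_nonneg_left (H i) hA0
  obtain ⟨k, rfl⟩ : ∃ k, n = k + 1 := ⟨n - 1, by omega⟩
  clear hn
  induction k with
  | zero =>
    have hj := fun i => (hjet i)
    refine DomL.mk_succ hDe hXe (base _ h.deriv.1 fun i => ?_) (base _ h.deriv.2 fun i => ?_) hwn
    · exact (hj i).2.2.1.congr fun s hs => ((hDe i).eq hs).symm
    · exact (hj i).2.2.2.congr fun s hs => ((hXe i).eq hs).symm
  | succ k ih =>
    have h1 := ih (h.of_le (by omega)) (fun i => (hjet i).of_succ)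
    have key : ∀ v : ι → ℝ → L2U, DomL T (k + 1) (fun _ => 0) (fun _ => 1) v →
        DomL T (k + 1) κ (fun _ => 1)
          (fun i s => GowdyFuchs.pm (GowdyFuchs.pe (u i s)) (v i s)) := by
      intro v hv
      have := h1.pm (by omega) hv (fun _ => zero_le_one)
      simpa using this
    exact DomL.mk_succ hDe hXe (key _ h.deriv.1) (key _ h.deriv.2) hwn

/-- A positive order leaves room for the Sobolev loss: take weight exponent `κ / 2` and target
exponent `0`. -/
theorem DomL.exists_abs_le {u : ι → ℝ → L2U} (hn : 1 ≤ n) (h : DomL T n κ (fun _ => 1) u)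
    (hκ : ∀ x, 0 < κ x) : ∃ C, ∀ i, ∀ᵐ x ∂measU, |u i (T.t i) x| ≤ C := by
  have hc := h.1
  obtain ⟨C, hC, H⟩ := exists_sup_le (μ := fun x => κ x / 2) (ρ := fun _ => 0) (by fun_prop)
    continuous_const (fun x => by linarith [hκ x]) T.δ₀
  obtain ⟨C', hC', H'⟩ := (h.of_le hn).2.2 (fun x => κ x / 2) (by fun_prop)
    (fun x => by linarith [hκ x])
  refine ⟨C * C', fun i => ?_⟩
  filter_upwards [H _ (T.mem i).1 ((T.mem i).2.trans (T.le i)) _ _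
    (((h.2.1 i).mono hn).2.1 _ (T.mem i))] with x hx
  refine hx.trans ?_
  rw [Real.rpow_zero, mul_one]
  refine mul_le_mul_of_nonneg_left ?_ hC
  have := H' i
  simp only [NN] at this
  linarith [wn_nonneg (fun x => κ x / 2) (T.t i) (DL2 (T.δ i) (u i) (T.t i))]

theorem abs_exp_sub_one_le_mul_exp (d : ℝ) : |Real.exp d - 1| ≤ |d| * Real.exp |d| := by
  rcases le_total 0 d with h | h
  · rw [abs_of_nonneg h, abs_of_nonneg (by linarith [Real.one_le_exp h])]
    have h1 := Real.add_one_le_exp (-d)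
    have h2 := mul_le_mul_of_nonneg_right h1 (Real.exp_pos d).le
    rw [← Real.exp_add, neg_add_cancel, Real.exp_zero] at h2
    linarith
  · have h1 : Real.exp d ≤ 1 := Real.exp_le_one_iff.2 h
    rw [abs_of_nonpos h, abs_of_nonpos (by linarith)]
    have h2 := Real.add_one_le_exp d
    have h3 : 1 ≤ Real.exp (-d) := Real.one_le_exp (by linarith)
    nlinarith

/-- `e^u - 1` has the same order as `u`, if `u` is bounded with positive order. -/
theorem DomL.pe_sub_one {u : ι → ℝ → L2U} (hn : 1 ≤ n) (h : DomL T n κ B u)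
    (h1 : DomL T n κ (fun _ => 1) u) (hκ : ∀ x, 0 < κ x) (hB : ∀ i, 0 ≤ B i) :
    DomL T n κ B (fun i s => GowdyFuchs.pe (u i s) - oneL2) := by
  obtain ⟨A, hA⟩ := h1.exists_abs_le hn hκ
  have hexp : DomL T n (fun _ => 0) (fun _ => 1) (fun i s => GowdyFuchs.pe (u i s)) := by
    refine (h1.mono continuous_const fun x => (hκ x).le).pe hn continuous_const
      ⟨Real.exp A, fun i => ?_⟩
    filter_upwards [hA i] with x hx
    rw [Real.rpow_zero, mul_one]
    exact Real.exp_le_exp.2 ((le_abs_self _).trans hx)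
  have hbdd : ∀ i, ∃ C, EssBdd (u i (T.t i)) C := fun i =>
    (((h.2.1 i).mono hn).2.1 _ (T.mem i)).exists_essBdd
  have hwn : ∀ μ : ℝ → ℝ, Continuous μ → (∀ x, μ x < κ x) →
      ∃ C, 0 ≤ C ∧ ∀ i, wn μ (T.t i) (GowdyFuchs.pe (u i (T.t i)) - oneL2) ≤ C * B i := by
    intro μ hμ hlt
    obtain ⟨C, hC, H⟩ := h.2.2 μ hμ hlt
    refine ⟨Real.exp A * C, by positivity, fun i => ?_⟩
    have : wn μ (T.t i) (GowdyFuchs.pe (u i (T.t i)) - oneL2) ≤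
        Real.exp A * wn μ (T.t i) (u i (T.t i)) := by
      obtain ⟨C, hC⟩ := hbdd i
      refine wn_le_of_ae hμ hμ (T.mem i).1 ?_
      filter_upwards [hA i, pe_coe hC, oneL2_coe,
        Lp.coeFn_sub (GowdyFuchs.pe (u i (T.t i))) oneL2] with x h1 h2 h3 h4
      rw [h4, Pi.sub_apply, h2, h3]
      calc T.t i ^ (-μ x) * |Real.exp (u i (T.t i) x) - 1|
          ≤ T.t i ^ (-μ x) * (|u i (T.t i) x| * Real.exp A) := by
            have := Real.rpow_nonneg (T.mem i).1.le (-μ x)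
            refine mul_le_mul_of_nonneg_left ((abs_exp_sub_one_le_mul_exp _).trans ?_) this
            gcongr
        _ = _ := by ring
    refine this.trans ?_
    rw [mul_assoc]
    exact mul_le_mul_of_nonneg_left (wn_le_NN.trans (H i)) (Real.exp_pos A).le
  obtain ⟨k, rfl⟩ : ∃ k, n = k + 1 := ⟨n - 1, by omega⟩
  -- The derivatives of `e^u - 1` are `e^u` times those of `u`; the latter carry the size `B`, while
  -- `e^u` contributes only order `0` and size `1`.
  have key : ∀ v : ι → ℝ → L2U, DomL T k κ B v →
      DomL T k κ B (fun i s => GowdyFuchs.pm (GowdyFuchs.pe (u i s)) (v i s)) := by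
    intro v hv
    have h2 := hv.pm_max (hexp.of_le (by omega : max k 1 ≤ k + 1)) hB
    simp only [add_zero, mul_one] at h2
    exact h2.congr fun i s _ => pm_comm _ _
  refine DomL.mk_succ (fun i => ?_) (fun i => ?_) (key _ h.deriv.1) (key _ h.deriv.2) hwn
  · intro s hs
    have h3 := (h.2.1 i).1.exp (h.2.1 i).2.1 (h.2.1 i).2.2.2.continuousOn s hs
    exact h3.sub_const _
  · intro s hs
    have h3 := (h.2.1 i).2.1.exp s hs
    simpa using h3.sub hasWeakDeriv_oneL2

/-! ### Orders for functions of (t, x) -/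

/-- The version of `DomL` for functions of `(t,x)`. -/
def Dom (T : Fam ι) (n : ℕ) (κ : ℝ → ℝ) (B : ι → ℝ) (u : ι → ℝ → ℝ → ℝ) : Prop :=
  (∀ i, ∀ s ∈ Ioc 0 (T.δ i), MemLp (u i s) 2 measU) ∧ DomL T n κ B (fun i s => toL2 (u i s))

theorem Dom.congr {u v : ι → ℝ → ℝ → ℝ} (h : Dom T n κ B u)
    (e : ∀ i, ∀ s ∈ Ioc 0 (T.δ i), v i s =ᵐ[measU] u i s) : Dom T n κ B v :=
  ⟨fun i s hs => (h.1 i s hs).ae_eq (e i s hs).symm, h.2.congr fun i s hs => toL2_congr (e i s hs)⟩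

theorem Dom.congr' {u v : ι → ℝ → ℝ → ℝ} (h : Dom T n κ B u)
    (e : ∀ i s x, 0 < s → v i s x = u i s x) : Dom T n κ B v :=
  h.congr fun i s hs => ae_of_all _ fun x => e i s x hs.1

theorem Dom.mono {u : ι → ℝ → ℝ → ℝ} (h : Dom T n κ B u) (hc : Continuous κ')
    (hκ : ∀ x, κ' x ≤ κ x) : Dom T n κ' B u := ⟨h.1, h.2.mono hc hκ⟩

theorem Dom.add {u v : ι → ℝ → ℝ → ℝ} (h : Dom T n κ B u) (h' : Dom T n κ B v) :
    Dom T n κ B (fun i s x => u i s x + v i s x) :=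
  ⟨fun i s hs => (h.1 i s hs).add (h'.1 i s hs), (h.2.add h'.2).congr fun i s hs =>
    toL2_add (h.1 i s hs) (h'.1 i s hs)⟩

theorem Dom.const_mul {u : ι → ℝ → ℝ → ℝ} (c : ℝ) (h : Dom T n κ B u) :
    Dom T n κ B (fun i s x => c * u i s x) :=
  ⟨fun i s hs => (h.1 i s hs).const_mul c, (h.2.smul c).congr fun i s hs => toL2_eq (by
    filter_upwards [Lp.coeFn_smul c (toL2 (u i s)), toL2_coe (h.1 i s hs)] with x h1 h2
    rw [Pi.smul_apply, h1, Pi.smul_apply, h2, smul_eq_mul])⟩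

theorem Dom.sub {u v : ι → ℝ → ℝ → ℝ} (h : Dom T n κ B u) (h' : Dom T n κ B v) :
    Dom T n κ B (fun i s x => u i s x - v i s x) :=
  (h.add (h'.const_mul (-1))).congr' fun i s x _ => by ring

theorem Dom.mul {u v : ι → ℝ → ℝ → ℝ} (hn : 1 ≤ n) (h : Dom T n κ B u) (h' : Dom T n κ' B' v)
    (hB : ∀ i, 0 ≤ B i) :
    Dom T n (fun x => κ x + κ' x) (fun i => B i * B' i) (fun i s x => u i s x * v i s x) := by
  have e : ∀ i, ∀ s ∈ Ioc 0 (T.δ i),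
      (fun x => u i s x * v i s x) =ᵐ[measU] pm (toL2 (u i s)) (toL2 (v i s)) := by
    intro i s hs
    obtain ⟨C, hC⟩ := (((h.2.2.1 i).mono hn).2.1 s hs).exists_essBdd
    filter_upwards [pm_coe (g := toL2 (v i s)) hC, toL2_coe (h.1 i s hs), toL2_coe (h'.1 i s hs)]
      with x h1 h2 h3
    rw [h1, h2, h3]
  exact ⟨fun i s hs => (Lp.memLp _).ae_eq (e i s hs).symm,
    (h.2.pm hn h'.2 hB).congr fun i s hs => toL2_eq (e i s hs)⟩

theorem Dom.exp {u : ι → ℝ → ℝ → ℝ} (hn : 1 ≤ n) (h : Dom T n (fun _ => 0) (fun _ => 1) u)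
    (hκ : Continuous κ)
    (hb : ∃ C, ∀ i, ∀ᵐ x ∂measU, Real.exp (u i (T.t i) x) ≤ C * T.t i ^ κ x) :
    Dom T n κ (fun _ => 1) (fun i s x => Real.exp (u i s x)) := by
  have e : ∀ i, ∀ s ∈ Ioc 0 (T.δ i), (fun x => Real.exp (u i s x)) =ᵐ[measU] pe (toL2 (u i s)) := by
    intro i s hs
    obtain ⟨C, hC⟩ := (((h.2.2.1 i).mono hn).2.1 s hs).exists_essBdd
    filter_upwards [pe_coe hC, toL2_coe (h.1 i s hs)] with x h1 h2
    rw [h1, h2]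
  obtain ⟨C, hC⟩ := hb
  refine ⟨fun i s hs => (Lp.memLp _).ae_eq (e i s hs).symm,
    (h.2.pe hn hκ ⟨C, fun i => ?_⟩).congr fun i s hs => toL2_eq (e i s hs)⟩
  filter_upwards [hC i, toL2_coe (h.1 i _ (T.mem i))] with x h1 h2
  rwa [h2]

theorem Dom.exists_abs_le {u : ι → ℝ → ℝ → ℝ} (hn : 1 ≤ n) (h : Dom T n κ (fun _ => 1) u)
    (hκ : ∀ x, 0 < κ x) : ∃ C, ∀ i, ∀ᵐ x ∂measU, |u i (T.t i) x| ≤ C := by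
  obtain ⟨C, hC⟩ := h.2.exists_abs_le hn hκ
  refine ⟨C, fun i => ?_⟩
  filter_upwards [hC i, toL2_coe (h.1 i _ (T.mem i))] with x h1 h2
  rwa [← h2]

theorem Dom.exp_bounded {u : ι → ℝ → ℝ → ℝ} (hn : 1 ≤ n) (h : Dom T n κ (fun _ => 1) u)
    (hκ : ∀ x, 0 < κ x) : Dom T n (fun _ => 0) (fun _ => 1) (fun i s x => Real.exp (u i s x)) := by
  obtain ⟨C, hC⟩ := h.exists_abs_le hn hκ
  refine (h.mono continuous_const fun x => (hκ x).le).exp hn continuous_const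
    ⟨Real.exp C, fun i => ?_⟩
  filter_upwards [hC i] with x hx
  rw [Real.rpow_zero, mul_one]
  exact Real.exp_le_exp.2 ((le_abs_self _).trans hx)

theorem Dom.exp_sub_one {u : ι → ℝ → ℝ → ℝ} (hn : 1 ≤ n) (h : Dom T n κ B u)
    (h1 : Dom T n κ (fun _ => 1) u) (hκ : ∀ x, 0 < κ x) (hB : ∀ i, 0 ≤ B i) :
    Dom T n κ B (fun i s x => Real.exp (u i s x) - 1) := by
  have e : ∀ i, ∀ s ∈ Ioc 0 (T.δ i), (fun x => Real.exp (u i s x) - 1) =ᵐ[measU]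
      (pe (toL2 (u i s)) - oneL2 : L2U) := by
    intro i s hs
    obtain ⟨C, hC⟩ := (((h.2.2.1 i).mono hn).2.1 s hs).exists_essBdd
    filter_upwards [pe_coe hC, toL2_coe (h.1 i s hs), oneL2_coe,
      Lp.coeFn_sub (pe (toL2 (u i s))) oneL2] with x h1 h2 h3 h4
    rw [h4, Pi.sub_apply, h1, h2, h3]
  exact ⟨fun i s hs => (Lp.memLp _).ae_eq (e i s hs).symm,
    (h.2.pe_sub_one hn h1.2 hκ hB).congr fun i s hs => toL2_eq (e i s hs)⟩

theorem Dom.zero (hκ : Continuous κ) : Dom T n κ B (fun _ _ _ => 0) := by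
  refine ⟨fun i s _ => MemLp.zero, hκ, fun i => ?_, fun μ _ _ => ⟨0, le_rfl, fun i => ?_⟩⟩
  · simp only [toL2_zero]; exact Jet.zero
  · simp only [toL2_zero]; rw [NN_zero (T.mem i), zero_mul]

theorem Dom.of_time_indep {f : ℝ → ℝ} (hf : MemLp f 2 measU) (h : HasJets n (toL2 f)) :
    Dom T n (fun _ => 0) (fun _ => 1) (fun _ _ x => f x) := by
  refine ⟨fun _ _ _ => hf, continuous_const, fun i => Jet.const h, fun μ hμ hlt => ?_⟩
  obtain ⟨C, hC, H⟩ := exists_NN_const_le hμ (fun x => (hlt x).le) T.δ₀ h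
  exact ⟨C, hC, fun i => by rw [mul_one]; exact H _ (T.le i) _ (T.mem i)⟩

theorem Dom.log : Dom T n (fun _ => 0) (fun _ => 1) (fun _ s _ => Real.log s) := by
  have e : ∀ s : ℝ, toL2 (fun _ => Real.log s) = Real.log s • oneL2 := fun s => toL2_eq (by
    filter_upwards [Lp.coeFn_smul (Real.log s) oneL2, oneL2_coe] with x h1 h2
    rw [h1, Pi.smul_apply, h2, smul_eq_mul, mul_one])
  refine ⟨fun _ s _ => memLp_of_continuousOn continuousOn_const, ?_⟩
  simp only [e]
  refine ⟨continuous_const, fun i => Jet.log, fun μ hμ hlt => ?_⟩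
  obtain ⟨C, hC, H⟩ := exists_NN_log_le hμ hlt T.δ₀ n
  exact ⟨C, hC, fun i => by rw [mul_one]; exact H _ (T.le i) _ (T.mem i)⟩

/-- Write `s^f = exp(f log s)`. The logarithm has order `0` because a loss in the exponent is
allowed, and the pointwise bound required for the exponential holds with equality. -/
theorem Dom.rpow {f : ℝ → ℝ} (hn : 1 ≤ n) (hc : Continuous f) (h : HasJets n (toL2 f)) :
    Dom T n f (fun _ => 1) (fun _ s x => s ^ f x) := by
  have h1 := Dom.log (T := T).mul hn
    (Dom.of_time_indep (memLp_of_continuousOn hc.continuousOn) h) (fun _ => zero_le_one)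
  simp only [add_zero, mul_one] at h1
  refine (h1.exp hn hc ⟨1, fun i => ae_of_all _ fun x => ?_⟩).congr' fun i s x hs =>
    Real.rpow_def_of_pos hs _
  rw [one_mul, Real.rpow_def_of_pos (T.mem i).1]

/-! ### Lipschitz pairs -/

/-- Two families that are of order `t^κ`, while their difference is of order `B t^κ`. -/
structure LipDom (T : Fam ι) (n : ℕ) (κ : ℝ → ℝ) (B : ι → ℝ) (u u' : ι → ℝ → ℝ → ℝ) : Prop where
  left : Dom T n κ (fun _ => 1) u
  right : Dom T n κ (fun _ => 1) u'
  diff : Dom T n κ B (fun i s x => u i s x - u' i s x)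

theorem LipDom.of_dom {u : ι → ℝ → ℝ → ℝ} (h : Dom T n κ (fun _ => 1) u) :
    LipDom T n κ B u u :=
  ⟨h, h, (Dom.zero h.2.1).congr' fun _ _ _ _ => sub_self _⟩

theorem LipDom.mono {u u' : ι → ℝ → ℝ → ℝ} (h : LipDom T n κ B u u') (hc : Continuous κ')
    (hκ : ∀ x, κ' x ≤ κ x) : LipDom T n κ' B u u' :=
  ⟨h.left.mono hc hκ, h.right.mono hc hκ, h.diff.mono hc hκ⟩

theorem LipDom.add {u u' v v' : ι → ℝ → ℝ → ℝ} (h : LipDom T n κ B u u')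
    (h' : LipDom T n κ B v v') :
    LipDom T n κ B (fun i s x => u i s x + v i s x) (fun i s x => u' i s x + v' i s x) :=
  ⟨h.left.add h'.left, h.right.add h'.right, (h.diff.add h'.diff).congr' fun i s x _ => by ring⟩

theorem LipDom.const_mul {u u' : ι → ℝ → ℝ → ℝ} (c : ℝ) (h : LipDom T n κ B u u') :
    LipDom T n κ B (fun i s x => c * u i s x) (fun i s x => c * u' i s x) :=
  ⟨h.left.const_mul c, h.right.const_mul c, (h.diff.const_mul c).congr' fun i s x _ => by ring⟩

theorem LipDom.sub {u u' v v' : ι → ℝ → ℝ → ℝ} (h : LipDom T n κ B u u')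
    (h' : LipDom T n κ B v v') :
    LipDom T n κ B (fun i s x => u i s x - v i s x) (fun i s x => u' i s x - v' i s x) :=
  ⟨h.left.sub h'.left, h.right.sub h'.right, (h.diff.sub h'.diff).congr' fun i s x _ => by ring⟩

theorem LipDom.congr {u u' v v' : ι → ℝ → ℝ → ℝ} (h : LipDom T n κ B u u')
    (e : ∀ i s x, 0 < s → v i s x = u i s x) (e' : ∀ i s x, 0 < s → v' i s x = u' i s x) :
    LipDom T n κ B v v' :=
  ⟨h.left.congr' e, h.right.congr' e', h.diff.congr' fun i s x hs => by rw [e i s x hs, e' i s x hs]⟩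

/-- Use `u v - u' v' = (u - u') v + u' (v - v')`: each term has one factor of size `B` and one of
size `1`, so the bound stays linear in `B`. -/
theorem LipDom.mul {u u' v v' : ι → ℝ → ℝ → ℝ} (hn : 1 ≤ n) (h : LipDom T n κ B u u')
    (h' : LipDom T n κ' B v v') (hB : ∀ i, 0 ≤ B i) :
    LipDom T n (fun x => κ x + κ' x) B (fun i s x => u i s x * v i s x)
      (fun i s x => u' i s x * v' i s x) := by
  have h1 := h.left.mul hn h'.left fun _ => zero_le_one
  have h2 := h.right.mul hn h'.right fun _ => zero_le_one
  have h3 := h.diff.mul hn h'.left hB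
  have h4 := h.right.mul hn h'.diff fun _ => zero_le_one
  simp only [mul_one, one_mul] at h1 h2 h3 h4
  exact ⟨h1, h2, (h3.add h4).congr' fun i s x _ => by ring⟩

/-- Use `e^u - e^u' = e^u' (e^(u - u') - 1)`; the last factor has the size of `u - u'`, since `u -
u'` is also bounded with positive order. -/
theorem LipDom.exp {u u' : ι → ℝ → ℝ → ℝ} (hn : 1 ≤ n) (h : LipDom T n κ B u u')
    (hκ : ∀ x, 0 < κ x) (hB : ∀ i, 0 ≤ B i) :
    LipDom T n (fun _ => 0) B (fun i s x => Real.exp (u i s x))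
      (fun i s x => Real.exp (u' i s x)) := by
  have h2 := h.right.exp_bounded hn hκ
  have h3 := h.diff.exp_sub_one hn (h.left.sub h.right) hκ hB
  have h4 := h2.mul hn h3 fun _ => zero_le_one
  simp only [zero_add, one_mul] at h4
  refine ⟨h.left.exp_bounded hn hκ, h2, (h4.mono continuous_const fun x => (hκ x).le).congr' ?_⟩
  intro i s x _
  rw [mul_sub, ← Real.exp_add]
  ring_nf

end

/-! ### Orders of the factors and components of the source operator -/

section
variable {ι : Type*} {T : Fam ι} {n : ℕ} {κ κ' : ℝ → ℝ} {B B' : ι → ℝ}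

theorem Dom.of_bounded {u : ι → ℝ → ℝ → ℝ} {r : ℝ} (h : Dom T n κ (fun _ => r) u) :
    Dom T n κ (fun _ => 1) u := by
  refine ⟨h.1, h.2.1, h.2.2.1, fun μ hμ hlt => ?_⟩
  obtain ⟨C, hC, H⟩ := h.2.2.2 μ hμ hlt
  refine ⟨C * |r|, by positivity, fun i => (H i).trans ?_⟩
  rw [mul_one]
  exact mul_le_mul_of_nonneg_left (le_abs_self r) hC

/-- `u`, `D u` and `t ∂ₓ u` are of order `t^κ` if the derivatives of `u` of order at most `n + 1`
are, with a factor `t` at the highest spatial derivative. -/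
theorem Dom.of_tilde {u : ι → ℝ → ℝ → ℝ} (hκ : Continuous κ)
    (hmem : ∀ i, ∀ s ∈ Ioc 0 (T.δ i), MemLp (u i s) 2 measU)
    (hjet : ∀ i, Jet (T.δ i) (n + 1) (fun s => toL2 (u i s)))
    (hb : ∀ i p q, p + q ≤ n + 1 → (if q = n + 1 then T.t i else 1) *
      wn κ (T.t i) (mixedDeriv (T.δ i) p q (u i) (T.t i)) ≤ B i) :
    Dom T n κ B u ∧ Dom T n κ B (fun i => Dt (T.δ i) (u i)) ∧
      Dom T n κ B (fun i s x => s * dx (u i s) x) := by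
  obtain ⟨C, hC, H⟩ := exists_NN_le_of_tilde hκ T.δ₀ n
  have hH := fun i => H _ (T.le i) _ (T.mem i) _ _ (hjet i) (hb i)
  have main : ∀ v : ι → ℝ → L2U, (∀ i, Jet (T.δ i) n (v i)) →
      (∀ i, NN κ (T.δ i) n (v i) (T.t i) ≤ C * B i) → DomL T n κ B v := by
    intro v hj hN
    refine ⟨hκ, hj, fun μ hμ hlt => ?_⟩
    obtain ⟨A, hA, HA⟩ := exists_NN_le hκ hμ (fun x => (hlt x).le) T.δ₀ n
    refine ⟨A * C, by positivity, fun i => (HA _ (T.le i) _ (T.mem i) _).trans ?_⟩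
    rw [mul_assoc]
    exact mul_le_mul_of_nonneg_left (hN i) hA
  have e2 : ∀ i s, Dt (T.δ i) (u i) s = DL2 (T.δ i) (fun s => toL2 (u i s)) s := fun _ _ => rfl
  have e3 : ∀ i s, (fun x => s * dx (u i s) x) =ᵐ[measU] (s • wderiv (toL2 (u i s)) : L2U) := by
    intro i s
    filter_upwards [Lp.coeFn_smul s (wderiv (toL2 (u i s)))] with x hx
    rw [hx, Pi.smul_apply, smul_eq_mul, dx]
  refine ⟨⟨hmem, main _ (fun i => (hjet i).of_succ) fun i => (hH i).1⟩, ⟨fun i s _ => ?_, ?_⟩,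
    ⟨fun i s _ => (Lp.memLp _).ae_eq (e3 i s).symm, ?_⟩⟩
  · change MemLp (Dt (T.δ i) (u i) s) 2 measU
    rw [e2]; exact Lp.memLp _
  · refine (main _ (fun i => (hjet i).2.2.1) fun i => (hH i).2.1).congr fun i s _ => ?_
    simp only
    rw [e2, toL2_self]
  · refine (main _ (fun i => (hjet i).2.2.2.id_smul) fun i => (hH i).2.2).congr fun i s _ => ?_
    exact toL2_eq (e3 i s)

/-- Apply `Dom.of_tilde` to `u`, `u'` and `u - u'`; by linearity `D` and `t ∂ₓ` of the difference
are the differences of the pairs. -/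
theorem LipDom.of_tilde {u u' : ι → ℝ → ℝ → ℝ} {r : ℝ} (hκ : Continuous κ)
    (hmem : ∀ i, ∀ s ∈ Ioc 0 (T.δ i), MemLp (u i s) 2 measU)
    (hmem' : ∀ i, ∀ s ∈ Ioc 0 (T.δ i), MemLp (u' i s) 2 measU)
    (hjet : ∀ i, Jet (T.δ i) (n + 1) (fun s => toL2 (u i s)))
    (hjet' : ∀ i, Jet (T.δ i) (n + 1) (fun s => toL2 (u' i s)))
    (hb : ∀ i p q, p + q ≤ n + 1 → (if q = n + 1 then T.t i else 1) *
      wn κ (T.t i) (mixedDeriv (T.δ i) p q (u i) (T.t i)) ≤ r)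
    (hb' : ∀ i p q, p + q ≤ n + 1 → (if q = n + 1 then T.t i else 1) *
      wn κ (T.t i) (mixedDeriv (T.δ i) p q (u' i) (T.t i)) ≤ r)
    (hbd : ∀ i p q, p + q ≤ n + 1 → (if q = n + 1 then T.t i else 1) *
      wn κ (T.t i) (mixedDeriv (T.δ i) p q (u i - u' i) (T.t i)) ≤ B i) :
    LipDom T n κ B u u' ∧
      LipDom T n κ B (fun i => Dt (T.δ i) (u i)) (fun i => Dt (T.δ i) (u' i)) ∧
      LipDom T n κ B (fun i s x => s * dx (u i s) x) (fun i s x => s * dx (u' i s) x) := by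
  have esub : ∀ i, EqOn (fun s => toL2 ((u i - u' i) s))
      ((fun s => toL2 (u i s)) + (-1 : ℝ) • fun s => toL2 (u' i s)) (Ioc 0 (T.δ i)) := by
    intro i s hs
    simp only [Pi.add_apply, Pi.smul_apply, Pi.sub_apply]
    rw [toL2_sub (hmem i s hs) (hmem' i s hs)]
    simp [sub_eq_add_neg]
  obtain ⟨a1, a2, a3⟩ := Dom.of_tilde (B := fun _ => r) hκ hmem hjet hb
  obtain ⟨b1, b2, b3⟩ := Dom.of_tilde (B := fun _ => r) hκ hmem' hjet' hb'
  obtain ⟨c1, c2, c3⟩ := Dom.of_tilde (T := T) (u := fun i => u i - u' i) hκ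
    (fun i s hs => (hmem i s hs).sub (hmem' i s hs))
    (fun i => ((hjet i).add ((hjet' i).smul (-1))).congr (esub i)) hbd
  refine ⟨⟨a1.of_bounded, b1.of_bounded, c1⟩, ⟨a2.of_bounded, b2.of_bounded, c2.congr ?_⟩,
    ⟨a3.of_bounded, b3.of_bounded, c3.congr ?_⟩⟩
  · intro i s hs
    have h1 := ((hjet i).1.add ((hjet' i).1.smul (-1))).eq hs
    have h2 : DL2 (T.δ i) (fun s => toL2 ((u i - u' i) s)) s =
        DL2 (T.δ i) (fun s => toL2 (u i s)) s - DL2 (T.δ i) (fun s => toL2 (u' i s)) s := by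
      rw [DL2_congr (esub i) hs, h1]
      simp [sub_eq_add_neg]
    filter_upwards [Lp.coeFn_sub (DL2 (T.δ i) (fun s => toL2 (u i s)) s)
      (DL2 (T.δ i) (fun s => toL2 (u' i s)) s)] with x hx
    simp only [Dt]
    rw [h2, hx, Pi.sub_apply]
  · intro i s hs
    have h1 := (((hjet i).2.1 s hs).sub ((hjet' i).2.1 s hs)).wderiv_eq
    rw [← toL2_sub (hmem i s hs) (hmem' i s hs)] at h1
    filter_upwards [Lp.coeFn_sub (wderiv (toL2 (u i s))) (wderiv (toL2 (u' i s)))] with x hx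
    simp only [dx, Pi.sub_apply]
    rw [h1, hx, Pi.sub_apply, mul_sub]

/-- The asymptotic orders of the two components of the source operator. -/
theorem LipDom.gowdyF {k Ps Pss Qs Qss : ℝ → ℝ} (hn : 1 ≤ n)
    (hk : ContDiff ℝ ∞ k) (hkper : Function.Periodic k (2 * Real.pi)) (hkpos : ∀ x, 0 < k x)
    (hPs : MemSobolev (n + 1) Ps) (hPss : MemSobolev (n + 1) Pss)
    (hQs : MemSobolev (n + 1) Qs) (hQss : MemSobolev (n + 1) Qss) (hPscont : Continuous Ps)
    {α₀ α₁ : ℝ → ℝ} (hα₀ : Continuous α₀) (hα₁ : Continuous α₁) (hα₀pos : ∀ x, 0 < α₀ x)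
    (hα₁pos : ∀ x, 0 < α₁ x) (hB : ∀ i, 0 ≤ B i) {w w' : ι → Fin 2 → ℝ → ℝ → ℝ}
    (h0 : LipDom T n α₀ B (fun i => w i 0) (fun i => w' i 0))
    (h0D : LipDom T n α₀ B (fun i => Dt (T.δ i) (w i 0)) (fun i => Dt (T.δ i) (w' i 0)))
    (h0X : LipDom T n α₀ B (fun i s x => s * dx (w i 0 s) x) (fun i s x => s * dx (w' i 0 s) x))
    (h1D : LipDom T n (fun x => α₁ x + 2 * k x) B (fun i => Dt (T.δ i) (w i 1))
      (fun i => Dt (T.δ i) (w' i 1)))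
    (h1X : LipDom T n (fun x => α₁ x + 2 * k x) B (fun i s x => s * dx (w i 1 s) x)
      (fun i s x => s * dx (w' i 1 s) x)) :
    LipDom T n (fun x => 2 * (Ps x + min 1 (2 * k x))) B
      (fun i => gowdyF (T.δ i) k Ps Pss Qs Qss (w i) 0)
      (fun i => gowdyF (T.δ i) k Ps Pss Qs Qss (w' i) 0) ∧
    LipDom T n (fun x => min (α₀ x + 2 * k x) (min 1 (α₀ x) + min 1 (α₁ x + 2 * k x))) B
      (fun i => gowdyF (T.δ i) k Ps Pss Qs Qss (w i) 1)
      (fun i => gowdyF (T.δ i) k Ps Pss Qs Qss (w' i) 1) := by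
  have hkc : Continuous k := hk.continuous
  have hk' := (contDiff_infty_iff_deriv.1 hk).2
  have hk'per : Function.Periodic (deriv k) (2 * Real.pi) := fun x => by
    rw [← deriv_comp_add_const, show (fun y => k (y + 2 * Real.pi)) = k from funext hkper]
  have per2 : Function.Periodic (fun x => 2 * k x) (2 * Real.pi) := fun x => by
    simp only [hkper x]
  have dk : Dom T n (fun _ => 0) (fun _ => 1) (fun _ _ x => k x) :=
    Dom.of_time_indep (memLp_of_continuousOn hkc.continuousOn) (hasJets_of_smooth hk hkper)
  have dk' : Dom T n (fun _ => 0) (fun _ => 1) (fun _ _ x => deriv k x) :=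
    Dom.of_time_indep (memLp_of_continuousOn hk'.continuous.continuousOn)
      (hasJets_of_smooth hk' hk'per)
  have dt2k : Dom T n (fun x => 2 * k x) (fun _ => 1) (fun _ s x => s ^ (2 * k x)) :=
    Dom.rpow hn (by fun_prop) (hasJets_of_smooth (contDiff_const.mul hk) per2)
  have dtP : Dom T n Ps (fun _ => 1) (fun _ s x => s ^ Ps x) :=
    Dom.rpow hn hPscont hPs.hasJets.of_succ
  have dt : Dom T n (fun _ => 1) (fun _ => 1) (fun _ s _ => s) :=
    (Dom.rpow (f := fun _ => 1) hn continuous_const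
      (hasJets_of_smooth contDiff_const fun _ => rfl)).congr' fun i s x _ => (Real.rpow_one s).symm
  have dlog : Dom T n (fun _ => 0) (fun _ => 1) (fun _ s _ => Real.log s) := Dom.log
  have dS : ∀ {f : ℝ → ℝ}, MemSobolev (n + 1) f →
      Dom T n (fun _ => 0) (fun _ => 1) (fun _ _ x => f x) := fun h =>
    Dom.of_time_indep h.memLp h.hasJets.of_succ
  have dSx : ∀ {f : ℝ → ℝ}, MemSobolev (n + 1) f →
      Dom T n (fun _ => 0) (fun _ => 1) (fun _ _ x => dx f x) := fun h =>
    Dom.of_time_indep (Lp.memLp _) (by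
      rw [dx, toL2_self]
      exact h.hasJets.2)
  have dePss : Dom T n (fun _ => 0) (fun _ => 1) (fun _ _ x => Real.exp (Pss x)) := by
    obtain ⟨C, hC⟩ := hPss.hasJets.1.exists_essBdd
    refine (dS hPss).exp hn continuous_const ⟨Real.exp C, fun i => ?_⟩
    filter_upwards [hC.2, toL2_coe hPss.memLp] with x h1 h2
    rw [Real.rpow_zero, mul_one, ← h2]
    exact Real.exp_le_exp.2 ((le_abs_self _).trans h1)
  have L : ∀ {κ : ℝ → ℝ} {u : ι → ℝ → ℝ → ℝ}, Dom T n κ (fun _ => 1) u → LipDom T n κ B u u :=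
    fun h => LipDom.of_dom h
  have lA : LipDom T n Ps B
      (fun i s x => s ^ Ps x * Real.exp (Pss x) * Real.exp (w i 0 s x))
      (fun i s x => s ^ Ps x * Real.exp (Pss x) * Real.exp (w' i 0 s x)) := by
    have := ((L dtP).mul hn (L dePss) hB).mul hn (h0.exp hn hα₀pos hB) hB
    simpa using this
  -- The data term `t^{2k} Q_**` fixes the order; `D w` of the second component has the higher order
  -- `α₁ + 2k`.
  have lR : LipDom T n (fun x => 2 * k x) B
      (fun i s x => 2 * k x * s ^ (2 * k x) * Qss x + Dt (T.δ i) (w i 1) s x)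
      (fun i s x => 2 * k x * s ^ (2 * k x) * Qss x + Dt (T.δ i) (w' i 1) s x) := by
    refine LipDom.add ?_ (h1D.mono (by fun_prop) fun x => by linarith [hα₁pos x])
    have := (((L dk).const_mul 2).mul hn (L dt2k) hB).mul hn (L (dS hQss)) hB
    simpa using this
  have lS : LipDom T n (fun x => min 1 (α₁ x + 2 * k x)) B
      (fun i s x => s * dx Qs x + 2 * deriv k x * s ^ (2 * k x) * s * Real.log s * Qss x
          + s ^ (2 * k x) * s * dx Qss x + s * dx (w i 1 s) x)
      (fun i s x => s * dx Qs x + 2 * deriv k x * s ^ (2 * k x) * s * Real.log s * Qss x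
          + s ^ (2 * k x) * s * dx Qss x + s * dx (w' i 1 s) x) := by
    have hc : Continuous fun x => min 1 (α₁ x + 2 * k x) := by fun_prop
    -- Each data term contains a factor `t`, so has order at least `1` (the logarithm costs
    -- nothing); only `t ∂ₓ w` brings in `α₁ + 2k`.
    refine LipDom.add (LipDom.add (LipDom.add ?_ ?_) ?_) ?_
    · refine ((L dt).mul hn (L (dSx hQs)) hB).mono hc fun x => ?_
      linarith [min_le_left 1 (α₁ x + 2 * k x)]
    · refine ((((((L dk').const_mul 2).mul hn (L dt2k) hB).mul hn (L dt) hB).mul hn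
        (L dlog) hB).mul hn (L (dS hQss)) hB).mono hc fun x => ?_
      linarith [min_le_left 1 (α₁ x + 2 * k x), hkpos x]
    · refine (((L dt2k).mul hn (L dt) hB).mul hn (L (dSx hQss)) hB).mono hc fun x => ?_
      linarith [min_le_left 1 (α₁ x + 2 * k x), hkpos x]
    · exact h1X.mono hc fun _ => min_le_right _ _
  have lV : LipDom T n (fun x => min 1 (α₀ x)) B
      (fun i s x => s * dx Ps x * Real.log s + s * dx Pss x + s * dx (w i 0 s) x)
      (fun i s x => s * dx Ps x * Real.log s + s * dx Pss x + s * dx (w' i 0 s) x) := by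
    have hc : Continuous fun x => min 1 (α₀ x) := by fun_prop
    refine LipDom.add (LipDom.add ?_ ?_) (h0X.mono hc fun _ => min_le_right _ _)
    · refine (((L dt).mul hn (L (dSx hPs)) hB).mul hn (L dlog) hB).mono hc fun x => ?_
      linarith [min_le_left 1 (α₀ x)]
    · refine ((L dt).mul hn (L (dSx hPss)) hB).mono hc fun x => ?_
      linarith [min_le_left 1 (α₀ x)]
  constructor
  · have hc : Continuous fun x => 2 * (Ps x + min 1 (2 * k x)) := by fun_prop
    have q1 := lA.mul hn lR hB
    have q2 := lA.mul hn lS hB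
    have q3 := (q1.mul hn q1 hB).mono hc fun x => by
      linarith [min_le_right 1 (2 * k x)]
    have q4 := (q2.mul hn q2 hB).mono hc fun x => by
      have : min 1 (2 * k x) ≤ min 1 (α₁ x + 2 * k x) :=
        min_le_min le_rfl (by linarith [hα₁pos x])
      linarith
    refine (q3.sub q4).congr (fun i s x _ => ?_) (fun i s x _ => ?_) <;>
    · simp only [GowdyFuchs.gowdyF, Matrix.cons_val_zero]
      ring
  · have hc : Continuous fun x =>
        min (α₀ x + 2 * k x) (min 1 (α₀ x) + min 1 (α₁ x + 2 * k x)) := by fun_prop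
    have q1 := ((h0D.const_mul (-2)).mul hn lR hB).mono hc fun _ => min_le_left _ _
    have q2 := ((lV.const_mul 2).mul hn lS hB).mono hc fun _ => min_le_right _ _
    refine (q1.add q2).congr (fun i s x _ => ?_) (fun i s x _ => ?_) <;>
    · simp only [GowdyFuchs.gowdyF, Matrix.cons_val_one, Matrix.cons_val_zero]

end

/-! ### Energies as finite sums of weighted norms -/

section
variable {N : ℕ} {δ : ℝ} {lam al : Fin N → ℝ → ℝ} {s : ℕ → ℝ} {l : ℕ} {w : Fin N → ℝ → ℝ → ℝ}
  {t : ℝ}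

theorem slice_term_nonneg (ht : 0 < t) (i : Fin N) (p q : ℕ) :
    0 ≤ ∫ x, t ^ (2 * (lam i x - al i x + s q)) * (mixedDeriv δ p q (w i) t x) ^ 2 ∂measU :=
  integral_nonneg fun _ => mul_nonneg (Real.rpow_nonneg ht.le _) (sq_nonneg _)

theorem slice_nonneg (ht : 0 < t) (p j : ℕ) : 0 ≤ slice δ lam al s p j w t :=
  Finset.sum_nonneg fun i _ => Finset.sum_nonneg fun _ _ => Finset.sum_nonneg fun _ _ =>
    slice_term_nonneg ht i _ _

theorem slice_term_eq (hl : ∀ i, Continuous (lam i)) (ha : ∀ i, Continuous (al i)) (ht : 0 < t)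
    (i : Fin N) (p q : ℕ) :
    ∫ x, t ^ (2 * (lam i x - al i x + s q)) * (mixedDeriv δ p q (w i) t x) ^ 2 ∂measU =
      (t ^ s q * wn (fun x => al i x - lam i x) t (mixedDeriv δ p q (w i) t)) ^ 2 := by
  rw [mul_pow, wn_sq (μ := fun x => al i x - lam i x) ((ha i).sub (hl i)) ht, ← integral_const_mul]
  refine integral_congr_ae (ae_of_all _ fun x => ?_)
  simp only
  rw [← mul_assoc, ← Real.rpow_natCast (t ^ s q) 2, ← Real.rpow_mul ht.le, ← Real.rpow_add ht]
  congr 2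
  push_cast
  ring

theorem energy_nonneg : 0 ≤ energy δ lam al s l w t := Real.sqrt_nonneg _

theorem wn_mixedDeriv_le_energy (hl : ∀ i, Continuous (lam i)) (ha : ∀ i, Continuous (al i))
    (ht : 0 < t) (i : Fin N) {p q : ℕ} (hpq : p + q ≤ l) :
    t ^ s q * wn (fun x => al i x - lam i x) t (mixedDeriv δ p q (w i) t) ≤
      energy δ lam al s l w t := by
  refine Real.le_sqrt_of_sq_le ?_
  rw [← slice_term_eq hl ha ht]
  calc _ ≤ slice δ lam al s p (l - p) w t := by
        rw [slice]
        refine le_trans ?_ (Finset.single_le_sum (fun j _ => Finset.sum_nonneg fun _ _ =>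
          Finset.sum_nonneg fun _ _ => slice_term_nonneg ht j _ _) (Finset.mem_univ i))
        refine le_trans ?_ (Finset.single_le_sum (fun j _ => Finset.sum_nonneg fun _ _ =>
          slice_term_nonneg ht i _ _) (Finset.mem_range.2 (Nat.lt_succ_self p)))
        exact Finset.single_le_sum (f := fun q => ∫ x, t ^ (2 * (lam i x - al i x + s q)) *
          (mixedDeriv δ p q (w i) t x) ^ 2 ∂measU) (fun j _ => slice_term_nonneg ht i _ _)
          (Finset.mem_range.2 (by omega))
    _ ≤ _ := Finset.single_le_sum (f := fun p => slice δ lam al s p (l - p) w t)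
          (fun j _ => slice_nonneg ht _ _) (Finset.mem_range.2 (by omega))

theorem exists_energy_le (N l : ℕ) : ∃ K, 0 ≤ K ∧ ∀ (δ : ℝ) (lam al : Fin N → ℝ → ℝ) (s : ℕ → ℝ)
    (w : Fin N → ℝ → ℝ → ℝ) (t b : ℝ), (∀ i, Continuous (lam i)) → (∀ i, Continuous (al i)) →
    0 < t → 0 ≤ b → (∀ i p q, p + q ≤ l →
      t ^ s q * wn (fun x => al i x - lam i x) t (mixedDeriv δ p q (w i) t) ≤ b) →
    energy δ lam al s l w t ≤ K * b := by
  -- The radicand bounds the number of integrals in the energy: at most `l + 1` values of each of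
  -- `p`, `p'`, `q`, and `N` components.
  refine ⟨Real.sqrt ((l + 1) * (N * ((l + 1) * (l + 1)))), Real.sqrt_nonneg _,
    fun δ lam al s w t b hl ha ht hb H => ?_⟩
  rw [energy]
  have hterm : ∀ i p q, p + q ≤ l → ∫ x, t ^ (2 * (lam i x - al i x + s q)) *
      (mixedDeriv δ p q (w i) t x) ^ 2 ∂measU ≤ b ^ 2 := by
    intro i p q hpq
    rw [slice_term_eq hl ha ht]
    exact pow_le_pow_left₀ (mul_nonneg (Real.rpow_nonneg ht.le _) (wn_nonneg _ _ _)) (H i p q hpq) 2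
  have hsum : ∑ p ∈ Finset.range (l + 1), slice δ lam al s p (l - p) w t ≤
      (l + 1) * (N * ((l + 1) * (l + 1))) * b ^ 2 := by
    have h1 : ∀ p ∈ Finset.range (l + 1), slice δ lam al s p (l - p) w t ≤
        N * ((l + 1) * (l + 1)) * b ^ 2 := by
      intro p hp
      rw [Finset.mem_range] at hp
      have h2 : ∀ i : Fin N, ∑ p' ∈ Finset.range (p + 1), ∑ q ∈ Finset.range (l - p + 1),
          ∫ x, t ^ (2 * (lam i x - al i x + s q)) * (mixedDeriv δ p' q (w i) t x) ^ 2 ∂measU ≤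
          ((l + 1) * (l + 1)) * b ^ 2 := by
        intro i
        calc _ ≤ ∑ p' ∈ Finset.range (p + 1), ∑ q ∈ Finset.range (l - p + 1), b ^ 2 :=
              Finset.sum_le_sum fun p' hp' => Finset.sum_le_sum fun q hq => by
                rw [Finset.mem_range] at hp' hq
                exact hterm i p' q (by omega)
          _ = ((p + 1 : ℕ) : ℝ) * ((l - p + 1 : ℕ) : ℝ) * b ^ 2 := by
              simp only [Finset.sum_const, Finset.card_range, nsmul_eq_mul]; ring
          _ ≤ ((l + 1 : ℕ) : ℝ) * ((l + 1 : ℕ) : ℝ) * b ^ 2 := by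
              have a1 : ((p + 1 : ℕ) : ℝ) ≤ ((l + 1 : ℕ) : ℝ) := Nat.cast_le.2 (by omega)
              have a2 : ((l - p + 1 : ℕ) : ℝ) ≤ ((l + 1 : ℕ) : ℝ) := Nat.cast_le.2 (by omega)
              gcongr
          _ = _ := by push_cast; ring
      rw [slice]
      calc _ ≤ ∑ _i : Fin N, ((l + 1) * (l + 1)) * b ^ 2 := Finset.sum_le_sum fun i _ => h2 i
        _ = _ := by simp; ring
    calc _ ≤ ∑ p ∈ Finset.range (l + 1), (N * ((l + 1) * (l + 1)) * b ^ 2 : ℝ) :=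
          Finset.sum_le_sum h1
      _ = _ := by simp; ring
  calc _ ≤ Real.sqrt ((l + 1) * (N * ((l + 1) * (l + 1))) * b ^ 2) := Real.sqrt_le_sqrt hsum
    _ = _ := by rw [Real.sqrt_mul (by positivity), Real.sqrt_sq hb]

/-- At a fixed `t` each slice is at most its supremum, so the sum of suprema dominates the energy.
-/
theorem energy_le_of_wnorm_le {r : ℝ} (hr : 0 ≤ r) (ht : t ∈ Ioc 0 δ)
    (h : wnorm δ lam al s l w ≤ ENNReal.ofReal r) : energy δ lam al s l w t ≤ r := by
  rw [← ENNReal.ofReal_le_ofReal_iff hr]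
  refine le_trans ?_ h
  rw [energy, wnorm, Real.sqrt_eq_rpow,
    ← ENNReal.ofReal_rpow_of_nonneg (Finset.sum_nonneg fun _ _ => slice_nonneg ht.1 _ _) (by norm_num)]
  refine ENNReal.rpow_le_rpow ?_ (by norm_num)
  rw [ENNReal.ofReal_sum_of_nonneg fun _ _ => slice_nonneg ht.1 _ _]
  refine Finset.sum_le_sum fun p _ => ?_
  rw [← Real.sq_sqrt (slice_nonneg ht.1 p (l - p)), ENNReal.ofReal_pow (Real.sqrt_nonneg _)]
  exact pow_le_pow_left₀ zero_le (le_iSup₂ (f := fun t (_ : t ∈ Ioc 0 δ) =>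
    ENNReal.ofReal (Real.sqrt (slice δ lam al s p (l - p) w t))) t ht) 2

theorem wnorm_lt_top {b : ℝ} (h : ∀ t ∈ Ioc 0 δ, energy δ lam al s l w t ≤ b) :
    wnorm δ lam al s l w < ⊤ := by
  rw [wnorm]
  refine ENNReal.rpow_lt_top_of_nonneg (by norm_num) (ne_of_lt ?_)
  refine ENNReal.sum_lt_top.2 fun p hp => ENNReal.pow_lt_top ?_
  refine lt_of_le_of_lt (iSup₂_le fun t ht => ENNReal.ofReal_le_ofReal ?_) ENNReal.ofReal_lt_top
    (b := ENNReal.ofReal b)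
  refine le_trans (Real.sqrt_le_sqrt ?_) (h t ht)
  exact Finset.single_le_sum (f := fun p => slice δ lam al s p (l - p) w t)
    (fun j _ => slice_nonneg ht.1 _ _) hp

end

/-! ### Comparison of exponents and conclusion -/

theorem continuous_gowdyLam {k : ℝ → ℝ} (hk : Continuous k) (i : Fin 2) :
    Continuous (gowdyLam k i) := by
  fin_cases i
  · exact continuous_const
  · exact continuous_const.mul hk

theorem Jet.of_memC {δ : ℝ} {m : ℕ} {w : ℝ → ℝ → ℝ} (h : ∀ p ≤ m, MemC δ p (m - p) w) :
    (∀ s ∈ Ioc 0 δ, MemLp (w s) 2 measU) ∧ Jet δ m (fun s => toL2 (w s)) := by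
  refine ⟨fun s hs => ?_, Jet.of_curveC fun p hp => (h p hp).curveC⟩
  obtain ⟨W, -, e⟩ := h 0 (Nat.zero_le _)
  exact (Lp.memLp (sobFn (W s))).ae_eq (e s hs).symm

/-- The source operator on families of functions bounded in `X̃_{δ,α,n+1}`: regularity, bounds and
Lipschitz bounds in the weighted norms. -/
theorem gowdyF_family {k Ps Pss Qs Qss : ℝ → ℝ} {n : ℕ} (hn : 1 ≤ n)
    (hk : ContDiff ℝ ∞ k) (hkper : Function.Periodic k (2 * Real.pi)) (hkpos : ∀ x, 0 < k x)
    (hPs : MemSobolev (n + 1) Ps) (hPss : MemSobolev (n + 1) Pss)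
    (hQs : MemSobolev (n + 1) Qs) (hQss : MemSobolev (n + 1) Qss) (hPscont : Continuous Ps)
    {α : Fin 2 → ℝ → ℝ} (hαcont : ∀ i, Continuous (α i)) (hαpos : ∀ i x, 0 < α i x)
    {ε : ℝ} (hε1 : ε < 1)
    (h1 : ∀ x, α 0 x + ε < min (2 * (Ps x + 2 * k x)) (2 * (Ps x + 1)))
    (h2 : ∀ x, α 1 x + ε < 2 * (1 - k x))
    (h3 : ∀ x, α 0 x - α 1 x > ε + max 0 (2 * k x - 1))
    {ι : Type*} (T : Fam ι) {r : ℝ} {w w' : ι → Fin 2 → ℝ → ℝ → ℝ}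
    (hw : ∀ i, w i ∈ Xt (T.δ i) (gowdyLam k) α (n + 1))
    (hw' : ∀ i, w' i ∈ Xt (T.δ i) (gowdyLam k) α (n + 1))
    (hr : ∀ i, Et (T.δ i) (gowdyLam k) α (n + 1) (w i) (T.t i) ≤ r)
    (hr' : ∀ i, Et (T.δ i) (gowdyLam k) α (n + 1) (w' i) (T.t i) ≤ r) :
    (∀ i j, (∀ s ∈ Ioc 0 (T.δ i), MemLp (gowdyF (T.δ i) k Ps Pss Qs Qss (w i) j s) 2 measU) ∧
      Jet (T.δ i) n (fun s => toL2 (gowdyF (T.δ i) k Ps Pss Qs Qss (w i) j s))) ∧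
    (∃ C, 0 ≤ C ∧ ∀ i, E (T.δ i) (gowdyLam k) (fun j x => α j x + ε) n
      (gowdyF (T.δ i) k Ps Pss Qs Qss (w i)) (T.t i) ≤ C) ∧
    (∃ C, 0 ≤ C ∧ ∀ i, E (T.δ i) (gowdyLam k) (fun j x => α j x + ε) n
      (gowdyF (T.δ i) k Ps Pss Qs Qss (w i) - gowdyF (T.δ i) k Ps Pss Qs Qss (w' i)) (T.t i) ≤
        C * Et (T.δ i) (gowdyLam k) α (n + 1) (w i - w' i) (T.t i)) := by
  have hlam := continuous_gowdyLam hk.continuous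
  set B : ι → ℝ := fun i => Et (T.δ i) (gowdyLam k) α (n + 1) (w i - w' i) (T.t i) with hBdef
  have hB : ∀ i, 0 ≤ B i := fun i => energy_nonneg
  have low : ∀ (i : ι) (v : Fin 2 → ℝ → ℝ → ℝ) (j : Fin 2) (p q : ℕ), p + q ≤ n + 1 →
      (if q = n + 1 then T.t i else 1) * wn (fun x => α j x - gowdyLam k j x) (T.t i)
        (mixedDeriv (T.δ i) p q (v j) (T.t i)) ≤
      Et (T.δ i) (gowdyLam k) α (n + 1) v (T.t i) := by
    intro i v j p q hpq
    have := wn_mixedDeriv_le_energy (δ := T.δ i) (s := topWeight (n + 1)) (w := v) hlam hαcont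
      (T.mem i).1 j hpq
    refine le_trans (le_of_eq ?_) this
    congr 1
    rw [topWeight]
    split_ifs
    · rw [Real.rpow_one]
    · rw [Real.rpow_zero]
  have atoms : ∀ j, _ := fun j : Fin 2 => LipDom.of_tilde (T := T) (n := n) (B := B) (r := r)
    (κ := fun x => α j x - gowdyLam k j x)
    (u := fun i => w i j) (u' := fun i => w' i j) ((hαcont j).sub (hlam j))
    (fun i => (Jet.of_memC ((hw i).1 j)).1) (fun i => (Jet.of_memC ((hw' i).1 j)).1)
    (fun i => (Jet.of_memC ((hw i).1 j)).2) (fun i => (Jet.of_memC ((hw' i).1 j)).2)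
    (fun i p q hpq => (low i (w i) j p q hpq).trans (hr i))
    (fun i p q hpq => (low i (w' i) j p q hpq).trans (hr' i))
    (fun i p q hpq => low i (w i - w' i) j p q hpq)
  have e0 : (fun x => α 0 x - gowdyLam k 0 x) = α 0 := by
    funext x; simp [gowdyLam]
  have e1 : (fun x => α 1 x - gowdyLam k 1 x) = fun x => α 1 x + 2 * k x := by
    funext x; simp [gowdyLam]
  have at0 := atoms 0
  have at1 := atoms 1
  rw [e0] at at0
  rw [e1] at at1
  obtain ⟨F0, F1⟩ := LipDom.gowdyF hn hk hkper hkpos hPs hPss hQs hQss hPscont (hαcont 0)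
    (hαcont 1) (hαpos 0) (hαpos 1) hB at0.1 at0.2.1 at0.2.2 at1.2.1 at1.2.2
  -- the target exponents are smaller than the exponents obtained
  have ex : ∀ j : Fin 2, ∃ κ : ℝ → ℝ, LipDom T n κ B
      (fun i => gowdyF (T.δ i) k Ps Pss Qs Qss (w i) j)
      (fun i => gowdyF (T.δ i) k Ps Pss Qs Qss (w' i) j) ∧
      ∀ x, α j x + ε - gowdyLam k j x < κ x := by
    intro j
    fin_cases j
    · refine ⟨_, F0, fun x => ?_⟩
      have a1 := (h1 x).trans_le (min_le_left _ _)
      have a2 := (h1 x).trans_le (min_le_right _ _)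
      have : gowdyLam k 0 x = 0 := rfl
      simp only [Fin.zero_eta, this]
      rcases min_choice 1 (2 * k x) with h | h <;> rw [h] <;> linarith
    · refine ⟨_, F1, fun x => ?_⟩
      have a1 := h2 x
      have a2 := h3 x
      have a3 := le_max_left 0 (2 * k x - 1)
      have a4 := le_max_right 0 (2 * k x - 1)
      have a5 := hαpos 0 x
      have a6 := hαpos 1 x
      have a7 := hkpos x
      have : gowdyLam k 1 x = -2 * k x := rfl
      simp only [Fin.mk_one, this]
      refine lt_min (by linarith) ?_
      -- The sums `1 + 1`, `1 + (α 1 + 2k)`, `α 0 + 1`, `α 0 + (α 1 + 2k)` must exceed `α 1 + ε +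
      -- 2k`: use respectively `h2`, `ε < 1`, the `2k - 1` branch of `h3`, and `α 0 > α 1 + ε > ε`.
      rcases min_choice 1 (α 0 x) with h | h <;> rcases min_choice 1 (α 1 x + 2 * k x) with h' | h' <;>
        rw [h, h'] <;> linarith
  choose κ hκ hlt using ex
  have hlt' : ∀ j x, α j x + ε - gowdyLam k j x < κ j x := hlt
  have hμc : ∀ j, Continuous fun x => α j x + ε - gowdyLam k j x := fun j =>
    ((hαcont j).add continuous_const).sub (hlam j)
  obtain ⟨K, hK, HK⟩ := exists_energy_le 2 n
  have fin : ∀ (B' : ι → ℝ) (v : ι → Fin 2 → ℝ → ℝ → ℝ), (∀ i, 0 ≤ B' i) →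
      (∀ j, Dom T n (κ j) B' (fun i => v i j)) → ∃ C, 0 ≤ C ∧ ∀ i,
        E (T.δ i) (gowdyLam k) (fun j x => α j x + ε) n (v i) (T.t i) ≤ C * B' i := by
    intro B' v hB' hv
    choose C hC H using fun j => (hv j).2.2.2 _ (hμc j) (hlt' j)
    -- The sum serves as a common bound for the constants of the two components.
    refine ⟨K * (C 0 + C 1), mul_nonneg hK (add_nonneg (hC 0) (hC 1)), fun i => ?_⟩
    rw [mul_assoc]
    refine HK _ _ _ _ _ _ _ hlam (fun j => (hαcont j).add continuous_const) (T.mem i).1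
      (mul_nonneg (add_nonneg (hC 0) (hC 1)) (hB' i)) fun j p q hpq => ?_
    rw [Pi.zero_apply, Real.rpow_zero, one_mul]
    refine (mixed_le_NN (δ := T.δ i) (u := fun s => toL2 (v i j s)) hpq).trans ((H j i).trans ?_)
    refine mul_le_mul_of_nonneg_right ?_ (hB' i)
    have c0 := hC 0
    have c1 := hC 1
    fin_cases j
    · exact le_add_of_nonneg_right c1
    · exact le_add_of_nonneg_left c0
  refine ⟨fun i j => ⟨(hκ j).left.1 i, (hκ j).left.2.2.1 i⟩, ?_, ?_⟩
  · obtain ⟨C, hC, H⟩ := fin (fun _ => 1) _ (fun _ => zero_le_one) fun j => (hκ j).left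
    exact ⟨C, hC, fun i => by simpa using H i⟩
  · exact fin B (fun i => gowdyF (T.δ i) k Ps Pss Qs Qss (w i) -
      gowdyF (T.δ i) k Ps Pss Qs Qss (w' i)) hB fun j => (hκ j).diff

end GowdyFuchs

end

theorem lemma4p1
    (k : ℝ → ℝ) (hk : ContDiff ℝ ∞ k) (hkper : Function.Periodic k (2 * Real.pi))
    (hkpos : ∀ x, 0 < k x)
    (m : ℕ) (hm : 2 ≤ m)
    (Ps Pss Qs Qss : ℝ → ℝ)
    (hPs : MemSobolev m Ps) (hPss : MemSobolev m Pss)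
    (hQs : MemSobolev m Qs) (hQss : MemSobolev m Qss)
    (hPscont : Continuous Ps) (hPsper : Function.Periodic Ps (2 * Real.pi))
    (α : Fin 2 → ℝ → ℝ) (hαcont : ∀ i, Continuous (α i))
    (hαper : ∀ i, Function.Periodic (α i) (2 * Real.pi)) (hαpos : ∀ i x, 0 < α i x)
    (ε : ℝ) (hε : 0 < ε) (hε1 : ε < 1)
    (h1 : ∀ x, α 0 x + ε < min (2 * (Ps x + 2 * k x)) (2 * (Ps x + 1)))
    (h2 : ∀ x, α 1 x + ε < 2 * (1 - k x))
    (h3 : ∀ x, α 0 x - α 1 x > ε + max 0 (2 * k x - 1)) :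
    (∀ δ : ℝ, 0 < δ →
      MapsTo (gowdyF δ k Ps Pss Qs Qss) (Xt δ (gowdyLam k) α m)
        (X δ (gowdyLam k) (fun i x => α i x + ε) (m - 1))) ∧
    (∀ δ₀ : ℝ, 0 < δ₀ → ∀ r : ℝ, 0 < r → ∃ C : ℝ, 0 < C ∧
      ∀ δ : ℝ, 0 < δ → δ ≤ δ₀ →
        ∀ w ∈ Xt δ (gowdyLam k) α m, ∀ w' ∈ Xt δ (gowdyLam k) α m,
          normXt δ (gowdyLam k) α m w ≤ ENNReal.ofReal r →
          normXt δ (gowdyLam k) α m w' ≤ ENNReal.ofReal r →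
          ∀ t ∈ Ioc 0 δ,
            E δ (gowdyLam k) (fun i x => α i x + ε) (m - 1)
                (gowdyF δ k Ps Pss Qs Qss w - gowdyF δ k Ps Pss Qs Qss w') t
              ≤ C * Et δ (gowdyLam k) α m (w - w') t) := by
  obtain ⟨n, rfl⟩ : ∃ n, m = n + 1 := ⟨m - 1, by omega⟩
  have hn : 1 ≤ n := by omega
  rw [Nat.add_sub_cancel]
  constructor
  · intro δ hδ w hw
    -- With `δ` and `w` fixed the index is the time alone, so a bound uniform over the family is
    -- finiteness of the norm.
    let T : Fam (Ioc 0 δ) := ⟨fun _ => δ, fun t => t, δ, fun t => t.2, fun _ => le_rfl⟩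
    have hr : ∀ t ∈ Ioc 0 δ, Et δ (gowdyLam k) α (n + 1) w t ≤
        (normXt δ (gowdyLam k) α (n + 1) w).toReal := fun t ht =>
      energy_le_of_wnorm_le ENNReal.toReal_nonneg ht (ENNReal.ofReal_toReal hw.2.ne).ge
    obtain ⟨hJ, ⟨C, hC, H⟩, -⟩ := gowdyF_family hn hk hkper hkpos hPs hPss hQs hQss hPscont hαcont
      hαpos hε1 h1 h2 h3 T (w := fun _ => w) (w' := fun _ => w) (fun _ => hw) (fun _ => hw)
      (fun i => hr i i.2) (fun i => hr i i.2)
    refine ⟨fun j p hp => ?_, wnorm_lt_top (b := C) fun t ht => H ⟨t, ht⟩⟩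
    -- Regularity concerns the whole interval and not the marked time, so any index will do.
    have hJ' := hJ ⟨δ, ⟨hδ, le_rfl⟩⟩ j
    exact (hJ'.2.curveC (by omega)).memC hJ'.1
  · intro δ₀ hδ₀ r hr
    -- All admissible quadruples `(δ, t, w, w')` form a single family, so one constant serves every
    -- `δ ≤ δ₀`.
    let T : Fam {a : ℝ × ℝ × (Fin 2 → ℝ → ℝ → ℝ) × (Fin 2 → ℝ → ℝ → ℝ) //
        a.1 ≤ δ₀ ∧ a.2.1 ∈ Ioc 0 a.1 ∧ a.2.2.1 ∈ Xt a.1 (gowdyLam k) α (n + 1) ∧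
        a.2.2.2 ∈ Xt a.1 (gowdyLam k) α (n + 1) ∧
        normXt a.1 (gowdyLam k) α (n + 1) a.2.2.1 ≤ ENNReal.ofReal r ∧
        normXt a.1 (gowdyLam k) α (n + 1) a.2.2.2 ≤ ENNReal.ofReal r} :=
      ⟨fun a => a.1.1, fun a => a.1.2.1, δ₀, fun a => a.2.2.1, fun a => a.2.1⟩
    obtain ⟨-, -, C, hC, H⟩ := gowdyF_family hn hk hkper hkpos hPs hPss hQs hQss hPscont hαcont
      hαpos hε1 h1 h2 h3 T (r := r) (w := fun a => a.1.2.2.1) (w' := fun a => a.1.2.2.2)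
      (fun a => a.2.2.2.1) (fun a => a.2.2.2.2.1)
      (fun a => energy_le_of_wnorm_le hr.le a.2.2.1 a.2.2.2.2.2.1)
      (fun a => energy_le_of_wnorm_le hr.le a.2.2.1 a.2.2.2.2.2.2)
    -- Adding `1` makes the nonnegative constant positive.
    refine ⟨C + 1, by linarith, fun δ _ hδ w hw w' hw' hwr hwr' t ht => ?_⟩
    refine (H ⟨(δ, t, w, w'), hδ, ht, hw, hw', hwr, hwr'⟩).trans ?_
    exact mul_le_mul_of_nonneg_right (by linarith) energy_nonneg
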